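/- Let $d>3$. Let $AE_d$ be the split real Kac–Moody algebra with Chevalley generators $e_i,f_i,h_i$ ($1\le i\le d$), Chevalley–Serre relations, and simply-laced Dynkin diagram in which the nodes $1,\dots,d-1$ form a line and the node $d$ is joined exactly to the nodes $2$ and $d-1$. Let $\omega$ be the Cartan–Chevalley involution ($e_i\mapsto -f_i$, $f_i\mapsto -e_i$, $h_i\mapsto -h_i$), let $K(AE_d)=\{x:\omega(x)=x\}$ and let $x_i=e_i-f_i$. Identify the root lattice with the lattice in $\mathbb Z^d$ spanned by $$\alpha_i=(0,\dots,0,1,-1,0,\dots,0)\ (i<d,\ 1\text{ in position } i),\qquad \alpha_d=(0,0,1,\dots,1,2),$$ with scalar product $p\cdot q=\sum_a p_aq_a-\frac1{d-1}\left(\sum_a p_a\right)\left(\sum_a q_a\right)$; then $\alpha_i\cdot\alpha_j$ is the Cartan matrix, and $\sum_a p_a$ is divisible by $d-1$ for every $\alpha=(p_1,\dots,p_d)$ in the root lattice. A real root is a root $\alpha$ (an element of the root lattice whose root space $(AE_d)_\alpha=\{x:[h_i,x]=(\alpha_i\cdot\alpha)\,x\ \ \forall i\}$ is non-zero) with $\alpha\cdot\alpha>0$.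 Let $\Gamma_0,\dots,\Gamma_d$ be real $N\times N$ matrices with $\Gamma_\mu\Gamma_\nu+\Gamma_\nu\Gamma_\mu=2\eta_{\mu\nu}\mathbf 1$, $\eta=\mathrm{diag}(-1,1,\dots,1)$; such matrices exist for some $N>0$, and they can be chosen with $\Gamma_0$ antisymmetric and $\Gamma_1,\dots,\Gamma_d$ symmetric. Put $\Gamma_*=\Gamma_0\Gamma_1\cdots\Gamma_d$, write $\Gamma_{ab\cdots}=\Gamma_a\Gamma_b\cdots$ for distinct indices, and let $$\Gamma(\alpha_i)=\Gamma_{i,i+1}\ (i<d),\qquad \Gamma(\alpha_d)=\Gamma_{345\cdots d-1}\Gamma_*=\Gamma_*\Gamma_{345\cdots d-1}=(-1)^{\frac{(d-2)(d-3)}2}\Gamma_{012d}$$ (the last two equalities are part of the claim). Then: 1. The matrices $J_i=\frac12\Gamma(\alpha_i)$ satisfy the Berman relations $[J_i,[J_i,J_j]]+J_j=0$ if $i,j$ are joined, and $[J_i,J_j]=0$ otherwise. 2. There is exactly one homomorphism of Lie algebras $\rho:K(AE_d)\to\mathfrak{gl}(N,\mathbb R)$ with $\rho(x_i)=\frac12\Gamma(\alpha_i)$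 for all $i$. 3. For $\alpha=(p_1,\dots,p_d)$ in the root lattice put $\Gamma(\alpha)=\Gamma_1^{p_1}\cdots\Gamma_d^{p_d}\,\Gamma_*^{\frac1{d-1}\sum_a p_a}$. The simple roots are real roots, on them this agrees with the matrices above, and $\Gamma(\alpha+\beta)=\pm\Gamma(\alpha)\Gamma(\beta)$ for all $\alpha,\beta$ in the root lattice. For every real root $\alpha$ there is $e\in(AE_d)_\alpha$ such that $([e,-\omega(e)],\,e,\,-\omega(e))$ is an $\mathfrak{sl}_2$-triple and $\rho(e+\omega(e))=J(\alpha):=\frac12\Gamma(\alpha)$. 4. $\rho$ is double-valued: $\exp(2\pi J(\alpha))=-\mathbf 1$ for every real root $\alpha$. 5. For all $\alpha,\beta$ in the root lattice, $\alpha\cdot\beta\in\mathbb Z$, $\alpha\cdot\alpha\in2\mathbb Z$ and $$\Gamma(\alpha)\Gamma(\beta)=(-1)^{\alpha\cdot\beta}\,\Gamma(\beta)\Gamma(\alpha),\qquad \Gamma(\alpha)^2=(-1)^{\frac12\alpha\cdot\alpha}\,\mathbf 1,$$ and, if $\Gamma_0$ is antisymmetric and $\Gamma_1,\dots,\Gamma_d$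 are symmetric, also $\Gamma(\alpha)^T=(-1)^{\frac12\alpha\cdot\alpha}\,\Gamma(\alpha)$. -/

import Mathlib

/-! Associative algebras carry the commutator bracket. -/
attribute [local instance] LieRing.ofAssociativeRing

noncomputable section

/-! ## Split real Kac-Moody algebras and their maximal compact subalgebras -/

namespace KacMoody

section General

variable {ι : Type} [DecidableEq ι] (A : Matrix ι ι ℤ)

/-- The split real Lie algebra with Chevalley generators `e i`, `f i`, `h i` and the
Chevalley-Serre relations of the generalised Cartan matrix `A`. -/
abbrev Alg : Type := Matrix.ToLieAlgebra ℝ A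

/-- The quotient map from the free Lie algebra on the Chevalley generators. -/
def proj : FreeLieAlgebra ℝ (CartanMatrix.Generators ι) →ₗ⁅ℝ⁆ Alg A where
  toFun x := (LieSubmodule.Quotient.mk x :
    FreeLieAlgebra ℝ (CartanMatrix.Generators ι) ⧸ CartanMatrix.Relations.toIdeal ℝ A)
  map_add' _ _ := rfl
  map_smul' _ _ := rfl
  map_lie' := rfl

def h (i : ι) : Alg A := proj A (FreeLieAlgebra.of ℝ (CartanMatrix.Generators.H i))

def e (i : ι) : Alg A := proj A (FreeLieAlgebra.of ℝ (CartanMatrix.Generators.E i))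

def f (i : ι) : Alg A := proj A (FreeLieAlgebra.of ℝ (CartanMatrix.Generators.F i))

variable {A}

theorem proj_eq_zero {x : FreeLieAlgebra ℝ (CartanMatrix.Generators ι)}
    (hx : x ∈ CartanMatrix.Relations.toSet ℝ A) : proj A x = 0 :=
  LieSubmodule.Quotient.mk_eq_zero'.mpr (LieSubmodule.subset_lieSpan hx)

variable (A)

theorem lie_h_h (i j : ι) : ⁅h A i, h A j⁆ = 0 := by
  have := proj_eq_zero (A := A) (x := CartanMatrix.Relations.HH ℝ (i, j))
    (by simp [CartanMatrix.Relations.toSet])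
  simpa [h, e, f, CartanMatrix.Relations.HH, LieHom.map_lie] using this

theorem lie_h_e (i j : ι) : ⁅h A i, e A j⁆ = A i j • e A j := by
  have := proj_eq_zero (A := A) (x := CartanMatrix.Relations.HE ℝ A (i, j))
    (by simp [CartanMatrix.Relations.toSet])
  simpa [h, e, f, CartanMatrix.Relations.HE, LieHom.map_lie, sub_eq_zero] using this

theorem lie_h_f (i j : ι) : ⁅h A i, f A j⁆ = -(A i j • f A j) := by
  have := proj_eq_zero (A := A) (x := CartanMatrix.Relations.HF ℝ A (i, j))
    (by simp [CartanMatrix.Relations.toSet])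
  simpa [h, e, f, CartanMatrix.Relations.HF, LieHom.map_lie, add_eq_zero_iff_eq_neg] using this

theorem lie_e_f (i j : ι) : ⁅e A i, f A j⁆ = if i = j then h A i else 0 := by
  have := proj_eq_zero (A := A) (x := CartanMatrix.Relations.EF ℝ (i, j))
    (by simp [CartanMatrix.Relations.toSet])
  by_cases hij : i = j
  · subst hij
    simpa [h, e, f, CartanMatrix.Relations.EF, LieHom.map_lie, sub_eq_zero] using this
  · simpa [h, e, f, CartanMatrix.Relations.EF, LieHom.map_lie, hij] using this

theorem proj_ad_pow (x y : FreeLieAlgebra ℝ (CartanMatrix.Generators ι)) (k : ℕ) :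
    proj A (((LieAlgebra.ad ℝ _ x) ^ k) y) =
      ((LieAlgebra.ad ℝ (Alg A) (proj A x)) ^ k) (proj A y) := by
  induction k with
  | zero => simp
  | succ k ih => simp only [pow_succ', Module.End.mul_apply, LieAlgebra.ad_apply,
      LieHom.map_lie, ih]

theorem serre_e (i j : ι) :
    ((LieAlgebra.ad ℝ (Alg A) (e A i)) ^ (-A i j).toNat) ⁅e A i, e A j⁆ = 0 := by
  have := proj_eq_zero (A := A) (x := CartanMatrix.Relations.adE ℝ A (i, j))
    (by simp [CartanMatrix.Relations.toSet])
  simpa [h, e, f, CartanMatrix.Relations.adE, proj_ad_pow, LieHom.map_lie] using this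

theorem serre_f (i j : ι) :
    ((LieAlgebra.ad ℝ (Alg A) (f A i)) ^ (-A i j).toNat) ⁅f A i, f A j⁆ = 0 := by
  have := proj_eq_zero (A := A) (x := CartanMatrix.Relations.adF ℝ A (i, j))
    (by simp [CartanMatrix.Relations.toSet])
  simpa [h, e, f, CartanMatrix.Relations.adF, proj_ad_pow, LieHom.map_lie] using this

/-- The Cartan-Chevalley involution on the free Lie algebra. -/
def freeInvolution : FreeLieAlgebra ℝ (CartanMatrix.Generators ι) →ₗ⁅ℝ⁆ Alg A :=
  FreeLieAlgebra.lift ℝ fun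
    | .H i => -h A i
    | .E i => -f A i
    | .F i => -e A i

theorem freeInvolution_ad_pow (x y : FreeLieAlgebra ℝ (CartanMatrix.Generators ι)) (k : ℕ) :
    freeInvolution A (((LieAlgebra.ad ℝ _ x) ^ k) y) =
      ((LieAlgebra.ad ℝ (Alg A) (freeInvolution A x)) ^ k) (freeInvolution A y) := by
  induction k with
  | zero => simp
  | succ k ih => simp only [pow_succ', Module.End.mul_apply, LieAlgebra.ad_apply,
      LieHom.map_lie, ih]

theorem ad_neg_pow_eq_zero {x y : Alg A} {k : ℕ}
    (hxy : ((LieAlgebra.ad ℝ (Alg A) x) ^ k) y = 0) :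
    ((LieAlgebra.ad ℝ (Alg A) (-x)) ^ k) y = 0 := by
  rw [map_neg]
  rcases Nat.even_or_odd k with hk | hk
  · rw [hk.neg_pow, hxy]
  · rw [hk.neg_pow, LinearMap.neg_apply, hxy, neg_zero]

theorem toIdeal_le_ker :
    CartanMatrix.Relations.toIdeal ℝ A ≤ (freeInvolution A).ker := by
  rw [CartanMatrix.Relations.toIdeal, LieSubmodule.lieSpan_le]
  rintro x (((((⟨⟨i, j⟩, rfl⟩ | ⟨⟨i, j⟩, rfl⟩) | ⟨⟨i, j⟩, rfl⟩) | ⟨⟨i, j⟩, rfl⟩) |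
    ⟨⟨i, j⟩, rfl⟩) | ⟨⟨i, j⟩, rfl⟩)
  all_goals rw [SetLike.mem_coe, LieHom.mem_ker]
  · simp [CartanMatrix.Relations.HH, freeInvolution, LieHom.map_lie, lie_h_h]
  · by_cases hij : i = j
    · subst hij
      simp only [CartanMatrix.Relations.EF, Function.uncurry_apply_pair, if_true, map_sub,
        LieHom.map_lie, Function.comp_apply, freeInvolution, FreeLieAlgebra.lift_of_apply]
      rw [neg_lie, lie_neg, neg_neg, ← lie_skew, lie_e_f]
      simp
    · simp only [CartanMatrix.Relations.EF, Function.uncurry_apply_pair, if_neg hij,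
        LieHom.map_lie, Function.comp_apply, freeInvolution, FreeLieAlgebra.lift_of_apply]
      rw [neg_lie, lie_neg, neg_neg, ← lie_skew, lie_e_f, if_neg (Ne.symm hij), neg_zero]
  · simp [CartanMatrix.Relations.HE, freeInvolution, LieHom.map_lie, lie_h_f]
  · simp [CartanMatrix.Relations.HF, freeInvolution, LieHom.map_lie, lie_h_e]
  · simp only [CartanMatrix.Relations.adE, Function.uncurry_apply_pair, freeInvolution_ad_pow,
      LieHom.map_lie, Function.comp_apply]
    simp only [freeInvolution, FreeLieAlgebra.lift_of_apply, neg_lie, lie_neg, neg_neg]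
    exact ad_neg_pow_eq_zero A (serre_f A i j)
  · simp only [CartanMatrix.Relations.adF, Function.uncurry_apply_pair, freeInvolution_ad_pow,
      LieHom.map_lie, Function.comp_apply]
    simp only [freeInvolution, FreeLieAlgebra.lift_of_apply, neg_lie, lie_neg, neg_neg]
    exact ad_neg_pow_eq_zero A (serre_e A i j)

/-- The Cartan-Chevalley involution: `e i ↦ -f i`, `f i ↦ -e i`, `h i ↦ -h i`. -/
def involution : Alg A →ₗ⁅ℝ⁆ Alg A :=
  { Submodule.liftQ (CartanMatrix.Relations.toIdeal ℝ A).toSubmodule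
      (freeInvolution A : FreeLieAlgebra ℝ (CartanMatrix.Generators ι) →ₗ[ℝ] Alg A)
      (fun _ hx => toIdeal_le_ker A hx) with
    map_lie' := by
      intro x y
      obtain ⟨x, rfl⟩ := Submodule.Quotient.mk_surjective _ x
      obtain ⟨y, rfl⟩ := Submodule.Quotient.mk_surjective _ y
      exact LieHom.map_lie (freeInvolution A) x y }

theorem involution_proj (x : FreeLieAlgebra ℝ (CartanMatrix.Generators ι)) :
    involution A (proj A x) = freeInvolution A x := rfl

theorem involution_h (i : ι) : involution A (h A i) = -h A i := by
  simp [h, involution_proj, freeInvolution]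

theorem involution_e (i : ι) : involution A (e A i) = -f A i := by
  simp [e, involution_proj, freeInvolution]

theorem involution_f (i : ι) : involution A (f A i) = -e A i := by
  simp [f, involution_proj, freeInvolution]

theorem involution_involution (x : Alg A) : involution A (involution A x) = x := by
  have key : ((involution A).comp (involution A)).comp (proj A) = proj A := by
    apply FreeLieAlgebra.hom_ext
    rintro (i | i | i)
    · change involution A (involution A (h A i)) = h A i
      simp [involution_h]
    · change involution A (involution A (e A i)) = e A i
      simp [involution_e, involution_f]
    · change involution A (involution A (f A i)) = f A i
      simp [involution_e, involution_f]
  obtain ⟨x, rfl⟩ : ∃ y, proj A y = x := Submodule.Quotient.mk_surjective _ x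
  exact LieHom.congr_fun key x

/-- The maximal compact subalgebra: the fixed points of the Cartan-Chevalley involution. -/
def maxCompact : LieSubalgebra ℝ (Alg A) where
  carrier := {x | involution A x = x}
  add_mem' := by intro x y hx hy; simp_all
  zero_mem' := by simp
  smul_mem' := by intro c x hx; simp_all
  lie_mem' := by
    intro x y hx hy
    have hx' : involution A x = x := hx
    have hy' : involution A y = y := hy
    change involution A ⁅x, y⁆ = ⁅x, y⁆
    rw [LieHom.map_lie, hx', hy']

/-- The fixed element `x + ω x` attached to `x`, where `ω` is the involution. -/
def symmetrize (x : Alg A) : maxCompact A :=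
  ⟨x + involution A x, by
    change involution A (x + involution A x) = x + involution A x
    rw [map_add, involution_involution, add_comm]⟩

/-- The generators `x i = e i - f i` of the maximal compact subalgebra. -/
def compactGen (i : ι) : maxCompact A :=
  ⟨e A i - f A i, by
    change involution A (e A i - f A i) = e A i - f A i
    rw [map_sub, involution_e, involution_f]; abel⟩

end General

end KacMoody

/-! ## The algebra `AE_d`

The nodes `1, …, d` of the Dynkin diagram and the coordinates `1, …, d` of the wall basis are
both indexed by `Fin d`, so that `i : Fin d` stands for the label `i + 1`. -/

namespace AE

/-- `i` and `j` are joined in the Dynkin diagram: the nodes `1, …, d - 1` form a line, and the node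
`d` is joined to the nodes `2` and `d - 1`. -/
def Joined (d : ℕ) (i j : Fin d) : Prop :=
  (i.val + 2 < d ∧ j.val = i.val + 1) ∨ (j.val + 2 < d ∧ i.val = j.val + 1) ∨
  (i.val + 1 = d ∧ (j.val = 1 ∨ j.val + 2 = d)) ∨ (j.val + 1 = d ∧ (i.val = 1 ∨ i.val + 2 = d))

instance (d : ℕ) (i j : Fin d) : Decidable (Joined d i j) := by
  unfold Joined; infer_instance

/-- The Cartan matrix read from the Dynkin diagram (simply laced). -/
def cartan (d : ℕ) : Matrix (Fin d) (Fin d) ℤ :=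
  Matrix.of fun i j => if i = j then 2 else if Joined d i j then -1 else 0

/-- The Kac-Moody algebra `AE_d`. -/
abbrev Alg (d : ℕ) : Type := KacMoody.Alg (cartan d)

/-- Its maximal compact subalgebra `K(AE_d)`. -/
abbrev K (d : ℕ) : LieSubalgebra ℝ (Alg d) := KacMoody.maxCompact (cartan d)

/-- The scalar product of the wall basis, `e^a · e^b = δ^{ab} - 1 / (d - 1)`. -/
def dewitt {d : ℕ} (p q : Fin d → ℤ) : ℝ :=
  ∑ a, ∑ b, (p a : ℝ) * (q b : ℝ) * ((if a = b then 1 else 0) - 1 / ((d : ℝ) - 1))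

/-- The simple roots in the wall basis: `α_i = (0, …, 0, 1, -1, 0, …, 0)` for `i < d`, with the `1`
in position `i`, and `α_d = (0, 0, 1, …, 1, 2)`. -/
def simpleRoot {d : ℕ} (i : Fin d) : Fin d → ℤ := fun a =>
  if i.val + 1 < d then
    (if a = i then 1 else if a.val = i.val + 1 then -1 else 0)
  else
    (if a.val + 1 = d then 2 else if 2 ≤ a.val then 1 else 0)

/-- The root lattice in the wall basis. -/
def rootLattice (d : ℕ) : AddSubgroup (Fin d → ℤ) :=
  AddSubgroup.closure (Set.range simpleRoot)

/-- The space of all `x` with `[h, x] = α(h) x` for all `h` in the Cartan subalgebra, where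
`α` has wall components `p`; on the basis of the Cartan subalgebra, `α(h_i) = α_i · α`. -/
def rootSpace {d : ℕ} (p : Fin d → ℤ) : Submodule ℝ (Alg d) where
  carrier := {x | ∀ i, ⁅KacMoody.h (cartan d) i, x⁆ = dewitt (simpleRoot i) p • x}
  add_mem' := by
    intro x y hx hy i
    rw [lie_add, hx i, hy i, smul_add]
  zero_mem' := by intro i; simp
  smul_mem' := by
    intro c x hx i
    rw [lie_smul, hx i, smul_comm]

/-- A real root: a space-like root. -/
def IsRealRoot {d : ℕ} (p : Fin d → ℤ) : Prop :=
  p ∈ rootLattice d ∧ rootSpace p ≠ ⊥ ∧ 0 < dewitt p p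

/-! ## Gamma matrices -/

/-- The Minkowski metric `diag(-1, 1, …, 1)`. -/
def minkowski (d : ℕ) : Matrix (Fin (d + 1)) (Fin (d + 1)) ℝ :=
  Matrix.diagonal fun μ => if μ = 0 then -1 else 1

section Gamma

variable {d N : ℕ} (Γ : Fin (d + 1) → Matrix (Fin N) (Fin N) ℝ)

/-- `Γ_0, …, Γ_d` are real matrices with `Γ_μ Γ_ν + Γ_ν Γ_μ = 2 η_{μν}`. -/
def IsClifford : Prop :=
  ∀ μ ν, Γ μ * Γ ν + Γ ν * Γ μ = (2 * minkowski d μ ν) • (1 : Matrix (Fin N) (Fin N) ℝ)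

/-- The space-like `Γ_a` are symmetric and the time-like `Γ_0` is antisymmetric. -/
def IsOrthogonalChoice : Prop :=
  ∀ μ, (Γ μ).transpose = minkowski d μ μ • Γ μ

/-- `Γ_* = Γ_0 Γ_1 ⋯ Γ_d`. -/
def gammaStar : Matrix (Fin N) (Fin N) ℝ := (List.ofFn Γ).prod

/-- `Γ_3 Γ_4 ⋯ Γ_{d-1}`. -/
def gammaMiddle : Matrix (Fin N) (Fin N) ℝ :=
  (List.ofFn fun a : Fin (d - 3) => Γ ⟨a.val + 3, by omega⟩).prod

/-- The matrices of the simple roots: `Γ(α_i) = Γ_{i,i+1}` for `i < d` and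
`Γ(α_d) = Γ_{34⋯d-1} Γ_*`. An antisymmetrised product of gamma matrices with distinct indices is
their product. -/
def gammaSimple (i : Fin d) : Matrix (Fin N) (Fin N) ℝ :=
  if hi : i.val + 1 < d then Γ i.succ * Γ ⟨i.val + 2, by omega⟩
  else gammaMiddle Γ * gammaStar Γ

/-- `Γ(α) = Γ_1^{p_1} ⋯ Γ_d^{p_d} Γ_*^{(p_1 + ⋯ + p_d) / (d - 1)}` for `α = (p_1, …, p_d)`. The
division is exact on the root lattice. -/
def gammaRoot (p : Fin d → ℤ) : Matrix (Fin N) (Fin N) ℝ :=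
  (List.ofFn fun a : Fin d => Γ a.succ ^ p a).prod *
    gammaStar Γ ^ ((∑ a, p a) / ((d : ℤ) - 1))

end Gamma

end AE

end

/-! Existence of ρ. Each Γ(α_i) squares to -1, and Γ(α_i), Γ(α_j) anticommute exactly when the nodes
are joined; this gives the Berman relations for the halves. That these relations suffice
(`exists_hom_of_bermanRelations`) is proved by coinduction. Heuristically, by the Iwasawa
decomposition G = KAN, a function on G that is equivariant under K on the left is known from its
restriction to the torus A and its derivatives along N, that is, from a family of functions on A
indexed by words in the e_i. Right translation by e_i and h_i on such families is explicit, and f_i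
= e_i - x_i, with x_i acting on values by the prescribed X_i, dictates right translation by f_i. The
Serre relations of the e_i cut out a submodule; on it those of the f_i follow from the Berman
relations of the X_i (`PreChevalleyRelations.berman_twist`, `serreElement_coF_nil`). So the whole
Kac-Moody algebra acts, and evaluation at the identity turns the action of the compact subalgebra
into left multiplication by the values of the desired homomorphism.

Uniqueness. The compact subalgebra is generated by the x_i (`compactGen_induction`): the algebra is
spanned by the h_i, the iterated brackets of the e_i and their images under ω, and x ↦ x + ω(x)
turns a bracket with e_i into a bracket with x_i plus a term of lower height.

Real roots. The automorphism exp(ad e_i) exp(-ad f_i) exp(ad e_i) lifts the simple reflection s_i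
and commutes with ω. Through ρ its restriction to the compact subalgebra becomes conjugation by (1 +
Γ(α_i))/√2 (`spinor_compactReflection`), which sends Γ(α) to Γ(α) or Γ(α_i)Γ(α) according to the
parity of α_i·α. Up to sign this is Γ(s_i α). Since reflections and negation carry simple roots to
all real roots (`real_root_induction`), every real root has norm 2 and a root vector on which ρ
takes the value ±Γ(α)/2; replacing e by -e fixes the sign.

Gamma relations. Up to sign Γ is multiplicative on the root lattice, and sign ambiguities drop out
of commutation relations, squares and transposes. Hence these identities propagate from the simple
roots by bilinearity of the scalar product. For a real root, Γ(α)² = -1 makes Γ(α) a complex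
structure, and exp(πΓ(α)) = -1 is Euler's formula. -/

noncomputable section

/-! ### Presentation, triangular decomposition and generators of the compact subalgebra. -/

namespace KacMoody

variable {ι : Type} [DecidableEq ι]

/-- A symmetric generalised Cartan matrix with off-diagonal entries `0` and `-1`. -/
structure IsSimplyLaced (A : Matrix ι ι ℤ) : Prop where
  diag : ∀ i, A i i = 2
  symm : ∀ i j, A i j = A j i
  off_diag : ∀ i j, i ≠ j → A i j = 0 ∨ A i j = -1

namespace IsSimplyLaced

variable {A : Matrix ι ι ℤ}

theorem trichotomy (hA : IsSimplyLaced A) (i j : ι) :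
    (i = j ∧ A i j = 2) ∨ (i ≠ j ∧ A i j = 0) ∨ (i ≠ j ∧ A i j = -1) := by
  by_cases h : i = j
  · subst h; exact Or.inl ⟨rfl, hA.diag i⟩
  · rcases hA.off_diag i j h with h' | h' <;> simp [h, h']

omit [DecidableEq ι] in
theorem ne_of_eq_zero (hA : IsSimplyLaced A) {i j : ι} (h : A i j = 0) : i ≠ j := by
  rintro rfl; simp [hA.diag] at h

omit [DecidableEq ι] in
theorem ne_of_eq_neg_one (hA : IsSimplyLaced A) {i j : ι} (h : A i j = -1) : i ≠ j := by
  rintro rfl; simp [hA.diag] at h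

end IsSimplyLaced

section Presentation

variable {A : Matrix ι ι ℤ}

theorem proj_surjective (x : Alg A) : ∃ y, proj A y = x :=
  Submodule.Quotient.mk_surjective _ x

theorem hom_ext {L : Type*} [LieRing L] [LieAlgebra ℝ L] {φ ψ : Alg A →ₗ⁅ℝ⁆ L}
    (hh : ∀ i, φ (h A i) = ψ (h A i)) (he : ∀ i, φ (e A i) = ψ (e A i))
    (hf : ∀ i, φ (f A i) = ψ (f A i)) : φ = ψ := by
  have key : φ.comp (proj A) = ψ.comp (proj A) := by
    apply FreeLieAlgebra.hom_ext
    rintro (i | i | i)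
    exacts [hh i, he i, hf i]
  ext x
  obtain ⟨x, rfl⟩ := proj_surjective x
  exact LieHom.congr_fun key x

theorem subalgebra_eq_top {S : LieSubalgebra ℝ (Alg A)} (hh : ∀ i, h A i ∈ S)
    (he : ∀ i, e A i ∈ S) (hf : ∀ i, f A i ∈ S) (x : Alg A) : x ∈ S := by
  let g : CartanMatrix.Generators ι → S := fun
    | .H i => ⟨h A i, hh i⟩
    | .E i => ⟨e A i, he i⟩
    | .F i => ⟨f A i, hf i⟩
  have key : S.incl.comp (FreeLieAlgebra.lift ℝ g) = proj A := by
    apply FreeLieAlgebra.hom_ext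
    rintro (i | i | i) <;> simp [g] <;> rfl
  obtain ⟨x, rfl⟩ := proj_surjective x
  rw [← key]
  exact (FreeLieAlgebra.lift ℝ g x).2

theorem lie_e_e_of_eq_zero {i j : ι} (hij : A i j = 0) : ⁅e A i, e A j⁆ = 0 := by
  simpa [hij] using serre_e A i j

theorem lie_f_f_of_eq_zero {i j : ι} (hij : A i j = 0) : ⁅f A i, f A j⁆ = 0 := by
  simpa [hij] using serre_f A i j

theorem lie_e_lie_e_e {i j : ι} (hij : A i j = -1) : ⁅e A i, ⁅e A i, e A j⁆⁆ = 0 := by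
  simpa [hij] using serre_e A i j

theorem lie_f_lie_f_f {i j : ι} (hij : A i j = -1) : ⁅f A i, ⁅f A i, f A j⁆⁆ = 0 := by
  simpa [hij] using serre_f A i j

/-- Images of the Chevalley generators satisfying the relations of a simply laced matrix. -/
structure ChevalleyRelations (A : Matrix ι ι ℤ) {L : Type*} [LieRing L] (H E F : ι → L) :
    Prop where
  hh : ∀ i j, ⁅H i, H j⁆ = 0
  he : ∀ i j, ⁅H i, E j⁆ = A i j • E j
  hf : ∀ i j, ⁅H i, F j⁆ = -(A i j • F j)
  ef : ∀ i j, ⁅E i, F j⁆ = if i = j then H i else 0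
  ee : ∀ i j, A i j = 0 → ⁅E i, E j⁆ = 0
  ff : ∀ i j, A i j = 0 → ⁅F i, F j⁆ = 0
  eee : ∀ i j, A i j = -1 → ⁅E i, ⁅E i, E j⁆⁆ = 0
  fff : ∀ i j, A i j = -1 → ⁅F i, ⁅F i, F j⁆⁆ = 0

theorem map_ad_pow {L L' : Type*} [LieRing L] [LieAlgebra ℝ L] [LieRing L'] [LieAlgebra ℝ L']
    (φ : L →ₗ⁅ℝ⁆ L') (x y : L) (k : ℕ) :
    φ (((LieAlgebra.ad ℝ L x) ^ k) y) = ((LieAlgebra.ad ℝ L' (φ x)) ^ k) (φ y) := by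
  induction k with
  | zero => simp
  | succ k ih => simp only [pow_succ', Module.End.mul_apply, LieAlgebra.ad_apply,
      LieHom.map_lie, ih]

theorem exists_lift (hA : IsSimplyLaced A) {L : Type*} [LieRing L] [LieAlgebra ℝ L]
    {H E F : ι → L} (hr : ChevalleyRelations A H E F) :
    ∃ φ : Alg A →ₗ⁅ℝ⁆ L, (∀ i, φ (h A i) = H i) ∧ (∀ i, φ (e A i) = E i) ∧
      (∀ i, φ (f A i) = F i) := by
  let g : CartanMatrix.Generators ι → L := fun
    | .H i => H i
    | .E i => E i
    | .F i => F i
  let ψ := FreeLieAlgebra.lift ℝ g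
  have hψH : ∀ i, ψ (FreeLieAlgebra.of ℝ (.H i)) = H i := fun i =>
    FreeLieAlgebra.lift_of_apply ..
  have hψE : ∀ i, ψ (FreeLieAlgebra.of ℝ (.E i)) = E i := fun i =>
    FreeLieAlgebra.lift_of_apply ..
  have hψF : ∀ i, ψ (FreeLieAlgebra.of ℝ (.F i)) = F i := fun i =>
    FreeLieAlgebra.lift_of_apply ..
  have hle : CartanMatrix.Relations.toIdeal ℝ A ≤ ψ.ker := by
    rw [CartanMatrix.Relations.toIdeal, LieSubmodule.lieSpan_le]
    rintro x (((((⟨⟨i, j⟩, rfl⟩ | ⟨⟨i, j⟩, rfl⟩) | ⟨⟨i, j⟩, rfl⟩) | ⟨⟨i, j⟩, rfl⟩) |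
      ⟨⟨i, j⟩, rfl⟩) | ⟨⟨i, j⟩, rfl⟩)
    all_goals rw [SetLike.mem_coe, LieHom.mem_ker]
    · simp [CartanMatrix.Relations.HH, LieHom.map_lie, hψH, hr.hh]
    · by_cases hij : i = j
      · subst hij
        simp [CartanMatrix.Relations.EF, LieHom.map_lie, hψH, hψE, hψF, hr.ef]
      · simp [CartanMatrix.Relations.EF, LieHom.map_lie, hψE, hψF, hr.ef, hij]
    · simp [CartanMatrix.Relations.HE, LieHom.map_lie, hψH, hψE, hr.he]
    · simp [CartanMatrix.Relations.HF, LieHom.map_lie, hψH, hψF, hr.hf]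
    · simp only [CartanMatrix.Relations.adE, Function.uncurry_apply_pair, map_ad_pow,
        LieHom.map_lie, Function.comp_apply, hψE]
      -- The Serre exponent `(-A i j).toNat` is 0 for entries 2 and 0, and 1 for entry -1. The
      -- diagonal relation is thus the trivial [E_i, E_i] = 0.
      rcases hA.trichotomy i j with ⟨rfl, h⟩ | ⟨-, h⟩ | ⟨-, h⟩
      · simp [h]
      · simp [h, hr.ee i j h]
      · simp [h, hr.eee i j h]
    · simp only [CartanMatrix.Relations.adF, Function.uncurry_apply_pair, map_ad_pow,
        LieHom.map_lie, Function.comp_apply, hψF]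
      rcases hA.trichotomy i j with ⟨rfl, h⟩ | ⟨-, h⟩ | ⟨-, h⟩
      · simp [h]
      · simp [h, hr.ff i j h]
      · simp [h, hr.fff i j h]
  exact ⟨{ Submodule.liftQ (CartanMatrix.Relations.toIdeal ℝ A).toSubmodule
      (ψ : FreeLieAlgebra ℝ (CartanMatrix.Generators ι) →ₗ[ℝ] L) (fun _ hx => hle hx) with
    map_lie' := by
      intro x y
      obtain ⟨x, rfl⟩ := Submodule.Quotient.mk_surjective _ x
      obtain ⟨y, rfl⟩ := Submodule.Quotient.mk_surjective _ y
      exact LieHom.map_lie ψ x y }, hψH, hψE, hψF⟩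

end Presentation

/-! ### Iterated brackets of the positive generators -/

section Brackets

variable (A : Matrix ι ι ℤ)

/-- `IsBracket A c y`: `y` is an iterated bracket of the `e i` in which `e i` occurs `c i` times. -/
inductive IsBracket : (ι → ℤ) → Alg A → Prop
  | gen (i : ι) : IsBracket (Pi.single i 1) (e A i)
  | lie (i : ι) {c : ι → ℤ} {y : Alg A} (hy : IsBracket c y) :
      IsBracket (c + Pi.single i 1) ⁅e A i, y⁆

/-- The common eigenspace of the `h i` with the eigenvalues `A c`. -/
def weightSpace [Fintype ι] (c : ι → ℤ) : Submodule ℝ (Alg A) where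
  carrier := {x | ∀ i, ⁅h A i, x⁆ = A.mulVec c i • x}
  add_mem' := by
    intro x y hx hy i
    rw [lie_add, hx i, hy i, smul_add]
  zero_mem' := by intro i; simp
  smul_mem' := by
    intro c x hx i
    rw [lie_smul, hx i, smul_comm]

variable {A} [Fintype ι]

theorem lie_mem_weightSpace {c c' : ι → ℤ} {x y : Alg A} (hx : x ∈ weightSpace A c)
    (hy : y ∈ weightSpace A c') : ⁅x, y⁆ ∈ weightSpace A (c + c') := by
  intro i
  rw [leibniz_lie, hx i, hy i, smul_lie, lie_smul, ← add_smul, Matrix.mulVec_add, Pi.add_apply]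

theorem e_mem_weightSpace (i : ι) : e A i ∈ weightSpace A (Pi.single i 1) := by
  intro j
  rw [lie_h_e]; simp

theorem h_mem_weightSpace (i : ι) : h A i ∈ weightSpace A 0 := by
  intro j
  rw [lie_h_h]; simp

theorem involution_mem_weightSpace {c : ι → ℤ} {x : Alg A} (hx : x ∈ weightSpace A c) :
    involution A x ∈ weightSpace A (-c) := by
  intro i
  have := congrArg (involution A) (hx i)
  rw [LieHom.map_lie, involution_h, neg_lie, map_zsmul] at this
  rw [Matrix.mulVec_neg, Pi.neg_apply, neg_smul, ← this, neg_neg]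

namespace IsBracket

variable {c : ι → ℤ} {y : Alg A}

theorem mem_weightSpace (hy : IsBracket A c y) : y ∈ weightSpace A c := by
  induction hy with
  | gen i => exact e_mem_weightSpace i
  | lie i _ ih => rw [add_comm]; exact lie_mem_weightSpace (e_mem_weightSpace i) ih

omit [Fintype ι] in
theorem nonneg (hy : IsBracket A c y) : 0 ≤ c := by
  induction hy with
  | gen i => simp
  | lie i _ ih => exact add_nonneg ih (by simp)

omit [Fintype ι] in
/-- A non-zero iterated bracket involving only one generator is that generator. -/
theorem eq_gen_or_exists_pair (hy : IsBracket A c y) :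
    y = 0 ∨ (∃ i, c = Pi.single i 1 ∧ y = e A i) ∨ ∃ i j, i ≠ j ∧ 0 < c i ∧ 0 < c j := by
  induction hy with
  | gen i => exact Or.inr (Or.inl ⟨i, rfl, rfl⟩)
  | @lie i c y hy ih =>
    have hpos : ∀ k, c k ≤ (c + Pi.single i 1 : ι → ℤ) k := fun k => by
      have : (0 : ι → ℤ) k ≤ (Pi.single i 1 : ι → ℤ) k := (Pi.single_nonneg.mpr zero_le_one) k
      simpa using this
    rcases ih with rfl | ⟨j, rfl, rfl⟩ | ⟨j, k, hjk, hj, hk⟩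
    · simp
    · by_cases hij : i = j
      · subst hij; simp
      · refine Or.inr (Or.inr ⟨i, j, hij, ?_, ?_⟩) <;> simp [hij, Ne.symm hij]
    · exact Or.inr (Or.inr ⟨j, k, hjk, hj.trans_le (hpos j), hk.trans_le (hpos k)⟩)

end IsBracket

/-- Sums of iterated brackets with at most `n` factors. -/
def bracketSpan (A : Matrix ι ι ℤ) (n : ℤ) : Submodule ℝ (Alg A) :=
  Submodule.span ℝ {y | ∃ c, IsBracket A c y ∧ ∑ i, c i ≤ n}

def cartanSpan (A : Matrix ι ι ℤ) : Submodule ℝ (Alg A) := Submodule.span ℝ (Set.range (h A))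

theorem bracketSpan_mono {m n : ℤ} (hmn : m ≤ n) : bracketSpan A m ≤ bracketSpan A n :=
  Submodule.span_mono fun _ ⟨c, hc, h⟩ => ⟨c, hc, h.trans hmn⟩

theorem sum_single (i : ι) : ∑ j, (Pi.single i 1 : ι → ℤ) j = 1 := by simp

theorem lie_mem_of_forall {L : Type*} [LieRing L] [LieAlgebra ℝ L] {s : Set L}
    {T : Submodule ℝ L} {x y : L} (hs : ∀ z ∈ s, ⁅x, z⁆ ∈ T) (hy : y ∈ Submodule.span ℝ s) :
    ⁅x, y⁆ ∈ T :=
  (Submodule.span_le (p := T.comap (LieAlgebra.ad ℝ L x : L →ₗ[ℝ] L))).mpr hs hy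

theorem IsBracket.mem_bracketSpan {n : ℤ} {c : ι → ℤ} {y : Alg A} (hy : IsBracket A c y)
    (hc : ∑ i, c i ≤ n) : y ∈ bracketSpan A n :=
  Submodule.subset_span ⟨c, hy, hc⟩

theorem lie_e_bracketSpan (i : ι) {n : ℤ} {y : Alg A} (hy : y ∈ bracketSpan A n) :
    ⁅e A i, y⁆ ∈ bracketSpan A (n + 1) := by
  refine lie_mem_of_forall ?_ hy
  rintro z hz
  obtain ⟨c, hz, hc⟩ : ∃ c, IsBracket A c z ∧ ∑ i, c i ≤ n := hz
  have hc' : ∑ j, (c + Pi.single i 1 : ι → ℤ) j ≤ n + 1 := by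
    simp only [Pi.add_apply, Finset.sum_add_distrib, sum_single]; omega
  exact (hz.lie i).mem_bracketSpan hc'

theorem lie_h_bracketSpan (i : ι) {n : ℤ} {y : Alg A} (hy : y ∈ bracketSpan A n) :
    ⁅h A i, y⁆ ∈ bracketSpan A n := by
  refine lie_mem_of_forall ?_ hy
  rintro z hz
  obtain ⟨c, hz, hc⟩ : ∃ c, IsBracket A c z ∧ ∑ i, c i ≤ n := hz
  rw [hz.mem_weightSpace i]
  exact zsmul_mem (hz.mem_bracketSpan hc) _

theorem lie_e_cartanSpan (i : ι) {y : Alg A} (hy : y ∈ cartanSpan A) :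
    ⁅e A i, y⁆ ∈ bracketSpan A 1 := by
  refine lie_mem_of_forall ?_ hy
  rintro _ ⟨j, rfl⟩
  rw [← lie_skew, lie_h_e]
  exact neg_mem (zsmul_mem ((IsBracket.gen i).mem_bracketSpan (sum_single i).le) _)

omit [Fintype ι] in
theorem lie_h_cartanSpan (i : ι) {y : Alg A} (hy : y ∈ cartanSpan A) : ⁅h A i, y⁆ = 0 := by
  have : ⁅h A i, y⁆ ∈ (⊥ : Submodule ℝ (Alg A)) := by
    refine lie_mem_of_forall ?_ hy
    rintro _ ⟨j, rfl⟩
    simp [lie_h_h]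
  simpa using this

omit [Fintype ι] in
theorem lie_f_e_mem_cartanSpan (i j : ι) : ⁅f A i, e A j⁆ ∈ cartanSpan A := by
  rw [← lie_skew, lie_e_f]
  split_ifs
  · exact neg_mem (Submodule.subset_span ⟨j, rfl⟩)
  · simp

/-- By the Leibniz rule f_i either meets the outer e_j, leaving an element of the Cartan subalgebra
that acts on y by a scalar, or passes to the inner bracket. The explicit length bound is what makes
the later induction on height descend. -/
theorem IsBracket.lie_f {c : ι → ℤ} {y : Alg A} (hy : IsBracket A c y) (i : ι) :
    ⁅f A i, y⁆ ∈ bracketSpan A (∑ i, c i - 1) ⊔ cartanSpan A := by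
  induction hy with
  | gen j => exact Submodule.mem_sup_right (lie_f_e_mem_cartanSpan i j)
  | @lie j c y hy ih =>
    have hsum : ∑ k, (c + Pi.single j 1 : ι → ℤ) k - 1 = ∑ k, c k := by
      simp [Finset.sum_add_distrib]
    -- The Cartan part of [f_i, y] returns under e_j as a bracket of length 1, which must not exceed
    -- the length of y.
    have hpos : 1 ≤ ∑ k, c k := by
      clear ih hsum
      induction hy with
      | gen k => simp
      | lie k _ ih => simp only [Pi.add_apply, Finset.sum_add_distrib, sum_single]; omega
    rw [hsum, leibniz_lie]
    refine Submodule.mem_sup_left (add_mem ?_ ?_)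
    · rw [← lie_skew (f A i) (e A j), lie_e_f]
      split_ifs
      · rw [neg_lie, hy.mem_weightSpace j]
        exact neg_mem (zsmul_mem (hy.mem_bracketSpan le_rfl) _)
      · simp
    · obtain ⟨u, hu, v, hv, huv⟩ := Submodule.mem_sup.mp ih
      rw [← huv, lie_add]
      refine add_mem ?_ (bracketSpan_mono hpos (lie_e_cartanSpan j hv))
      simpa using lie_e_bracketSpan j hu

/-- The Lie algebra is spanned by the Cartan subalgebra, the iterated brackets of the `e i`, and
their images under the involution. -/
theorem triangular_induction {S : Submodule ℝ (Alg A)} (hS : ∀ c y, IsBracket A c y → y ∈ S)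
    (hS' : ∀ c y, IsBracket A c y → involution A y ∈ S) (hh : ∀ i, h A i ∈ S) (x : Alg A) :
    x ∈ S := by
  let B : Submodule ℝ (Alg A) := Submodule.span ℝ {y | ∃ c, IsBracket A c y}
  let ω : Alg A →ₗ[ℝ] Alg A := (involution A : Alg A →ₗ[ℝ] Alg A)
  have hωdef : ∀ x, ω x = involution A x := fun x => rfl
  have hωω : ∀ x, ω (ω x) = x := involution_involution A
  have hnB : ∀ n, bracketSpan A n ≤ B := fun n =>
    Submodule.span_mono fun _ ⟨c, hc, _⟩ => ⟨c, hc⟩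
  have hBn : ∀ c y, IsBracket A c y → y ∈ bracketSpan A (∑ i, c i) := fun c y hy =>
    hy.mem_bracketSpan le_rfl
  -- Negative, zero and positive parts together. T is stable under ω, and ω exchanges e_i with -f_i,
  -- so bracket estimates on `B` transfer to its image under ω.
  let T : Submodule ℝ (Alg A) := B ⊔ cartanSpan A ⊔ B.map ω
  have hBT : B ≤ T := le_sup_left.trans le_sup_left
  have hCT : cartanSpan A ≤ T := le_sup_right.trans le_sup_left
  have hωT : ∀ x ∈ T, ω x ∈ T := by
    intro x hx
    suffices hle : T ≤ T.comap ω from hle hx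
    refine sup_le (sup_le ?_ ?_) ?_
    · intro x hx; exact Submodule.mem_sup_right ⟨x, hx, rfl⟩
    · refine Submodule.span_le.mpr ?_
      rintro _ ⟨i, rfl⟩
      change involution A (h A i) ∈ T
      rw [involution_h]
      exact neg_mem (hCT (Submodule.subset_span ⟨i, rfl⟩))
    · rintro _ ⟨x, hx, rfl⟩
      change ω (ω x) ∈ T
      rw [hωω]; exact hBT hx
  have hT : T ≤ S := by
    refine sup_le (sup_le ?_ ?_) ?_
    · exact Submodule.span_le.mpr fun y ⟨c, hy⟩ => hS c y hy
    · refine Submodule.span_le.mpr ?_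
      rintro _ ⟨i, rfl⟩; exact hh i
    · rw [Submodule.map_le_iff_le_comap]
      exact Submodule.span_le.mpr fun y ⟨c, hy⟩ => hS' c y hy
  have heB : ∀ i, ∀ y ∈ B, ⁅e A i, y⁆ ∈ T := fun i y hy => lie_mem_of_forall
    (s := {y | ∃ c, IsBracket A c y}) (fun z ⟨c, hz⟩ => hBT (hnB _ (lie_e_bracketSpan i (hBn c z hz)))) hy
  have hfB : ∀ i, ∀ y ∈ B, ⁅f A i, y⁆ ∈ T := fun i y hy => lie_mem_of_forall
    (s := {y | ∃ c, IsBracket A c y}) (fun z ⟨c, hz⟩ => (sup_le_sup_right (hnB _) _).trans le_sup_left (hz.lie_f i)) hy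
  have hhB : ∀ i, ∀ y ∈ B, ⁅h A i, y⁆ ∈ T := fun i y hy => lie_mem_of_forall
    (s := {y | ∃ c, IsBracket A c y}) (fun z ⟨c, hz⟩ => hBT (hnB _ (lie_h_bracketSpan i (hBn c z hz)))) hy
  have heω : ∀ i, ∀ y ∈ B, ⁅e A i, ω y⁆ ∈ T := by
    intro i y hy
    have := hωT _ (neg_mem (hfB i y hy))
    simpa [hωdef, LieHom.map_lie, involution_f] using this
  have hfω : ∀ i, ∀ y ∈ B, ⁅f A i, ω y⁆ ∈ T := by
    intro i y hy
    have := hωT _ (neg_mem (heB i y hy))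
    simpa [hωdef, LieHom.map_lie, involution_e] using this
  have hhω : ∀ i, ∀ y ∈ B, ⁅h A i, ω y⁆ ∈ T := by
    intro i y hy
    have := hωT _ (neg_mem (hhB i y hy))
    simpa [hωdef, LieHom.map_lie, involution_h] using this
  have heC : ∀ i, ∀ y ∈ cartanSpan A, ⁅e A i, y⁆ ∈ T := fun i y hy =>
    hBT (hnB _ (lie_e_cartanSpan i hy))
  have hfC : ∀ i, ∀ y ∈ cartanSpan A, ⁅f A i, y⁆ ∈ T := by
    intro i y hy
    refine lie_mem_of_forall ?_ hy
    rintro _ ⟨j, rfl⟩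
    have := hωT _ (heC i _ (Submodule.subset_span ⟨j, rfl⟩))
    simpa [hωdef, LieHom.map_lie, involution_e, involution_h] using this
  have hhC : ∀ i, ∀ y ∈ cartanSpan A, ⁅h A i, y⁆ ∈ T := fun i y hy => by
    rw [lie_h_cartanSpan i hy]; exact zero_mem _
  have hstep : ∀ z : Alg A, (∀ y ∈ B, ⁅z, y⁆ ∈ T) → (∀ y ∈ cartanSpan A, ⁅z, y⁆ ∈ T) →
      (∀ y ∈ B, ⁅z, ω y⁆ ∈ T) → ∀ y ∈ T, ⁅z, y⁆ ∈ T := by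
    intro z h1 h2 h3 y hy
    suffices hle : T ≤ T.comap (LieAlgebra.ad ℝ (Alg A) z : Alg A →ₗ[ℝ] Alg A) from hle hy
    refine sup_le (sup_le h1 h2) ?_
    rintro _ ⟨x, hx, rfl⟩
    exact h3 x hx
  -- Stability of T under all of the algebra need only be tested on Chevalley generators, because
  -- the elements preserving T form a subalgebra. T is then itself a subalgebra containing the
  -- generators.
  let N : LieSubalgebra ℝ (Alg A) :=
    { carrier := {z | ∀ y ∈ T, ⁅z, y⁆ ∈ T}
      add_mem' := fun {a b} ha hb y hy => by rw [add_lie]; exact add_mem (ha y hy) (hb y hy)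
      zero_mem' := fun y _ => by simp
      smul_mem' := fun r a ha y hy => by rw [smul_lie]; exact T.smul_mem r (ha y hy)
      lie_mem' := fun {a b} ha hb y hy => by
        rw [lie_lie]; exact sub_mem (ha _ (hb y hy)) (hb _ (ha y hy)) }
  have hN : ∀ z, z ∈ N := subalgebra_eq_top
    (fun i => hstep _ (hhB i) (hhC i) (hhω i)) (fun i => hstep _ (heB i) (heC i) (heω i))
    (fun i => hstep _ (hfB i) (hfC i) (hfω i))
  let T' : LieSubalgebra ℝ (Alg A) := { T with lie_mem' := fun {a b} _ hb => hN a b hb }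
  refine hT ((subalgebra_eq_top (S := T') ?_ ?_ ?_ x : x ∈ T'))
  · exact fun i => hCT (Submodule.subset_span ⟨i, rfl⟩)
  · exact fun i => hBT (Submodule.subset_span ⟨_, .gen i⟩)
  · intro i
    have : ω (-e A i) ∈ T := hωT _ (neg_mem (hBT (Submodule.subset_span ⟨_, .gen i⟩)))
    change f A i ∈ T
    simpa [hωdef, involution_e] using this

/-- The maximal compact subalgebra is generated by the `e i - f i`. -/
theorem compactGen_induction {S : LieSubalgebra ℝ (maxCompact A)}
    (hS : ∀ i, compactGen A i ∈ S) (k : maxCompact A) : k ∈ S := by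
  let σ : Alg A →ₗ[ℝ] maxCompact A :=
    { toFun := symmetrize A
      map_add' := fun x y => Subtype.ext (by simp [symmetrize]; module)
      map_smul' := fun r x => Subtype.ext (by simp [symmetrize]) }
  have hσ : ∀ x, (σ x : Alg A) = x + involution A x := fun x => rfl
  have hσω : ∀ x, σ (involution A x) = σ x := fun x => Subtype.ext (by
    rw [hσ, hσ, involution_involution, add_comm])
  have hσh : ∀ y ∈ cartanSpan A, σ y = 0 := by
    intro y hy
    suffices hle : cartanSpan A ≤ LinearMap.ker σ from hle hy
    refine Submodule.span_le.mpr ?_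
    rintro _ ⟨i, rfl⟩
    exact Subtype.ext (by rw [hσ, involution_h]; simp)
  -- Since x_i is fixed by ω, [x_i, σ y] = σ [x_i, y], and e_i = x_i + f_i.
  have hrec : ∀ i y, σ ⁅e A i, y⁆ = ⁅compactGen A i, σ y⁆ + σ ⁅f A i, y⁆ := by
    intro i y
    refine Subtype.ext ?_
    rw [AddMemClass.coe_add, LieSubalgebra.coe_bracket, hσ, hσ, hσ]
    simp only [compactGen, LieHom.map_lie, involution_e, involution_f, sub_lie, lie_add, neg_lie]
    module
  have main : ∀ n : ℕ, ∀ c y, IsBracket A c y → ∑ i, c i ≤ n → σ y ∈ S := by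
    intro n
    induction n with
    | zero =>
      intro c y hy hc
      have hc' : c = 0 := by
        have h0 : ∑ i, c i = 0 := le_antisymm hc (Finset.sum_nonneg fun i _ => hy.nonneg i)
        funext i
        exact (Finset.sum_eq_zero_iff_of_nonneg fun i _ => hy.nonneg i).mp h0 i (Finset.mem_univ i)
      rcases hy.eq_gen_or_exists_pair with rfl | ⟨i, h, -⟩ | ⟨i, j, -, h, -⟩
      · simp
      · have := congrFun h i; simp [hc'] at this
      · simp [hc'] at h
    | succ n ih =>
      intro c y hy hc
      cases hy with
      | gen i =>
        have : σ (e A i) = compactGen A i := Subtype.ext (by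
          rw [hσ, involution_e]; exact (sub_eq_add_neg _ _).symm)
        rw [this]; exact hS i
      | @lie i c y hy =>
        simp only [Pi.add_apply, Finset.sum_add_distrib, sum_single] at hc
        rw [hrec]
        refine add_mem (S.lie_mem (hS i) (ih c y hy (by push_cast at hc; omega))) ?_
        obtain ⟨u, hu, v, hv, huv⟩ := Submodule.mem_sup.mp (hy.lie_f i)
        rw [← huv, map_add, hσh v hv, add_zero]
        suffices hle : bracketSpan A (∑ i, c i - 1) ≤ S.toSubmodule.comap σ from hle hu
        refine Submodule.span_le.mpr ?_
        rintro z ⟨c', hz, hc'⟩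
        exact ih c' z hz (by push_cast at hc; omega)
  have hall : ∀ x, x ∈ S.toSubmodule.comap σ := by
    have hB : ∀ c y, IsBracket A c y → σ y ∈ S := fun c y hy =>
      main (∑ i, c i).toNat c y hy (Int.self_le_toNat _)
    refine triangular_induction (fun c y hy => hB c y hy) (fun c y hy => ?_) (fun i => ?_)
    · change σ (involution A y) ∈ S
      rw [hσω]; exact hB c y hy
    · change σ (h A i) ∈ S
      rw [hσh _ (Submodule.subset_span ⟨i, rfl⟩)]; exact zero_mem _
  -- On fixed points σ is multiplication by 2, so σ is onto.
  have hk : k = σ ((1 / 2 : ℝ) • (k : Alg A)) := by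
    refine Subtype.ext ?_
    have hfix : involution A (k : Alg A) = k := k.2
    rw [hσ, map_smul, hfix, ← add_smul]
    norm_num
  rw [hk]
  exact hall _

theorem compact_hom_ext {L : Type*} [LieRing L] [LieAlgebra ℝ L] {φ ψ : maxCompact A →ₗ⁅ℝ⁆ L}
    (hφ : ∀ i, φ (compactGen A i) = ψ (compactGen A i)) : φ = ψ := by
  let S : LieSubalgebra ℝ (maxCompact A) :=
    { LinearMap.eqLocus (φ : maxCompact A →ₗ[ℝ] L) (ψ : maxCompact A →ₗ[ℝ] L) with
      lie_mem' := fun {a b} ha hb => by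
        have ha' : φ a = ψ a := ha
        have hb' : φ b = ψ b := hb
        change φ ⁅a, b⁆ = ψ ⁅a, b⁆
        rw [LieHom.map_lie, LieHom.map_lie, ha', hb'] }
  ext x
  exact (compactGen_induction (S := S) hφ x : x ∈ S)

end Brackets

end KacMoody

/-! ### Automorphisms integrating the simple reflections. -/

namespace KacMoody

/-! ### Exponentials of locally ad-nilpotent elements -/

section AdExp

variable {L : Type*} [LieRing L] [LieAlgebra ℝ L]

open Finset Nat in
open scoped Classical in
/-- The sum of the exponential series of a locally nilpotent `ad x`. -/
def adExpFun (x : L) (hx : ∀ y, ∃ n, ((LieAlgebra.ad ℝ L x) ^ n) y = 0) (y : L) : L :=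
  ∑ k ∈ range (Nat.find (hx y)), ((k ! : ℝ)⁻¹) • ((LieAlgebra.ad ℝ L x) ^ k) y

-- Frees the truncation point, so that series of several elements can be summed over one common
-- range.
open Finset Nat in
open scoped Classical in
theorem adExpFun_eq {x : L} (hx : ∀ y, ∃ n, ((LieAlgebra.ad ℝ L x) ^ n) y = 0) (y : L) (n : ℕ)
    (hn : ((LieAlgebra.ad ℝ L x) ^ n) y = 0) :
    adExpFun x hx y = ∑ k ∈ range n, ((k ! : ℝ)⁻¹) • ((LieAlgebra.ad ℝ L x) ^ k) y := by
  refine sum_subset (range_subset_range.mpr (Nat.find_min' (hx y) hn)) fun k _ hk => ?_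
  rw [Module.End.pow_map_zero_of_le (by simpa using hk) (Nat.find_spec (hx y)), smul_zero]

open Finset Nat in
/-- The automorphism `exp (ad x)` for locally nilpotent `ad x`. -/
def adExp (x : L) (hx : ∀ y, ∃ n, ((LieAlgebra.ad ℝ L x) ^ n) y = 0) : L →ₗ⁅ℝ⁆ L :=
  have key := adExpFun_eq hx
  { toFun := adExpFun x hx
    map_add' := fun y z => by
      obtain ⟨n, hn⟩ := hx y
      obtain ⟨m, hm⟩ := hx z
      have hn' := Module.End.pow_map_zero_of_le (n.le_add_right m) hn
      have hm' := Module.End.pow_map_zero_of_le (m.le_add_left n) hm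
      rw [key y _ hn', key z _ hm', key (y + z) (n + m) (by rw [map_add, hn', hm', add_zero]),
        ← sum_add_distrib]
      simp
    map_smul' := fun r y => by
      obtain ⟨n, hn⟩ := hx y
      rw [key y _ hn, key (r • y) n (by rw [map_smul, hn, smul_zero]), smul_sum]
      simp only [map_smul, RingHom.id_apply]
      exact sum_congr rfl fun k _ => smul_comm _ _ _
    map_lie' := fun {y z} => by
      obtain ⟨n, hn⟩ := hx y
      obtain ⟨m, hm⟩ := hx z
      have hn' := Module.End.pow_map_zero_of_le (n.le_add_right m) hn
      have hm' := Module.End.pow_map_zero_of_le (m.le_add_left n) hm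
      -- Beyond the antidiagonal n + m one of the two factors already vanishes; hence the sum over
      -- the triangle in the Leibniz formula equals the sum over the whole square.
      have hzero : ∀ i j, n + m ≤ i + j →
          ⁅((LieAlgebra.ad ℝ L x) ^ i) y, ((LieAlgebra.ad ℝ L x) ^ j) z⁆ = 0 := by
        intro i j hij
        rcases le_or_gt n i with hi | hi
        · rw [Module.End.pow_map_zero_of_le hi hn, zero_lie]
        · rw [Module.End.pow_map_zero_of_le (by omega : m ≤ j) hm, lie_zero]
      have hyz : ((LieAlgebra.ad ℝ L x) ^ (n + m)) ⁅y, z⁆ = 0 := by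
        rw [LieAlgebra.ad_pow_lie]
        refine sum_eq_zero fun ij hij => ?_
        rw [hzero _ _ (mem_antidiagonal.mp hij).ge, smul_zero]
      change adExpFun x hx ⁅y, z⁆ = ⁅adExpFun x hx y, adExpFun x hx z⁆
      rw [key y _ hn', key z _ hm', key _ _ hyz]
      simp only [lie_sum, sum_lie, smul_lie, lie_smul, smul_sum]
      rw [sum_comm, ← sum_product']
      set g : ℕ × ℕ → L := fun ij => ((ij.2 ! : ℝ)⁻¹) • ((ij.1 ! : ℝ)⁻¹) •
        ⁅((LieAlgebra.ad ℝ L x) ^ ij.1) y, ((LieAlgebra.ad ℝ L x) ^ ij.2) z⁆ with hg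
      have h1 : ∀ k, ((k ! : ℝ)⁻¹) • ((LieAlgebra.ad ℝ L x) ^ k) ⁅y, z⁆ =
          ∑ ij ∈ antidiagonal k, g ij := by
        intro k
        rw [LieAlgebra.ad_pow_lie, smul_sum]
        refine sum_congr rfl fun ij hij => ?_
        obtain rfl := mem_antidiagonal.mp hij
        simp only [hg]
        rw [← Nat.cast_smul_eq_nsmul ℝ, smul_smul, smul_smul]
        congr 1
        rw [Nat.cast_add_choose]
        have := Nat.factorial_ne_zero (ij.1 + ij.2)
        field_simp
      calc _ = ∑ k ∈ range (n + m), ∑ ij ∈ antidiagonal k, g ij := sum_congr rfl fun k _ => h1 k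
        _ = ∑ ij ∈ range (n + m) ×ˢ range (n + m) with ij.1 + ij.2 < n + m, g ij := by
          rw [← sum_fiberwise_of_maps_to (t := range (n + m)) (g := fun ij : ℕ × ℕ => ij.1 + ij.2)
            (fun ij hij => by simpa using (mem_filter.mp hij).2)]
          refine sum_congr rfl fun k hk => sum_congr ?_ fun _ _ => rfl
          ext ⟨i, j⟩
          simp only [HasAntidiagonal.mem_antidiagonal, mem_filter, mem_product, mem_range] at *
          omega
        _ = ∑ ij ∈ range (n + m) ×ˢ range (n + m), g ij := by
          refine sum_subset (filter_subset _ _) fun ij h1 h2 => ?_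
          have : n + m ≤ ij.1 + ij.2 := by
            by_contra hlt
            exact h2 (mem_filter.mpr ⟨h1, by omega⟩)
          simp only [hg]
          rw [hzero _ _ this, smul_zero, smul_zero] }

variable {x : L} (hx : ∀ y, ∃ n, ((LieAlgebra.ad ℝ L x) ^ n) y = 0)

open Finset Nat in
theorem adExp_apply {y : L} {n : ℕ} (hn : ((LieAlgebra.ad ℝ L x) ^ n) y = 0) :
    adExp x hx y = ∑ k ∈ range n, ((k ! : ℝ)⁻¹) • ((LieAlgebra.ad ℝ L x) ^ k) y :=
  adExpFun_eq hx y n hn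

theorem adExp_of_lie_eq_zero {y : L} (hy : ⁅x, y⁆ = 0) : adExp x hx y = y := by
  rw [adExp_apply hx (n := 1) (by simpa using hy)]; simp

theorem adExp_of_lie_lie_eq_zero {y : L} (hy : ⁅x, ⁅x, y⁆⁆ = 0) : adExp x hx y = y + ⁅x, y⁆ := by
  rw [adExp_apply hx (n := 2) (by simpa [pow_succ] using hy)]; simp [Finset.sum_range_succ]

theorem adExp_of_lie_lie_lie_eq_zero {y : L} (hy : ⁅x, ⁅x, ⁅x, y⁆⁆⁆ = 0) :
    adExp x hx y = y + ⁅x, y⁆ + (1 / 2 : ℝ) • ⁅x, ⁅x, y⁆⁆ := by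
  rw [adExp_apply hx (n := 3) (by simpa [pow_succ] using hy)]
  simp [Finset.sum_range_succ, pow_succ]

end AdExp

/-! ### Simple reflections as automorphisms -/

section Reflection

variable {ι : Type} [DecidableEq ι] {A : Matrix ι ι ℤ}

theorem lie_f_e (i j : ι) : ⁅f A i, e A j⁆ = if i = j then -h A i else 0 := by
  rw [← lie_skew, lie_e_f]
  by_cases hij : i = j
  · subst hij; simp
  · simp [hij, Ne.symm hij]

theorem lie_e_h (i j : ι) : ⁅e A i, h A j⁆ = -(A j i • e A i) := by
  rw [← lie_skew, lie_h_e]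

theorem lie_f_h (i j : ι) : ⁅f A i, h A j⁆ = A j i • f A i := by
  rw [← lie_skew, lie_h_f, neg_neg]

/-- The elements killed by some power of ad e_i form the Engel subalgebra of e_i, so it suffices to
inspect the generators. -/
theorem ad_e_locally_nilpotent (hA : IsSimplyLaced A) (i : ι) (y : Alg A) :
    ∃ n, ((LieAlgebra.ad ℝ (Alg A) (e A i)) ^ n) y = 0 := by
  rw [← LieSubalgebra.mem_engel_iff]
  refine subalgebra_eq_top (fun j => ?_) (fun j => ?_) (fun j => ?_) y
  · refine (LieSubalgebra.mem_engel_iff _ _ _).mpr ⟨2, ?_⟩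
    simp [pow_succ, lie_e_h]
  · refine (LieSubalgebra.mem_engel_iff _ _ _).mpr ⟨2, ?_⟩
    rcases hA.trichotomy i j with ⟨rfl, -⟩ | ⟨-, hij⟩ | ⟨-, hij⟩
    · simp [pow_succ]
    · simp [pow_succ, lie_e_e_of_eq_zero hij]
    · simp [pow_succ, lie_e_lie_e_e hij]
  · refine (LieSubalgebra.mem_engel_iff _ _ _).mpr ⟨3, ?_⟩
    simp only [pow_succ, pow_zero, one_mul, Module.End.mul_apply, LieAlgebra.ad_apply, lie_e_f]
    split_ifs <;> simp [lie_e_h]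

theorem ad_f_locally_nilpotent (hA : IsSimplyLaced A) (i : ι) (y : Alg A) :
    ∃ n, ((LieAlgebra.ad ℝ (Alg A) (-f A i)) ^ n) y = 0 := by
  obtain ⟨n, hn⟩ := ad_e_locally_nilpotent hA i (involution A y)
  refine ⟨n, ?_⟩
  have := congrArg (involution A) hn
  rwa [map_ad_pow, involution_involution, involution_e, map_zero] at this

/-- Integration of the simple reflection `s_i`: `exp (ad e) exp (- ad f) exp (ad e)`. -/
def reflection (hA : IsSimplyLaced A) (i : ι) : Alg A →ₗ⁅ℝ⁆ Alg A :=
  (adExp (e A i) (ad_e_locally_nilpotent hA i)).comp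
    ((adExp (-f A i) (ad_f_locally_nilpotent hA i)).comp
      (adExp (e A i) (ad_e_locally_nilpotent hA i)))

variable (hA : IsSimplyLaced A) (i : ι)

theorem reflection_apply (x : Alg A) : reflection hA i x =
    adExp (e A i) (ad_e_locally_nilpotent hA i)
      (adExp (-f A i) (ad_f_locally_nilpotent hA i)
        (adExp (e A i) (ad_e_locally_nilpotent hA i) x)) := rfl

theorem reflection_e_self : reflection hA i (e A i) = -f A i := by
  have hd := hA.diag i
  rw [reflection_apply, adExp_of_lie_eq_zero _ (lie_self _),
    adExp_of_lie_lie_lie_eq_zero (y := e A i) _ (by simp [lie_f_e, lie_f_h])]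
  simp only [map_add, map_smul, neg_lie, lie_f_e, lie_f_h, if_true, hd, neg_neg, map_neg]
  rw [adExp_of_lie_eq_zero (y := e A i) _ (lie_self _),
    adExp_of_lie_lie_eq_zero (y := h A i) _ (by simp [lie_e_h]), map_zsmul,
    adExp_of_lie_lie_lie_eq_zero (y := f A i) _ (by simp [lie_e_f, lie_e_h])]
  simp only [lie_e_h, lie_e_f, if_true, hd]
  module

theorem reflection_f_self : reflection hA i (f A i) = -e A i := by
  have hd := hA.diag i
  rw [reflection_apply,
    adExp_of_lie_lie_lie_eq_zero (y := f A i) _ (by simp [lie_e_f, lie_e_h])]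
  simp only [map_add, map_smul, lie_e_f, lie_e_h, if_true, hd, map_neg, map_zsmul]
  rw [adExp_of_lie_eq_zero (x := -f A i) (y := f A i) _ (by simp),
    adExp_of_lie_lie_eq_zero (x := -f A i) (y := h A i) _ (by simp [lie_f_h]),
    adExp_of_lie_lie_lie_eq_zero (x := -f A i) (y := e A i) _ (by simp [lie_f_e, lie_f_h])]
  simp only [map_add, map_smul, neg_lie, lie_f_e, lie_f_h, if_true, hd, neg_neg, map_neg, map_zsmul]
  rw [adExp_of_lie_eq_zero (y := e A i) _ (lie_self _),
    adExp_of_lie_lie_eq_zero (y := h A i) _ (by simp [lie_e_h]),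
    adExp_of_lie_lie_lie_eq_zero (y := f A i) _ (by simp [lie_e_f, lie_e_h])]
  simp only [lie_e_h, lie_e_f, if_true, hd]
  module

variable {i} {j : ι}

theorem reflection_e_of_eq_zero (hij : A i j = 0) : reflection hA i (e A j) = e A j := by
  have hne := hA.ne_of_eq_zero hij
  have he : ⁅e A i, e A j⁆ = 0 := lie_e_e_of_eq_zero hij
  rw [reflection_apply, adExp_of_lie_eq_zero _ he,
    adExp_of_lie_eq_zero (x := -f A i) (y := e A j) _ (by simp [lie_f_e, hne]),
    adExp_of_lie_eq_zero _ he]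

theorem reflection_f_of_eq_zero (hij : A i j = 0) : reflection hA i (f A j) = f A j := by
  have hne := hA.ne_of_eq_zero hij
  have he : ⁅e A i, f A j⁆ = 0 := by simp [lie_e_f, hne]
  rw [reflection_apply, adExp_of_lie_eq_zero _ he,
    adExp_of_lie_eq_zero (x := -f A i) (y := f A j) _ (by simp [lie_f_f_of_eq_zero hij]),
    adExp_of_lie_eq_zero _ he]

theorem lie_f_lie_e_e (hA : IsSimplyLaced A) (hij : A i j = -1) :
    ⁅f A i, ⁅e A i, e A j⁆⁆ = e A j := by
  rw [leibniz_lie, lie_f_e, lie_f_e, if_pos rfl, if_neg (hA.ne_of_eq_neg_one hij), neg_lie, lie_h_e,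
    hij]
  simp

theorem lie_e_lie_f_f (hA : IsSimplyLaced A) (hij : A i j = -1) :
    ⁅e A i, ⁅f A i, f A j⁆⁆ = f A j := by
  rw [leibniz_lie, lie_e_f, lie_e_f, if_pos rfl, if_neg (hA.ne_of_eq_neg_one hij), lie_h_f, hij]
  simp

theorem reflection_e_of_eq_neg_one (hij : A i j = -1) :
    reflection hA i (e A j) = ⁅e A i, e A j⁆ := by
  have hne := hA.ne_of_eq_neg_one hij
  have hs := lie_e_lie_e_e hij
  have hfe : ⁅f A i, e A j⁆ = 0 := by simp [lie_f_e, hne]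
  have h1 := lie_f_lie_e_e hA hij
  rw [reflection_apply, adExp_of_lie_lie_eq_zero _ hs, map_add,
    adExp_of_lie_eq_zero (x := -f A i) (y := e A j) _ (by simp [hfe]),
    adExp_of_lie_lie_eq_zero (x := -f A i) (y := ⁅e A i, e A j⁆) _ (by simp [h1, hfe]), neg_lie, h1,
    add_add_neg_cancel'_right, adExp_of_lie_eq_zero _ hs]

theorem reflection_f_of_eq_neg_one (hij : A i j = -1) :
    reflection hA i (f A j) = -⁅f A i, f A j⁆ := by
  have hne := hA.ne_of_eq_neg_one hij
  have hs := lie_f_lie_f_f hij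
  have hef : ⁅e A i, f A j⁆ = 0 := by simp [lie_e_f, hne]
  have h1 := lie_e_lie_f_f hA hij
  rw [reflection_apply, adExp_of_lie_eq_zero _ hef,
    adExp_of_lie_lie_eq_zero (x := -f A i) (y := f A j) _ (by simp [hs, -lie_skew]), map_add,
    adExp_of_lie_eq_zero _ hef, neg_lie, map_neg,
    adExp_of_lie_lie_eq_zero (y := ⁅f A i, f A j⁆) _ (by simp [h1, hef]), h1]
  abel

theorem lie_lie_e_e_lie_f_f (hA : IsSimplyLaced A) (hij : A i j = -1) :
    ⁅⁅e A i, e A j⁆, ⁅f A i, f A j⁆⁆ = -h A i - h A j := by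
  have hji : A j i = -1 := by rw [hA.symm, hij]
  have h1 : ⁅e A j, ⁅f A i, f A j⁆⁆ = -f A i := by
    rw [leibniz_lie, lie_e_f, lie_e_f, if_neg (hA.ne_of_eq_neg_one hji), if_pos rfl, lie_f_h, hji]
    simp
  rw [lie_lie, h1, lie_e_lie_f_f hA hij, lie_neg, lie_e_f, lie_e_f, if_pos rfl, if_pos rfl]

theorem reflection_h (i j : ι) : reflection hA i (h A j) = h A j - A i j • h A i := by
  have hj : h A j = ⁅e A j, f A j⁆ := by rw [lie_e_f, if_pos rfl]
  rw [hj, LieHom.map_lie]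
  rcases hA.trichotomy i j with ⟨rfl, hij⟩ | ⟨-, hij⟩ | ⟨-, hij⟩
  · rw [reflection_e_self, reflection_f_self, hij, neg_lie, lie_neg, lie_f_e, lie_e_f]
    simp only [if_true]; module
  · rw [reflection_e_of_eq_zero hA hij, reflection_f_of_eq_zero hA hij, hij]; simp
  · rw [reflection_e_of_eq_neg_one hA hij, reflection_f_of_eq_neg_one hA hij, hij, lie_neg,
      lie_lie_e_e_lie_f_f hA hij, lie_e_f, if_pos rfl]
    module

/-- Conjugation by ω swaps e_i and -f_i, turning exp(e)exp(-f)exp(e) into exp(-f)exp(e)exp(-f), the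
same element of SL₂. The proof compares both sides on the Chevalley generators. This is what lets
the reflection restrict to the compact subalgebra. -/
theorem involution_reflection (i : ι) (x : Alg A) :
    involution A (reflection hA i x) = reflection hA i (involution A x) := by
  suffices hcomp : (involution A).comp (reflection hA i) = (reflection hA i).comp (involution A) from
    LieHom.congr_fun hcomp x
  refine hom_ext (fun j => ?_) (fun j => ?_) (fun j => ?_)
  · simp [reflection_h, involution_h]; module
  all_goals
    simp only [LieHom.comp_apply, involution_e, involution_f, map_neg]
    rcases hA.trichotomy i j with ⟨rfl, hij⟩ | ⟨-, hij⟩ | ⟨-, hij⟩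
    · simp only [reflection_e_self, reflection_f_self, map_neg, involution_e, involution_f]
    · simp only [reflection_e_of_eq_zero hA hij, reflection_f_of_eq_zero hA hij, involution_e,
        involution_f]
    · simp only [reflection_e_of_eq_neg_one hA hij, reflection_f_of_eq_neg_one hA hij, involution_e,
        involution_f, LieHom.map_lie, map_neg, neg_lie, lie_neg, neg_neg]

/-- The square of the reflection fixes each h_j and multiplies each e_j and f_j by a sign. Only the
injectivity that results is needed later. -/
theorem reflection_pow_four (i : ι) (x : Alg A) :
    reflection hA i (reflection hA i (reflection hA i (reflection hA i x))) = x := by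
  suffices hcomp : ((reflection hA i).comp (reflection hA i)).comp
      ((reflection hA i).comp (reflection hA i)) = LieHom.id from LieHom.congr_fun hcomp x
  refine hom_ext (fun j => ?_) (fun j => ?_) (fun j => ?_)
  · simp only [LieHom.comp_apply, LieHom.id_apply, reflection_h, map_sub, map_zsmul, hA.diag]
    module
  all_goals
    simp only [LieHom.comp_apply, LieHom.id_apply]
    rcases hA.trichotomy i j with ⟨rfl, hij⟩ | ⟨-, hij⟩ | ⟨-, hij⟩
    · simp only [reflection_e_self, reflection_f_self, map_neg, neg_neg]
    · simp only [reflection_e_of_eq_zero hA hij, reflection_f_of_eq_zero hA hij]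
    · simp only [reflection_e_of_eq_neg_one hA hij, reflection_f_of_eq_neg_one hA hij,
        reflection_e_self, reflection_f_self, LieHom.map_lie, map_neg, neg_lie, lie_neg, neg_neg,
        lie_f_lie_e_e hA hij, lie_e_lie_f_f hA hij]

theorem reflection_injective (i : ι) : Function.Injective (reflection hA i) := fun x y hxy => by
  rw [← reflection_pow_four hA i x, hxy, reflection_pow_four]

/-- The simple reflection on the coordinates of the root lattice. -/
def reflectCoord [Fintype ι] (A : Matrix ι ι ℤ) (i : ι) (c : ι → ℤ) : ι → ℤ :=
  c - A.mulVec c i • Pi.single i 1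

theorem reflection_mem_weightSpace [Fintype ι] (i : ι) {c : ι → ℤ} {x : Alg A}
    (hx : x ∈ weightSpace A c) : reflection hA i x ∈ weightSpace A (reflectCoord A i c) := by
  intro j
  -- The reflection is an involution on the h_j, so h_j is the image of its own reflection and the
  -- eigenvalue can be computed before applying the automorphism.
  have h1 : h A j = reflection hA i (h A j - A i j • h A i) := by
    rw [map_sub, map_zsmul, reflection_h, reflection_h, hA.diag]; module
  rw [h1, ← LieHom.map_lie, sub_lie, zsmul_lie, hx j, hx i, ← map_zsmul, smul_smul, ← sub_smul]
  congr 2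
  rw [reflectCoord, Matrix.mulVec_sub, Matrix.mulVec_smul]
  simp [hA.symm i j, mul_comm]

/-- The restriction of a simple reflection to the maximal compact subalgebra. -/
def compactReflection (i : ι) : maxCompact A →ₗ⁅ℝ⁆ maxCompact A where
  toFun x := ⟨reflection hA i x, by
    have hx : involution A (x : Alg A) = x := x.2
    change involution A _ = _
    rw [involution_reflection, hx]⟩
  map_add' x y := Subtype.ext (map_add (reflection hA i) (x : Alg A) y)
  map_smul' r x := Subtype.ext (map_smul (reflection hA i) r (x : Alg A))
  map_lie' {x y} := Subtype.ext (LieHom.map_lie (reflection hA i) (x : Alg A) y)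

theorem compactReflection_symmetrize (i : ι) (x : Alg A) :
    compactReflection hA i (symmetrize A x) = symmetrize A (reflection hA i x) :=
  Subtype.ext (by
    change reflection hA i (x + involution A x) = _ + involution A (reflection hA i x)
    rw [map_add, involution_reflection])

theorem compactReflection_compactGen_self (i : ι) :
    compactReflection hA i (compactGen A i) = compactGen A i :=
  Subtype.ext (by
    change reflection hA i (e A i - f A i) = e A i - f A i
    rw [map_sub, reflection_e_self, reflection_f_self]; abel)

theorem compactReflection_compactGen_of_eq_zero (hij : A i j = 0) :
    compactReflection hA i (compactGen A j) = compactGen A j :=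
  Subtype.ext (by
    change reflection hA i (e A j - f A j) = e A j - f A j
    rw [map_sub, reflection_e_of_eq_zero hA hij, reflection_f_of_eq_zero hA hij])

theorem compactReflection_compactGen_of_eq_neg_one (hij : A i j = -1) :
    compactReflection hA i (compactGen A j) = ⁅compactGen A i, compactGen A j⁆ :=
  Subtype.ext (by
    have hne := hA.ne_of_eq_neg_one hij
    change reflection hA i (e A j - f A j) = ⁅e A i - f A i, e A j - f A j⁆
    rw [map_sub, reflection_e_of_eq_neg_one hA hij, reflection_f_of_eq_neg_one hA hij]
    simp only [sub_lie, lie_sub, lie_e_f, lie_f_e, if_neg hne]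
    abel)

end Reflection

end KacMoody

/-! ### Berman's theorem by coinduction from the compact subalgebra. -/

namespace KacMoody

variable {ι : Type} [DecidableEq ι] {A : Matrix ι ι ℤ}

/-! ### Serre elements -/

/-- The relations between the Chevalley generators other than the Serre relations. -/
structure PreChevalleyRelations (A : Matrix ι ι ℤ) {L : Type*} [LieRing L] (H E F : ι → L) :
    Prop where
  hh : ∀ i j, ⁅H i, H j⁆ = 0
  he : ∀ i j, ⁅H i, E j⁆ = A i j • E j
  hf : ∀ i j, ⁅H i, F j⁆ = -(A i j • F j)
  ef : ∀ i j, ⁅E i, F j⁆ = if i = j then H i else 0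

/-- The element whose vanishing is the Serre relation of the simply laced pair `i`, `j`. -/
def serreElement (A : Matrix ι ι ℤ) {L : Type*} [LieRing L] (E : ι → L) (i j : ι) : L :=
  if A i j = 0 then ⁅E i, E j⁆ else if A i j = -1 then ⁅E i, ⁅E i, E j⁆⁆ else 0

namespace PreChevalleyRelations

variable {L : Type*} [LieRing L] {H E F : ι → L}

/-- The relations are symmetric under exchanging E and F with H ↦ -H, so each statement about the
E_i has a twin about the F_i. -/
theorem swap (hr : PreChevalleyRelations A H E F) : PreChevalleyRelations A (-H) F E where
  hh i j := by simp [hr.hh]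
  he i j := by simp [hr.hf]
  hf i j := by simp [hr.he]
  ef i j := by
    rw [← lie_skew, hr.ef]
    by_cases hij : i = j
    · subst hij; simp
    · simp [hij, Ne.symm hij]

theorem lie_F_E (hr : PreChevalleyRelations A H E F) (i j : ι) :
    ⁅F i, E j⁆ = if i = j then -H i else 0 := hr.swap.ef i j

theorem lie_E_H (hr : PreChevalleyRelations A H E F) (i j : ι) :
    ⁅E i, H j⁆ = -(A j i • E i) := by
  rw [← lie_skew, hr.he]

/-- The Serre elements are lowest weight vectors, by the weight relations alone. In the joined case
with k = i the two contributions are -(2 - 1) and +1 times [E_i, E_j]. -/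
theorem lie_F_serreElement (hA : IsSimplyLaced A) (hr : PreChevalleyRelations A H E F)
    (i j k : ι) : ⁅F k, serreElement A E i j⁆ = 0 := by
  unfold serreElement
  split_ifs with h0 h1
  · have hij := hA.ne_of_eq_zero h0
    rw [leibniz_lie, hr.lie_F_E, hr.lie_F_E]
    by_cases hki : k = i
    · subst hki; simp [hij, hr.he, h0]
    · by_cases hkj : k = j
      · subst hkj; simp [hki, hr.lie_E_H, hA.symm k i, h0]
      · simp [hki, hkj]
  · have hij := hA.ne_of_eq_neg_one h1
    rw [leibniz_lie (F k), leibniz_lie (F k), hr.lie_F_E, hr.lie_F_E]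
    by_cases hki : k = i
    · subst hki
      simp only [if_true, if_neg hij, lie_zero, add_zero, neg_lie, lie_neg, leibniz_lie (H k),
        hr.he, hA.diag, h1, zsmul_lie, lie_zsmul]
      module
    · by_cases hkj : k = j
      · subst hkj; simp [hki, hr.lie_E_H]
      · simp [hki, hkj]
  · simp

theorem lie_H_serreElement (hr : PreChevalleyRelations A H E F) (i j k : ι) :
    ∃ c : ℤ, ⁅H k, serreElement A E i j⁆ = c • serreElement A E i j := by
  unfold serreElement
  split_ifs
  · exact ⟨A k i + A k j, by rw [leibniz_lie, hr.he, hr.he, zsmul_lie, lie_zsmul]; module⟩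
  · exact ⟨A k i + (A k i + A k j), by
      rw [leibniz_lie (H k), leibniz_lie (H k), hr.he, hr.he]
      simp only [zsmul_lie, lie_zsmul, lie_add]
      module⟩
  · exact ⟨0, by simp⟩

theorem lie_F_lie_E_E (hA : IsSimplyLaced A) (hr : PreChevalleyRelations A H E F) {i j : ι}
    (hij : A i j = -1) : ⁅F i, ⁅E i, E j⁆⁆ = E j := by
  rw [leibniz_lie, hr.lie_F_E, hr.lie_F_E, if_pos rfl, if_neg (hA.ne_of_eq_neg_one hij), neg_lie,
    hr.he, hij]
  simp

theorem lie_E_lie_F_F (hA : IsSimplyLaced A) (hr : PreChevalleyRelations A H E F) {i j : ι}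
    (hij : A i j = -1) : ⁅E i, ⁅F i, F j⁆⁆ = F j := hr.swap.lie_F_lie_E_E hA hij

end PreChevalleyRelations

theorem PreChevalleyRelations.map {L L' : Type*} [LieRing L] [LieAlgebra ℝ L] [LieRing L']
    [LieAlgebra ℝ L'] {H E F : ι → L} (hr : PreChevalleyRelations A H E F) (φ : L →ₗ⁅ℝ⁆ L') :
    PreChevalleyRelations A (fun i => φ (H i)) (fun i => φ (E i)) (fun i => φ (F i)) where
  hh i j := by rw [← LieHom.map_lie, hr.hh, map_zero]
  he i j := by rw [← LieHom.map_lie, hr.he, map_zsmul]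
  hf i j := by rw [← LieHom.map_lie, hr.hf, map_neg, map_zsmul]
  ef i j := by rw [← LieHom.map_lie, hr.ef]; split_ifs <;> simp

omit [DecidableEq ι] in
theorem map_serreElement {L L' : Type*} [LieRing L] [LieAlgebra ℝ L] [LieRing L']
    [LieAlgebra ℝ L'] (φ : L →ₗ⁅ℝ⁆ L') (E : ι → L) (i j : ι) :
    serreElement A (fun i => φ (E i)) i j = φ (serreElement A E i j) := by
  unfold serreElement
  split_ifs <;> simp [LieHom.map_lie]

/-- Images of the `e i - f i` satisfying the Berman relations of a simply laced matrix. -/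
structure BermanRelations (A : Matrix ι ι ℤ) {L : Type*} [LieRing L] (X : ι → L) : Prop where
  xx : ∀ i j, A i j = 0 → ⁅X i, X j⁆ = 0
  xxx : ∀ i j, A i j = -1 → ⁅X i, ⁅X i, X j⁆⁆ + X j = 0

/-! ### Relations in associative rings -/

section Ring

variable {R : Type*} [Ring R] {H E F : ι → R}

theorem PreChevalleyRelations.of_ring (hh : ∀ i j, H i * H j - H j * H i = 0)
    (he : ∀ i j, H i * E j - E j * H i = A i j • E j)
    (hf : ∀ i j, H i * F j - F j * H i = -(A i j • F j))
    (ef : ∀ i j, E i * F j - F j * E i = if i = j then H i else 0) :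
    PreChevalleyRelations A H E F := ⟨hh, he, hf, ef⟩

/-- On the coinduced module the relation for [H, F] is not evident. Its defect commutes with every
E_k, which leaves only the value at the empty word to check. -/
theorem commute_E_of_ring (hh : ∀ i j, H i * H j - H j * H i = 0)
    (he : ∀ i j, H i * E j - E j * H i = A i j • E j)
    (ef : ∀ i j, E i * F j - F j * E i = if i = j then H i else 0) (i j k : ι) :
    Commute (E k) (H i * F j - F j * H i + A i j • F j) := by
  simp only [← Ring.lie_def] at *
  rw [commute_iff_lie_eq]
  change LieRing.toBracket.bracket (E k) _ = 0
  rw [lie_add, leibniz_lie, ef, lie_zsmul, ef, ← lie_skew (E k), he]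
  by_cases hkj : k = j
  · subst hkj
    rw [if_pos rfl, hh, neg_lie, zsmul_lie, ef, if_pos rfl]
    simp
  · rw [if_neg hkj, neg_lie, zsmul_lie, ef, if_neg hkj]
    simp

theorem PreChevalleyRelations.ring_he (hr : PreChevalleyRelations A H E F) (i j : ι) :
    H i * E j = E j * H i + A i j • E j := sub_eq_iff_eq_add'.mp (hr.he i j)

theorem PreChevalleyRelations.ring_ef (hr : PreChevalleyRelations A H E F) (i j : ι) :
    E i * F j = F j * E i + if i = j then H i else 0 := sub_eq_iff_eq_add'.mp (hr.ef i j)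

theorem PreChevalleyRelations.commute_F_serreElement (hA : IsSimplyLaced A)
    (hr : PreChevalleyRelations A H E F) (i j k : ι) : Commute (F k) (serreElement A E i j) :=
  commute_iff_lie_eq.mpr (hr.lie_F_serreElement hA i j k)

theorem PreChevalleyRelations.serreElement_mul_H (hr : PreChevalleyRelations A H E F)
    (i j k : ι) : ∃ c : ℤ, serreElement A E i j * H k =
      H k * serreElement A E i j - c • serreElement A E i j := by
  obtain ⟨c, hc⟩ := hr.lie_H_serreElement i j k
  refine ⟨c, ?_⟩
  have hc' : H k * serreElement A E i j - serreElement A E i j * H k =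
    c • serreElement A E i j := hc
  rw [← hc']; abel

theorem lie_mul_mul_of_commute {a b x y : R} (hab : Commute a b) (hay : Commute a y)
    (hbx : Commute b x) : ⁅a * x, b * y⁆ = a * b * ⁅x, y⁆ := by
  rw [Ring.lie_def, Ring.lie_def, mul_assoc, ← mul_assoc x b, ← hbx.eq, mul_assoc b y,
    ← mul_assoc y a, ← hay.eq, mul_sub]
  simp only [mul_assoc]
  rw [← mul_assoc b a, ← hab.eq, mul_assoc]

/-- The Berman element of the torus conjugates of the `e i - f i` is a difference of conjugates of
the Serre elements. -/
theorem PreChevalleyRelations.berman_twist (hA : IsSimplyLaced A)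
    (hr : PreChevalleyRelations A H E F) {T S : ι → R} (hTS : ∀ i, T i * S i = 1)
    (hST : ∀ i, S i * T i = 1) (hT : ∀ i j, Commute (T i) (T j))
    (hTE : ∀ i j, Commute (T i) (E j)) (hTF : ∀ i j, Commute (T i) (F j)) (i j : ι) :
    (A i j = 0 → ⁅T i * E i - S i * F i, T j * E j - S j * F j⁆ =
      T i * T j * serreElement A E i j + S i * S j * serreElement A F i j) ∧
    (A i j = -1 → ⁅T i * E i - S i * F i, ⁅T i * E i - S i * F i, T j * E j - S j * F j⁆⁆ +
        (T j * E j - S j * F j) =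
      T i * T i * T j * serreElement A E i j - S i * S i * S j * serreElement A F i j) := by
  have hS : ∀ {x : R}, (∀ i, Commute (T i) x) → ∀ i, Commute (S i) x := by
    intro x hx i
    calc S i * x = S i * x * (T i * S i) := by rw [hTS, mul_one]
      _ = S i * (x * T i) * S i := by noncomm_ring
      _ = x * S i := by rw [← (hx i).eq, ← mul_assoc, hST, one_mul]
  have hTS' : ∀ i j, Commute (T i) (S j) := fun i j => (hS (fun k => hT k i) j).symm
  have hSS : ∀ i j, Commute (S i) (S j) := fun i j => hS (fun k => hTS' k j) i
  have hSE : ∀ i j, Commute (S i) (E j) := fun i j => hS (fun k => hTE k j) i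
  have hSF : ∀ i j, Commute (S i) (F j) := fun i j => hS (fun k => hTF k j) i
  have hne : A i j = 0 ∨ A i j = -1 → i ≠ j := by
    rintro (h | h)
    · exact hA.ne_of_eq_zero h
    · exact hA.ne_of_eq_neg_one h
  have hlie : ∀ {a x y : R}, Commute a x → Commute a y → Commute a ⁅x, y⁆ := by
    intro a x y hx hy
    rw [Ring.lie_def]
    exact (hx.mul_right hy).sub_right (hy.mul_right hx)
  have h1 : A i j = 0 ∨ A i j = -1 → ⁅T i * E i - S i * F i, T j * E j - S j * F j⁆ =
      T i * T j * ⁅E i, E j⁆ + S i * S j * ⁅F i, F j⁆ := by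
    intro h
    rw [sub_lie, lie_sub, lie_sub, lie_mul_mul_of_commute (hT i j) (hTE i j) (hTE j i),
      lie_mul_mul_of_commute (hTS' i j) (hTF i j) (hSE j i),
      lie_mul_mul_of_commute (hTS' j i).symm (hSE i j) (hTF j i),
      lie_mul_mul_of_commute (hSS i j) (hSF i j) (hSF j i), hr.ef, hr.lie_F_E, if_neg (hne h),
      if_neg (hne h)]
    simp
  refine ⟨fun h => ?_, fun h => ?_⟩
  · rw [h1 (Or.inl h)]
    simp [serreElement, h]
  · have hTT : ∀ {x : R}, (∀ k, Commute (T k) x) → Commute (T i * T j) x := fun hx =>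
      (hx i).mul_left (hx j)
    have hSS2 : ∀ {x : R}, (∀ k, Commute (S k) x) → Commute (S i * S j) x := fun hx =>
      (hx i).mul_left (hx j)
    -- Because T_i S_i = 1, the two mixed double brackets are S_j F_j and -T_j E_j; they cancel the
    -- added T_j E_j - S_j F_j and leave only the Serre elements.
    rw [h1 (Or.inr h), sub_lie, lie_add, lie_add,
      lie_mul_mul_of_commute (hTT fun k => hT k i).symm (hlie (hTE i i) (hTE i j))
        (hTT fun k => hTE k i),
      lie_mul_mul_of_commute (hSS2 fun k => (hTS' i k).symm).symm (hlie (hTF i i) (hTF i j))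
        (hSS2 fun k => hSE k i),
      lie_mul_mul_of_commute (hTT fun k => hTS' k i).symm (hlie (hSE i i) (hSE i j))
        (hTT fun k => hTF k i),
      lie_mul_mul_of_commute (hSS2 fun k => hSS k i).symm (hlie (hSF i i) (hSF i j))
        (hSS2 fun k => hSF k i),
      hr.lie_E_lie_F_F hA h, hr.lie_F_lie_E_E hA h, ← mul_assoc (T i) (S i), hTS,
      ← mul_assoc (S i) (T i), hST, one_mul, one_mul]
    simp only [serreElement, h, mul_assoc]
    norm_num
    abel

end Ring

/-! ### The coinduced module -/

section Coinduced

variable {P : Type*} [AddCommGroup P] [Module ℝ P]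

/-- Operators on functions on a torus: `H` are the invariant vector fields, `T` multiplication by
the simple characters with inverses `S`, and `X` act on the values. -/
structure TorusOperators (A : Matrix ι ι ℤ) (H T S X : ι → Module.End ℝ P) : Prop where
  hh : ∀ i j, H i * H j = H j * H i
  ht : ∀ i j, H j * T i = T i * H j - A j i • T i
  tt : ∀ i j, Commute (T i) (T j)
  ts : ∀ i, T i * S i = 1
  st : ∀ i, S i * T i = 1
  hx : ∀ i j, Commute (H i) (X j)
  tx : ∀ i j, Commute (T i) (X j)

/-- Right translation by `e i`. -/
def coE (P : Type*) [AddCommGroup P] [Module ℝ P] (i : ι) : Module.End ℝ (List ι → P) :=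
  LinearMap.funLeft ℝ P fun w => i :: w

/-- Right translation by `h i`. -/
def coH (A : Matrix ι ι ℤ) (H : ι → Module.End ℝ P) (i : ι) : Module.End ℝ (List ι → P) :=
  -- Moving h_i through the word to reach the torus, where it acts by `H i`, costs the weight of the
  -- word.
  LinearMap.pi fun w => (H i - (w.map (A i)).sum • (1 : Module.End ℝ P)) ∘ₗ LinearMap.proj w

/-- The values on words of the right translation by `f i`. -/
def coFAux (A : Matrix ι ι ℤ) (H T X : ι → Module.End ℝ P) (i : ι) :
    List ι → ((List ι → P) →ₗ[ℝ] P)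
  -- At a torus point a, a f_i = α_i(a)⁻¹ f_i a with f_i = e_i - x_i, and bringing e_i back to the
  -- right of a costs another α_i(a)⁻¹. Here `T i` stands for the character α_i⁻¹, and x_i acts on
  -- values by `X i`.
  | [] => (T i * T i) ∘ₗ LinearMap.proj [i] - (T i * X i) ∘ₗ LinearMap.proj []
  -- Forced by [e_j, f_i] = δ_ij h_i.
  | j :: w => coFAux A H T X i w ∘ₗ coE P j + if i = j then LinearMap.proj w ∘ₗ coH A H i else 0

/-- Right translation by `f i`. -/
def coF (A : Matrix ι ι ℤ) (H T X : ι → Module.End ℝ P) (i : ι) : Module.End ℝ (List ι → P) :=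
  LinearMap.pi (coFAux A H T X i)

variable {H T S X : ι → Module.End ℝ P} {F : List ι → P} {i j : ι} {w : List ι}

omit [DecidableEq ι] in
theorem coE_apply : coE P i F w = F (i :: w) := rfl

omit [DecidableEq ι] in
theorem coH_apply : coH A H i F w = H i (F w) - (w.map (A i)).sum • F w := rfl

theorem coF_nil : coF A H T X i F [] = T i (T i (F [i])) - T i (X i (F [])) := rfl

theorem coF_cons : coF A H T X i F (j :: w) =
    coF A H T X i (coE P j F) w + if i = j then coH A H i F w else 0 := by
  change (coFAux A H T X i w ∘ₗ coE P j + if i = j then LinearMap.proj w ∘ₗ coH A H i else 0) F = _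
  split_ifs <;> rfl

-- The value at a word is the value at the empty word of an iterated translate, so an operator
-- commuting with all translations is determined at the empty word.
omit [DecidableEq ι] in
theorem eq_zero_of_commute_coE {D : Module.End ℝ (List ι → P)}
    (hD : ∀ k, Commute (coE P k) D) (h0 : ∀ F, D F [] = 0) : D = 0 := by
  ext F w
  induction w generalizing F with
  | nil => exact h0 F
  | cons k w ih =>
    have := congrFun (LinearMap.congr_fun (hD k).eq F) w
    exact this.trans (ih _)

/-- The brackets of h with e and of e with f hold by the construction of `coH` and `coF`. For h with
f, `commute_E_of_ring` reduces the claim to the explicit formula at the empty word. -/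
theorem coinduced_relations (ht : TorusOperators A H T S X) :
    PreChevalleyRelations A (coH A H) (coE P) (coF A H T X) := by
  have hhe : ∀ i j, coH A H i * coE P j - coE P j * coH A H i = A i j • coE P j := by
    intro i j
    refine LinearMap.ext fun F => funext fun w => ?_
    simp only [LinearMap.sub_apply, Module.End.mul_apply, Pi.sub_apply, coH_apply,
      coE_apply, LinearMap.smul_apply, Pi.smul_apply, List.map_cons, List.sum_cons]
    module
  have hef : ∀ i j, coE P i * coF A H T X j - coF A H T X j * coE P i =
      if i = j then coH A H i else 0 := by
    intro i j
    refine LinearMap.ext fun F => funext fun w => ?_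
    simp only [LinearMap.sub_apply, Module.End.mul_apply, Pi.sub_apply]
    rw [coE_apply, coF_cons, add_sub_cancel_left]
    by_cases hij : i = j
    · subst hij; simp
    · simp [hij, Ne.symm hij]
  have hhh : ∀ i j, coH A H i * coH A H j - coH A H j * coH A H i = 0 := by
    intro i j
    refine LinearMap.ext fun F => funext fun w => ?_
    have := LinearMap.congr_fun (ht.hh i j) (F w)
    simp only [Module.End.mul_apply] at this
    simp only [LinearMap.sub_apply, Module.End.mul_apply, Pi.sub_apply, coH_apply,
      map_sub, map_zsmul, this, LinearMap.zero_apply, Pi.zero_apply]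
    module
  refine .of_ring hhh hhe (fun i j => eq_neg_of_add_eq_zero_left ?_) hef
  refine eq_zero_of_commute_coE (commute_E_of_ring hhh hhe hef i j) fun F => ?_
  have h1 := fun p => LinearMap.congr_fun (ht.ht j i) p
  have h2 := fun p => LinearMap.congr_fun (ht.hx i j).eq p
  simp only [Module.End.mul_apply, LinearMap.sub_apply, LinearMap.smul_apply] at h1 h2
  simp only [LinearMap.add_apply, LinearMap.sub_apply, Module.End.mul_apply,
    Pi.add_apply, Pi.sub_apply, LinearMap.smul_apply, Pi.smul_apply, coF_nil, coH_apply,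
    map_sub, h1, h2, map_zsmul, List.map_cons, List.sum_cons, List.map_nil, List.sum_nil]
  module

/-- Precomposition, with a sign that makes it a homomorphism. -/
def negPrecomp (M P : Type*) [AddCommGroup M] [Module ℝ M] [AddCommGroup P] [Module ℝ P] :
    Module.End ℝ M →ₗ⁅ℝ⁆ Module.End ℝ (M →ₗ[ℝ] P) where
  toFun u := -LinearMap.lcomp ℝ P u
  map_add' u v := by ext; simp; abel
  map_smul' r u := by ext; simp
  map_lie' {u v} := by
    refine LinearMap.ext fun y => LinearMap.ext fun m => ?_
    change -(y (u (v m) - v (u m))) = - -(y (v (u m))) - - -(y (u (v m)))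
    rw [map_sub]; abel

/-- Postcomposition. -/
def postcomp (M : Type*) [AddCommGroup M] [Module ℝ M] (t : Module.End ℝ P) :
    Module.End ℝ (M →ₗ[ℝ] P) := LinearMap.compRight ℝ t

omit [DecidableEq ι] in
theorem postcomp_apply {M : Type*} [AddCommGroup M] [Module ℝ M] (t : Module.End ℝ P)
    (y : M →ₗ[ℝ] P) : postcomp M t y = t ∘ₗ y := rfl

/-- The only place where the Berman relations enter. On linear maps from the module to P, the
operators x_i = T_i e_i - S_i f_i send evaluation at the empty word to -X_i ∘ ev and commute with
postcomposition by the X_k. Hence the Berman element of the x_i kills ev. By `berman_twist` it is a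
combination, with invertible torus factors, of the Serre elements of the e_i and of the f_i; if the
former kill F, so do the latter at the empty word. -/
theorem serreElement_coF_nil (hA : IsSimplyLaced A) (ht : TorusOperators A H T S X)
    (hX : BermanRelations A X) (hF : serreElement A (coE P) i j F = 0) :
    serreElement A (coF A H T X) i j F [] = 0 := by
  let M := List ι → P
  let φ := negPrecomp M P
  let ev : M →ₗ[ℝ] P := LinearMap.proj []
  have hφ : ∀ (u : Module.End ℝ M) (y : M →ₗ[ℝ] P), φ u y = -(y ∘ₗ u) := fun _ _ => rfl
  have hcom : ∀ {a b : Module.End ℝ P}, Commute a b → Commute (postcomp M a) (postcomp M b) :=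
    fun {a b} h => LinearMap.ext fun y => by
      change (a * b) ∘ₗ y = (b * a) ∘ₗ y
      rw [h.eq]
  have hone : ∀ {a b : Module.End ℝ P}, a * b = 1 → postcomp M a * postcomp M b = 1 :=
    fun {a b} h => LinearMap.ext fun y => by
      change (a * b) ∘ₗ y = y
      rw [h]; rfl
  have hcomφ : ∀ (a : Module.End ℝ P) (u : Module.End ℝ M), Commute (postcomp M a) (φ u) :=
    fun a u => LinearMap.ext fun y => LinearMap.ext fun m => by
      change a (-(y (u m))) = -(a (y (u m)))
      rw [map_neg]
  have hsx : ∀ i j, Commute (S i) (X j) := fun i j => by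
    calc S i * X j = S i * X j * (T i * S i) := by rw [ht.ts, mul_one]
      _ = S i * (X j * T i) * S i := by noncomm_ring
      _ = X j * S i := by rw [← (ht.tx i j).eq, ← mul_assoc, ht.st, one_mul]
  have key := ((coinduced_relations ht).map φ).berman_twist hA (T := fun i => postcomp M (T i))
    (S := fun i => postcomp M (S i)) (fun i => hone (ht.ts i)) (fun i => hone (ht.st i))
    (fun i j => hcom (ht.tt i j)) (fun i j => hcomφ _ _) (fun i j => hcomφ _ _) i j
  set x : ι → Module.End ℝ (M →ₗ[ℝ] P) := fun i =>
    postcomp M (T i) * φ (coE P i) - postcomp M (S i) * φ (coF A H T X i) with hx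
  have hxev : ∀ i, x i ev = -postcomp M (X i) ev := by
    intro i
    refine LinearMap.ext fun G => ?_
    change T i (-(G [i])) - S i (-(coF A H T X i G [])) = -(X i (G []))
    have hST := fun p => LinearMap.congr_fun (ht.st i) p
    simp only [Module.End.mul_apply, Module.End.one_apply] at hST
    rw [coF_nil, neg_sub, map_sub, map_neg, hST, hST]
    abel
  have hxX : ∀ i k y, x i (postcomp M (X k) y) = postcomp M (X k) (x i y) := by
    intro i k y
    have h : Commute (x i) (postcomp M (X k)) :=
      ((hcom (ht.tx i k)).mul_left (hcomφ _ _).symm).sub_left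
        ((hcom (hsx i k)).mul_left (hcomφ _ _).symm)
    exact LinearMap.congr_fun h.eq y
  change (A i j = 0 → ⁅x i, x j⁆ = _) ∧ (A i j = -1 → ⁅x i, ⁅x i, x j⁆⁆ + x j = _) at key
  rw [map_serreElement, map_serreElement] at key
  have hcancel : ∀ {a b : Module.End ℝ P} {p : P}, a * b = 1 → b p = 0 → p = 0 := by
    intro a b p hab hp
    have := LinearMap.congr_fun hab p
    rw [Module.End.mul_apply, hp, map_zero] at this
    exact this.symm
  rcases hA.trichotomy i j with ⟨rfl, h⟩ | ⟨hij, h⟩ | ⟨hij, h⟩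
  · simp [serreElement, h]
  · have h1 := LinearMap.congr_fun (LinearMap.congr_fun (key.1 h) ev) F
    have h2 : ⁅x i, x j⁆ ev = 0 := by
      have hXX := sub_eq_zero.mp (hX.xx i j h)
      change x i (x j ev) - x j (x i ev) = 0
      simp only [hxev, map_neg, hxX, neg_neg]
      rw [sub_eq_zero]
      change (X j * X i) ∘ₗ ev = (X i * X j) ∘ₗ ev
      rw [hXX]
    rw [h2] at h1
    change 0 = T i (T j (-(serreElement A (coE P) i j F []))) +
      S i (S j (-(serreElement A (coF A H T X) i j F []))) at h1
    rw [hF] at h1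
    simp only [Pi.zero_apply, neg_zero, map_zero, zero_add, map_neg] at h1
    exact hcancel (ht.ts j) (hcancel (ht.ts i) (neg_eq_zero.mp h1.symm))
  · have h1 := LinearMap.congr_fun (LinearMap.congr_fun (key.2 h) ev) F
    have h2 : (⁅x i, ⁅x i, x j⁆⁆ + x j) ev = 0 := by
      have hXX : X i * (X i * X j - X j * X i) - (X i * X j - X j * X i) * X i + X j = 0 :=
        hX.xxx i j h
      change x i (x i (x j ev) - x j (x i ev)) - (x i (x j (x i ev)) - x j (x i (x i ev))) +
        x j ev = 0
      simp only [hxev, map_neg, map_sub, hxX, neg_neg]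
      have h3 := congrArg (fun t => -(postcomp M t ev)) hXX
      refine Eq.trans (LinearMap.ext fun G => ?_) (h3.trans (by ext; simp [postcomp_apply]))
      change -(X j (X i (X i (ev G)))) - -(X i (X j (X i (ev G)))) -
        (-(X i (X j (X i (ev G)))) - -(X i (X i (X j (ev G))))) + -(X j (ev G)) = 
        -(X i (X i (X j (ev G)) - X j (X i (ev G))) - 
          (X i (X j (X i (ev G))) - X j (X i (X i (ev G)))) + X j (ev G))
      rw [map_sub]
      abel
    rw [h2] at h1
    change 0 = T i (T i (T j (-(serreElement A (coE P) i j F [])))) -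
      S i (S i (S j (-(serreElement A (coF A H T X) i j F [])))) at h1
    rw [hF] at h1
    simp only [Pi.zero_apply, neg_zero, map_zero, zero_sub, map_neg, neg_neg] at h1
    exact hcancel (ht.ts j) (hcancel (ht.ts i) (hcancel (ht.ts i) h1.symm))

/-- The functions killed by the Serre elements of the `e i` and stable under translation. -/
def serreSubmodule (A : Matrix ι ι ℤ) (P : Type*) [AddCommGroup P] [Module ℝ P] :
    Submodule ℝ (List ι → P) where
  carrier := {F | ∀ (w : List ι) i j, serreElement A (coE P) i j ((w.map (coE P)).prod F) = 0}
  add_mem' := fun {F G} hF hG w i j => by rw [map_add, map_add, hF, hG, add_zero]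
  zero_mem' := by simp
  smul_mem' := fun r F hF w i j => by rw [map_smul, map_smul, hF, smul_zero]

omit [DecidableEq ι] in
theorem coE_mem_serreSubmodule (hF : F ∈ serreSubmodule A P) (k : ι) :
    coE P k F ∈ serreSubmodule A P := fun w i j => by
  have := hF (w ++ [k]) i j
  simpa using this

theorem coH_mem_serreSubmodule (ht : TorusOperators A H T S X)
    (hF : F ∈ serreSubmodule A P) (k : ι) : coH A H k F ∈ serreSubmodule A P := by
  have hr := coinduced_relations ht
  have hw : ∀ w : List ι, ∃ c : ℤ, ∀ G, (w.map (coE P)).prod (coH A H k G) =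
      coH A H k ((w.map (coE P)).prod G) + c • (w.map (coE P)).prod G := by
    intro w
    induction w with
    | nil => exact ⟨0, fun G => by simp⟩
    | cons l w ih =>
      obtain ⟨c, hc⟩ := ih
      refine ⟨c - A k l, fun G => ?_⟩
      have := LinearMap.congr_fun (hr.ring_he k l) ((w.map (coE P)).prod G)
      simp only [Module.End.mul_apply, LinearMap.add_apply, LinearMap.smul_apply] at this
      simp only [List.map_cons, List.prod_cons, Module.End.mul_apply, hc, map_add, map_zsmul, this]
      module
  intro w i j
  obtain ⟨c, hc⟩ := hw w
  obtain ⟨c', hc'⟩ := hr.serreElement_mul_H i j k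
  have h1 := LinearMap.congr_fun hc' ((w.map (coE P)).prod F)
  simp only [Module.End.mul_apply, LinearMap.sub_apply, LinearMap.smul_apply] at h1
  rw [hc, map_add, map_zsmul, h1, hF]
  simp

/-- Induction from the end of the word, since its last letter acts first. Passing f_k across that
letter costs at most h_k, and at the empty word f_k commutes with the Serre elements of the e_i. -/
theorem coF_mem_serreSubmodule (hA : IsSimplyLaced A) (ht : TorusOperators A H T S X)
    (hF : F ∈ serreSubmodule A P) (k : ι) : coF A H T X k F ∈ serreSubmodule A P := by
  have hr := coinduced_relations ht
  intro w i j
  induction w using List.reverseRecOn generalizing F with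
  | nil =>
    have h1 := LinearMap.congr_fun (hr.commute_F_serreElement hA i j k).eq F
    have h2 := hF [] i j
    simp only [Module.End.mul_apply, List.map_nil, List.prod_nil, Module.End.one_apply] at h1 h2 ⊢
    rw [← h1, h2, map_zero]
  | append_singleton w l ih =>
    have h1 := LinearMap.congr_fun (hr.ring_ef l k) F
    simp only [List.map_append, List.prod_append, List.map_cons, List.map_nil, List.prod_cons,
      List.prod_nil, mul_one, Module.End.mul_apply, LinearMap.add_apply] at h1 ⊢
    rw [h1, map_add, map_add, ih (coE_mem_serreSubmodule hF l), zero_add]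
    split_ifs
    · exact coH_mem_serreSubmodule ht hF l w i j
    · simp

/-- The twin of `lie_F_serreElement` says that the Serre elements of the f_i commute with every e_k,
which moves the claim from any word to the empty one. -/
theorem serreElement_coF_eq_zero (hA : IsSimplyLaced A) (ht : TorusOperators A H T S X)
    (hX : BermanRelations A X) (hF : F ∈ serreSubmodule A P) (i j : ι) :
    serreElement A (coF A H T X) i j F = 0 := by
  funext w
  induction w generalizing F with
  | nil => exact serreElement_coF_nil hA ht hX (hF [] i j)
  | cons k w ih =>
    have h1 := LinearMap.congr_fun
      ((coinduced_relations ht).swap.commute_F_serreElement hA i j k).eq F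
    exact (congrFun h1 w).trans (ih (coE_mem_serreSubmodule hF k))

/-- The action of the Kac-Moody algebra on the coinduced module. -/
theorem exists_coinduced_action (hA : IsSimplyLaced A) (ht : TorusOperators A H T S X)
    (hX : BermanRelations A X) :
    ∃ φ : Alg A →ₗ⁅ℝ⁆ Module.End ℝ (serreSubmodule A P), ∀ i F,
      (φ (e A i) F : List ι → P) = coE P i F ∧ (φ (f A i) F : List ι → P) = coF A H T X i F := by
  have hr := coinduced_relations ht
  let D := serreSubmodule A P
  let E' : ι → Module.End ℝ D := fun i =>
    (coE P i).restrict fun F hF => coE_mem_serreSubmodule hF i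
  let F' : ι → Module.End ℝ D := fun i =>
    (coF A H T X i).restrict fun F hF => coF_mem_serreSubmodule hA ht hF i
  let H' : ι → Module.End ℝ D := fun i =>
    (coH A H i).restrict fun F hF => coH_mem_serreSubmodule ht hF i
  have hext : ∀ {u v : Module.End ℝ D}, (∀ F : D, (u F : List ι → P) = v F) → u = v :=
    fun h => LinearMap.ext fun F => Subtype.ext (h F)
  have hr' : PreChevalleyRelations A H' E' F' := by
    refine .of_ring (fun i j => hext fun F => ?_) (fun i j => hext fun F => ?_)
      (fun i j => hext fun F => ?_) (fun i j => hext fun F => ?_)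
    · exact LinearMap.congr_fun (hr.hh i j) F
    · exact LinearMap.congr_fun (hr.he i j) F
    · exact LinearMap.congr_fun (hr.hf i j) F
    · refine (LinearMap.congr_fun (hr.ef i j) F).trans ?_
      split_ifs <;> rfl
  have hsE : ∀ i j, serreElement A E' i j = 0 := fun i j => hext fun F => by
    refine Eq.trans ?_ (F.2 [] i j)
    unfold serreElement
    split_ifs <;> rfl
  have hsF : ∀ i j, serreElement A F' i j = 0 := fun i j => hext fun F => by
    refine Eq.trans ?_ (serreElement_coF_eq_zero hA ht hX F.2 i j)
    unfold serreElement
    split_ifs <;> rfl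
  obtain ⟨φ, -, hφE, hφF⟩ := exists_lift hA (H := H') (E := E') (F := F')
    { hh := hr'.hh
      he := hr'.he
      hf := hr'.hf
      ef := hr'.ef
      ee := fun i j h => by simpa [serreElement, h] using hsE i j
      ff := fun i j h => by simpa [serreElement, h] using hsF i j
      eee := fun i j h => by simpa [serreElement, h] using hsE i j
      fff := fun i j h => by simpa [serreElement, h] using hsF i j }
  exact ⟨φ, fun i F => ⟨by rw [hφE]; rfl, by rw [hφF]; rfl⟩⟩

/-- Frobenius reciprocity: ε at the empty word is evaluation at the identity, and there x_i acts as
left multiplication by b_i. -/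
theorem exists_hom_of_torusOperators [Fintype ι] (hA : IsSimplyLaced A)
    (ht : TorusOperators A H T S X) (hX : BermanRelations A X) {B : Type*} [Ring B] [Algebra ℝ B]
    (ε : P →ₗ[ℝ] B) {b : ι → B} {p₁ : P} (hp₁ : ε p₁ = 1) (hεT : ∀ i p, ε (T i p) = ε p)
    (hεX : ∀ i p, ε (X i p) = b i * ε p) :
    ∃ ρ : maxCompact A →ₗ⁅ℝ⁆ B, ∀ i, ρ (compactGen A i) = b i := by
  obtain ⟨φ, hφ⟩ := exists_coinduced_action hA ht hX
  let D := serreSubmodule A P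
  let ev : D →ₗ[ℝ] B := ε ∘ₗ LinearMap.proj [] ∘ₗ D.subtype
  -- A vector killed by all e_i, hence in the Serre submodule, with value 1 at the identity. It
  -- recovers an element of B from the left multiplication that it induces.
  let F₁ : List ι → P := fun w => if w = [] then p₁ else 0
  have hF₁ : ∀ i, coE P i F₁ = 0 := fun i => funext fun w => by
    rw [coE_apply]; simp [F₁]
  have hF₁D : F₁ ∈ D := by
    intro w i j
    induction w using List.reverseRecOn with
    | nil =>
      have h1 : ∀ k l, (coE P k * coE P l - coE P l * coE P k : Module.End ℝ (List ι → P)) F₁ = 0 := fun k l => by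
        simp [hF₁]
      simp only [List.map_nil, List.prod_nil, Module.End.one_apply]
      unfold serreElement
      split_ifs
      · exact h1 i j
      · change coE _ i ((coE P i * coE P j - coE P j * coE P i) F₁) -
          (coE P i * coE P j - coE P j * coE P i) (coE _ i F₁) = 0
        rw [h1, hF₁, map_zero, map_zero, sub_zero]
      · rfl
    | append_singleton w l ih => simp [hF₁]
  let v : D := ⟨F₁, hF₁D⟩
  have hv : ev v = 1 := by
    change ε (F₁ []) = 1
    simpa [F₁] using hp₁
  let r : maxCompact A →ₗ[ℝ] B :=
    { toFun := fun k => ev (φ k v)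
      map_add' := fun k l => by simp
      map_smul' := fun t k => by simp }
  have hr : ∀ k, r k = ev (φ k v) := fun _ => rfl
  have hlie : ∀ (x y : Alg A) G, φ ⁅x, y⁆ G = φ x (φ y G) - φ y (φ x G) := fun x y G => by
    rw [LieHom.map_lie]; rfl
  -- The elements acting through evaluation as left multiplication by `r k`. They form a subalgebra,
  -- on which r respects brackets.
  let Q : LieSubalgebra ℝ (maxCompact A) :=
    { carrier := {k | ∀ G, ev (φ k G) = r k * ev G}
      add_mem' := fun {k l} hk hl G => by
        rw [map_add, add_mul, ← hk, ← hl]; simp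
      zero_mem' := fun G => by simp
      smul_mem' := fun t k hk G => by
        rw [map_smul, smul_mul_assoc, ← hk]; simp
      lie_mem' := fun {k l} hk hl G => by
        have h2 : ∀ G, ev (φ (⁅k, l⁆ : maxCompact A) G) = (r k * r l - r l * r k) * ev G := fun G => by
          rw [LieSubalgebra.coe_bracket, hlie, map_sub, hk, hl, hl, hk]; noncomm_ring
        have h3 : r ⁅k, l⁆ = r k * r l - r l * r k := by
          rw [← mul_one (_ - _), ← hv, ← h2]; rfl
        rw [h3]; exact h2 G }
  have hgen : ∀ i G, ev (φ (compactGen A i) G) = b i * ev G := by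
    intro i G
    change ev (φ (e A i - f A i) G) = _
    have h1 : φ (e A i - f A i) G = φ (e A i) G - φ (f A i) G := by rw [map_sub]; rfl
    rw [h1, map_sub]
    change ε ((φ (e A i) G : List ι → P) []) -
      ε ((φ (f A i) G : List ι → P) []) = b i * ε (G.1 [])
    -- ε does not see T_i, so at the identity f_i acts as e_i - b_i and the e_i terms cancel.
    rw [(hφ i G).1, (hφ i G).2, coF_nil, map_sub, hεT, hεT, hεT, hεX, coE_apply]
    abel
  have hrgen : ∀ i, r (compactGen A i) = b i := fun i => by rw [hr, hgen, hv, mul_one]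
  have hQ : ∀ k, k ∈ Q := compactGen_induction fun i G => by rw [hgen, hrgen]
  exact ⟨{ r with
    map_lie' := fun {k l} => by
      change ev (φ ⁅(k : Alg A), (l : Alg A)⁆ v) = r k * r l - r l * r k
      rw [hlie, map_sub, hQ k, hQ l, hQ l, hQ k, hv, mul_one, mul_one] }, hrgen⟩

end Coinduced

/-! ### Representations of the maximal compact subalgebra from the Berman relations -/

section Berman

variable {B : Type*} [Ring B] [Algebra ℝ B]

/-- Finite sums of characters of a torus with coefficients in `B`. -/
abbrev Characters (ι B : Type*) [Ring B] : Type _ := (ι → ℤ) →₀ B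

def charDeriv (B : Type*) [Ring B] [Algebra ℝ B] (i : ι) : Module.End ℝ (Characters ι B) :=
  Finsupp.lsum ℝ fun μ => μ i • Finsupp.lsingle μ

def charShift (B : Type*) [Ring B] [Algebra ℝ B] (c : ι → ℤ) : Module.End ℝ (Characters ι B) :=
  Finsupp.lmapDomain B ℝ fun μ => μ + c

def charMul (ι : Type) (b : B) : Module.End ℝ (Characters ι B) :=
  Finsupp.mapRange.linearMap (LinearMap.mulLeft ℝ b)

/-- The value at the identity. -/
def charSum (ι B : Type*) [Ring B] [Algebra ℝ B] : Characters ι B →ₗ[ℝ] B :=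
  Finsupp.lsum ℝ fun _ => LinearMap.id

variable {i j : ι} {c c' μ : ι → ℤ} {b b' x : B}

omit [DecidableEq ι] in
@[simp] theorem charDeriv_single :
    charDeriv B i (Finsupp.single μ x) = μ i • Finsupp.single μ x := by
  simp [charDeriv]

omit [DecidableEq ι] in
@[simp] theorem charShift_single :
    charShift B c (Finsupp.single μ x) = Finsupp.single (μ + c) x := by
  simp [charShift]

omit [DecidableEq ι] in
@[simp] theorem charMul_single :
    charMul ι b (Finsupp.single μ x) = Finsupp.single μ (b * x) := by
  simp [charMul]

omit [DecidableEq ι] in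
@[simp] theorem charSum_single : charSum ι B (Finsupp.single μ x) = x := by
  simp [charSum]

omit [DecidableEq ι] in
theorem characters_hom_ext {V : Type*} [AddCommGroup V] [Module ℝ V]
    {u v : Characters ι B →ₗ[ℝ] V}
    (h : ∀ μ x, u (Finsupp.single μ x) = v (Finsupp.single μ x)) : u = v :=
  Finsupp.lhom_ext h

omit [DecidableEq ι] in
theorem charSum_charShift (p : Characters ι B) : charSum ι B (charShift B c p) = charSum ι B p :=
  LinearMap.congr_fun (characters_hom_ext (u := charSum ι B ∘ₗ charShift B c) (by simp)) p

omit [DecidableEq ι] in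
theorem charSum_charMul (p : Characters ι B) : charSum ι B (charMul ι b p) = b * charSum ι B p :=
  LinearMap.congr_fun (characters_hom_ext (u := charSum ι B ∘ₗ charMul ι b)
    (v := LinearMap.mulLeft ℝ b ∘ₗ charSum ι B) (by simp [-Finsupp.single_mul])) p

-- A character is recorded by its eigenvalues μ_j under the h_j. Shifting by -A_ji is multiplication
-- by the character of -α_i.
omit [DecidableEq ι] in
theorem characters_torusOperators (A : Matrix ι ι ℤ) (X : ι → B) :
    TorusOperators A (charDeriv B) (fun i => charShift B fun j => -A j i)
      (fun i => charShift B fun j => A j i) (fun i => charMul ι (X i)) where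
  hh i j := characters_hom_ext fun μ x => by simp [smul_comm (μ i) (μ j), -zsmul_eq_mul]
  ht i j := characters_hom_ext fun μ x => by
    simp only [Module.End.mul_apply, LinearMap.sub_apply, LinearMap.smul_apply, charShift_single,
      charDeriv_single, map_zsmul, Pi.add_apply]
    module
  tt i j := characters_hom_ext fun μ x => by simp [add_right_comm]
  ts i := characters_hom_ext fun μ x => by
    simp only [Module.End.mul_apply, charShift_single, Module.End.one_apply]
    congr 1; ext; simp
  st i := characters_hom_ext fun μ x => by
    simp only [Module.End.mul_apply, charShift_single, Module.End.one_apply]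
    congr 1; ext; simp
  hx i j := characters_hom_ext fun μ x => by simp [-Finsupp.single_mul, -zsmul_eq_mul]
  tx i j := characters_hom_ext fun μ x => by simp [-Finsupp.single_mul]

omit [DecidableEq ι] in
theorem characters_bermanRelations {X : ι → B} (hX : BermanRelations A X) :
    BermanRelations A fun i => charMul ι (X i) where
  xx i j h := characters_hom_ext fun μ x => by
    have := hX.xx i j h
    rw [Ring.lie_def, sub_eq_zero] at this
    change charMul ι (X i) (charMul ι (X j) _) - charMul ι (X j) (charMul ι (X i) _) = 0
    simp only [charMul_single, ← mul_assoc, this, sub_self]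
  xxx i j h := characters_hom_ext fun μ x => by
    have h0 : X i * (X i * X j - X j * X i) - (X i * X j - X j * X i) * X i + X j = 0 :=
      hX.xxx i j h
    have := congrArg (fun b => Finsupp.single μ (b * x)) h0
    simp only [zero_mul, Finsupp.single_zero] at this
    refine Eq.trans ?_ this
    change charMul ι (X i) (charMul ι (X i) (charMul ι (X j) _) -
      charMul ι (X j) (charMul ι (X i) _)) - (charMul ι (X i) (charMul ι (X j)
      (charMul ι (X i) _)) - charMul ι (X j) (charMul ι (X i) (charMul ι (X i) _))) +
      charMul ι (X j) _ = _
    simp only [charMul_single, ← Finsupp.single_sub, ← Finsupp.single_add]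
    congr 1
    noncomm_ring

/-- Berman's theorem: elements of an associative algebra satisfying the Berman relations define a
homomorphism of the maximal compact subalgebra. -/
theorem exists_hom_of_bermanRelations [Fintype ι] (hA : IsSimplyLaced A) {X : ι → B}
    (hX : BermanRelations A X) :
    ∃ ρ : maxCompact A →ₗ⁅ℝ⁆ B, ∀ i, ρ (compactGen A i) = X i :=
  exists_hom_of_torusOperators hA (characters_torusOperators A X) (characters_bermanRelations hX)
    (charSum ι B) (p₁ := Finsupp.single 0 1) charSum_single (fun _ => charSum_charShift)
    fun _ => charSum_charMul

end Berman

end KacMoody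

/-! ### Reduction of real roots to simple roots by descent on the height. -/

namespace KacMoody

/-! ### Weights and real roots -/

section RealRoots

variable {ι : Type} [DecidableEq ι] [Fintype ι] {A : Matrix ι ι ℤ} {c : ι → ℤ}

/-- The joint generalised eigenspaces of the `h i`. -/
def jointEigenspace (A : Matrix ι ι ℤ) (χ : ι → ℝ) : Submodule ℝ (Alg A) :=
  ⨅ i, ((LieAlgebra.ad ℝ (Alg A) (h A i) : Module.End ℝ (Alg A)).maxGenEigenspace (χ i))

omit [Fintype ι] in
theorem jointEigenspace_iSupIndep (A : Matrix ι ι ℤ) : iSupIndep (jointEigenspace A) := by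
  refine Module.End.independent_iInf_maxGenEigenspace_of_forall_mapsTo
    (fun i => (LieAlgebra.ad ℝ (Alg A) (h A i) : Module.End ℝ (Alg A))) fun i j φ => ?_
  refine Module.End.mapsTo_maxGenEigenspace_of_comm ?_ φ
  refine LinearMap.ext fun x => ?_
  simp only [Module.End.mul_apply, LieAlgebra.ad_apply]
  rw [leibniz_lie, lie_h_h, zero_lie, zero_add]

theorem weightSpace_le_jointEigenspace (c : ι → ℤ) :
    weightSpace A c ≤ jointEigenspace A fun i => (A.mulVec c i : ℝ) := fun x hx => by
  refine Submodule.mem_iInf _ |>.mpr fun i => ?_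
  refine Module.End.mem_maxGenEigenspace _ _ _ |>.mpr ⟨1, ?_⟩
  have := hx i
  simp [this, Int.cast_smul_eq_zsmul]

/-- Every weight is zero or, up to sign, the content of a non-zero iterated bracket. -/
theorem exists_isBracket_of_weightSpace_ne_bot (hinj : Function.Injective A.mulVec)
    (hc : weightSpace A c ≠ ⊥) :
    c = 0 ∨ ∃ c' y, IsBracket A c' y ∧ y ≠ 0 ∧ (c = c' ∨ c = -c') := by
  by_contra! hcon
  obtain ⟨h0, hcon⟩ := hcon
  apply hc
  let χ : (ι → ℤ) → ι → ℝ := fun c i => (A.mulVec c i : ℝ)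
  have hχ : ∀ {c c'}, χ c = χ c' → c = c' := fun {c c'} hcc => hinj (funext fun i =>
    Int.cast_injective (α := ℝ) (congrFun hcc i))
  -- The sum of all the other joint eigenspaces. If c were not ± the content of a non-zero bracket
  -- and not 0, S would contain a spanning set, while independence makes S disjoint from the weight
  -- space of c.
  let S : Submodule ℝ (Alg A) := ⨆ (χ') (_ : χ' ≠ χ c), jointEigenspace A χ'
  have hS : ∀ c', c' ≠ c → weightSpace A c' ≤ S := fun c' hne =>
    (weightSpace_le_jointEigenspace c').trans
      (le_iSup₂_of_le (χ c') (fun heq => hne (hχ heq)) le_rfl)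
  have htop : ∀ x, x ∈ S := by
    refine triangular_induction (fun c' y hy => ?_) (fun c' y hy => ?_) fun i =>
      hS 0 (Ne.symm h0) (h_mem_weightSpace i)
    · by_cases hy0 : y = 0
      · rw [hy0]; exact zero_mem _
      · exact hS c' (fun heq => (hcon c' y hy hy0).1 heq.symm) hy.mem_weightSpace
    · by_cases hy0 : y = 0
      · rw [hy0, map_zero]; exact zero_mem _
      · exact hS (-c') (fun heq => (hcon c' y hy hy0).2 heq.symm)
          (involution_mem_weightSpace hy.mem_weightSpace)
  refine (Submodule.eq_bot_iff _).mpr fun x hx => ?_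
  exact (Submodule.disjoint_def.mp (jointEigenspace_iSupIndep A (χ c))) x
    (weightSpace_le_jointEigenspace c hx) (htop x)

theorem weightSpace_neg_ne_bot (hc : weightSpace A c ≠ ⊥) : weightSpace A (-c) ≠ ⊥ := by
  obtain ⟨x, hx, hx0⟩ := Submodule.exists_mem_ne_zero_of_ne_bot hc
  refine (Submodule.ne_bot_iff _).mpr ⟨_, involution_mem_weightSpace hx, fun h0 => hx0 ?_⟩
  rw [← involution_involution A x, h0, map_zero]

theorem weightSpace_reflectCoord_ne_bot (hA : IsSimplyLaced A) (i : ι)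
    (hc : weightSpace A c ≠ ⊥) : weightSpace A (reflectCoord A i c) ≠ ⊥ := by
  obtain ⟨x, hx, hx0⟩ := Submodule.exists_mem_ne_zero_of_ne_bot hc
  exact (Submodule.ne_bot_iff _).mpr ⟨_, reflection_mem_weightSpace hA i hx, fun h0 =>
    hx0 (reflection_injective hA i (by rw [h0, map_zero]))⟩

theorem mulVec_reflectCoord (hA : IsSimplyLaced A) (i : ι) (c : ι → ℤ) :
    A.mulVec (reflectCoord A i c) i = -A.mulVec c i := by
  rw [reflectCoord, Matrix.mulVec_sub, Matrix.mulVec_smul]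
  simp [hA.diag]; ring

theorem reflectCoord_reflectCoord (hA : IsSimplyLaced A) (i : ι) (c : ι → ℤ) :
    reflectCoord A i (reflectCoord A i c) = c := by
  conv_lhs => rw [reflectCoord, mulVec_reflectCoord hA, reflectCoord]
  module

theorem dotProduct_reflectCoord (hA : IsSimplyLaced A) (i : ι) (c : ι → ℤ) :
    reflectCoord A i c ⬝ᵥ A.mulVec (reflectCoord A i c) = c ⬝ᵥ A.mulVec c := by
  have hsymm : A.transpose = A := Matrix.ext fun i j => hA.symm j i
  have h1 : c ⬝ᵥ A.mulVec (Pi.single i 1) = A.mulVec c i := by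
    rw [Matrix.dotProduct_mulVec, ← Matrix.mulVec_transpose, hsymm]; simp
  have h2 : A.mulVec (Pi.single i 1) i = 2 := by simp [hA.diag]
  rw [reflectCoord, Matrix.mulVec_sub, Matrix.mulVec_smul, sub_dotProduct, dotProduct_sub,
    dotProduct_sub, dotProduct_smul, smul_dotProduct, smul_dotProduct, dotProduct_smul, h1,
    single_one_dotProduct, single_one_dotProduct, h2]
  simp only [smul_eq_mul]
  ring

/-- A property of the simple roots which is stable under simple reflections and negation holds for
all real roots. -/
theorem real_root_induction (hA : IsSimplyLaced A) (hinj : Function.Injective A.mulVec)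
    {C : (ι → ℤ) → Prop} (hgen : ∀ i, C (Pi.single i 1)) (hneg : ∀ c, C c → C (-c))
    (hrefl : ∀ i c, C c → C (reflectCoord A i c)) (hc : weightSpace A c ≠ ⊥)
    (hpos : 0 < c ⬝ᵥ A.mulVec c) : C c := by
  -- The coordinates of a root of positive norm have one common sign, and unless it is ± a simple
  -- root at least two of them are non-zero.
  have hcontent : ∀ {c : ι → ℤ}, weightSpace A c ≠ ⊥ → 0 < c ⬝ᵥ A.mulVec c →
      ∃ c', (c = c' ∨ c = -c') ∧ 0 ≤ c' ∧
        ((∃ i, c' = Pi.single i 1) ∨ ∃ i j, i ≠ j ∧ 0 < c' i ∧ 0 < c' j) := by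
    intro c hc hpos
    rcases exists_isBracket_of_weightSpace_ne_bot hinj hc with rfl | ⟨c', y, hy, hy0, hcc⟩
    · simp at hpos
    · refine ⟨c', hcc, hy.nonneg, ?_⟩
      rcases hy.eq_gen_or_exists_pair with h | ⟨i, h, -⟩ | h
      · exact absurd h hy0
      · exact Or.inl ⟨i, h⟩
      · exact Or.inr h
  have main : ∀ (n : ℕ) (c : ι → ℤ), 0 ≤ c → ∑ i, c i ≤ n → weightSpace A c ≠ ⊥ →
      0 < c ⬝ᵥ A.mulVec c → C c := by
    intro n
    induction n with
    | zero =>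
      intro c hc0 hsum _ hpos
      have hs := le_antisymm (by simpa using hsum) (Finset.sum_nonneg fun i _ => hc0 i)
      have : c = 0 := funext fun i =>
        (Finset.sum_eq_zero_iff_of_nonneg fun i _ => hc0 i).mp hs i (Finset.mem_univ i)
      simp [this] at hpos
    | succ n ih =>
      intro c hc0 hsum hc hpos
      -- A positive norm Σ c_i (Ac)_i has a positive term; for that i the reflection lowers the
      -- height by (Ac)_i > 0.
      obtain ⟨i, -, hi⟩ := Finset.exists_lt_of_sum_lt (s := Finset.univ) (f := fun _ : ι => (0 : ℤ))
        (g := fun i => c i * A.mulVec c i) (by simpa [dotProduct] using hpos)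
      have hci : 0 < c i := lt_of_le_of_ne (hc0 i) fun h => by simp [← h] at hi
      have hAi : 0 < A.mulVec c i := pos_of_mul_pos_right hi hci.le
      obtain ⟨c', hcc, hc'0, hc'⟩ := hcontent hc hpos
      have hcc' : c = c' := by
        rcases hcc with h | h
        · exact h
        · have := hc'0 i; rw [h] at hci; simp at hci this; omega
      subst hcc'
      rcases hc' with ⟨j, rfl⟩ | ⟨j, k, hjk, hj, hk⟩
      · exact hgen j
      -- A positive coordinate that s_i does not touch: it forces the reflected root to stay
      -- positive.
      obtain ⟨l, hli, hl⟩ : ∃ l, l ≠ i ∧ 0 < c l := by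
        by_cases hji : j = i
        · exact ⟨k, fun h => hjk (hji.trans h.symm), hk⟩
        · exact ⟨j, hji, hj⟩
      have hroot := weightSpace_reflectCoord_ne_bot hA i hc
      have hpos' : 0 < reflectCoord A i c ⬝ᵥ A.mulVec (reflectCoord A i c) := by
        rwa [dotProduct_reflectCoord hA]
      have hl' : reflectCoord A i c l = c l := by simp [reflectCoord, hli]
      have hnn : 0 ≤ reflectCoord A i c := by
        obtain ⟨c', hcc, hc'0, -⟩ := hcontent hroot hpos'
        rcases hcc with h | h
        · rwa [h]
        · have h1 := hc'0 l
          rw [h] at hl'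
          simp at hl' h1
          omega
      rw [← reflectCoord_reflectCoord hA i c]
      refine hrefl i _ (ih _ hnn ?_ hroot hpos')
      have : ∑ j, reflectCoord A i c j = ∑ j, c j - A.mulVec c i := by
        simp [reflectCoord, Finset.sum_sub_distrib, ← Finset.mul_sum]
      push_cast at hsum
      omega
  obtain ⟨c', hcc, hc'0, -⟩ := hcontent hc hpos
  rcases hcc with rfl | rfl
  · exact main (∑ i, c i).toNat c hc'0 (Int.self_le_toNat _) hc hpos
  · refine hneg _ (main (∑ i, c' i).toNat c' hc'0 (Int.self_le_toNat _) ?_ ?_)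
    · simpa using weightSpace_neg_ne_bot hc
    · simpa [Matrix.mulVec_neg] using hpos

end RealRoots

end KacMoody

/-! ### Simple roots, scalar product and weights of `AE_d`. -/

namespace AE

/-! ### The root lattice in the wall basis -/

section Lattice

variable {d : ℕ}

theorem dewitt_eq (p q : Fin d → ℤ) : dewitt p q =
    (∑ a, p a * q a : ℤ) - ((∑ a, p a : ℤ) : ℝ) * ((∑ a, q a : ℤ) : ℝ) / ((d : ℝ) - 1) := by
  have h1 : ∀ a, ∑ b, (p a : ℝ) * (q b : ℝ) * ((if a = b then 1 else 0) - 1 / ((d : ℝ) - 1)) =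
      p a * q a - p a * (∑ b, (q b : ℝ)) / ((d : ℝ) - 1) := by
    intro a
    simp only [mul_sub, Finset.sum_sub_distrib, mul_ite, mul_one, mul_zero, Finset.sum_ite_eq,
      Finset.mem_univ, if_true]
    rw [← Finset.sum_mul, ← Finset.mul_sum]; ring
  rw [dewitt, Finset.sum_congr rfl fun a _ => h1 a, Finset.sum_sub_distrib, ← Finset.sum_div,
    ← Finset.sum_mul]
  push_cast; rfl

theorem dewitt_comm (p q : Fin d → ℤ) : dewitt p q = dewitt q p := by
  rw [dewitt_eq, dewitt_eq]
  simp only [mul_comm]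

theorem dewitt_add_left (p p' q : Fin d → ℤ) : dewitt (p + p') q = dewitt p q + dewitt p' q := by
  simp only [dewitt_eq, Pi.add_apply, add_mul, Finset.sum_add_distrib]
  push_cast; ring

theorem dewitt_add_right (p q q' : Fin d → ℤ) : dewitt p (q + q') = dewitt p q + dewitt p q' := by
  rw [dewitt_comm, dewitt_add_left, dewitt_comm q, dewitt_comm q']

theorem dewitt_neg_left (p q : Fin d → ℤ) : dewitt (-p) q = -dewitt p q := by
  simp only [dewitt_eq, Pi.neg_apply, neg_mul, Finset.sum_neg_distrib]
  push_cast; ring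

theorem dewitt_neg_right (p q : Fin d → ℤ) : dewitt p (-q) = -dewitt p q := by
  rw [dewitt_comm, dewitt_neg_left, dewitt_comm]

theorem dewitt_zero_left (q : Fin d → ℤ) : dewitt 0 q = 0 := by simp [dewitt]

theorem dewitt_zero_right (q : Fin d → ℤ) : dewitt q 0 = 0 := by simp [dewitt]

theorem dewitt_zsmul_right (n : ℤ) (p q : Fin d → ℤ) : dewitt p (n • q) = n * dewitt p q := by
  simp only [dewitt_eq, Pi.smul_apply, smul_eq_mul, mul_left_comm _ n, ← Finset.mul_sum]
  push_cast; ring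

theorem dewitt_sum_right {ι : Type*} (s : Finset ι) (p : Fin d → ℤ) (q : ι → Fin d → ℤ) :
    dewitt p (∑ i ∈ s, q i) = ∑ i ∈ s, dewitt p (q i) := by
  classical
  induction s using Finset.induction_on with
  | empty => simp [dewitt_zero_right]
  | insert a s ha ih => rw [Finset.sum_insert ha, Finset.sum_insert ha, dewitt_add_right, ih]

/-- The scalar product with a simple root. -/
def wall (hd : 3 < d) (i : Fin d) (q : Fin d → ℤ) : ℤ :=
  if h : i.val + 1 < d then q i - q ⟨i.val + 1, h⟩
  else q ⟨d - 1, by omega⟩ - q ⟨0, by omega⟩ - q ⟨1, by omega⟩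

/-- The last simple root is (1, …, 1) - e_1 - e_2 + e_d. Its all-ones part contributes Σ q_a, which
the trace term of the scalar product removes because the coordinates of α_d sum to d - 1. -/
theorem sum_simpleRoot_mul (hd : 3 < d) (i : Fin d) (q : Fin d → ℤ) :
    ∑ a, simpleRoot i a * q a =
      wall hd i q + if i.val + 1 < d then 0 else ∑ a, q a := by
  unfold wall simpleRoot
  split_ifs with h
  · have h1 : ∀ a : Fin d, (if a = i then (1 : ℤ) else if a.val = i.val + 1 then -1 else 0) * q a =
        (if a = i then q a else 0) - if a = ⟨i.val + 1, h⟩ then q a else 0 := by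
      intro a
      simp only [Fin.ext_iff]
      split_ifs <;> omega
    rw [Finset.sum_congr rfl fun a _ => h1 a, Finset.sum_sub_distrib]
    simp
  · have h1 : ∀ a : Fin d, (if a.val + 1 = d then (2 : ℤ) else if 2 ≤ a.val then 1 else 0) * q a =
        (if a = ⟨d - 1, by omega⟩ then q a else 0) - (if a = ⟨0, by omega⟩ then q a else 0) -
          (if a = ⟨1, by omega⟩ then q a else 0) + q a := by
      intro a
      simp only [Fin.ext_iff]
      split_ifs <;> omega
    rw [Finset.sum_congr rfl fun a _ => h1 a, Finset.sum_add_distrib, Finset.sum_sub_distrib,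
      Finset.sum_sub_distrib]
    simp

theorem sum_simpleRoot (hd : 3 < d) (i : Fin d) :
    ∑ a, simpleRoot i a = if i.val + 1 < d then 0 else (d : ℤ) - 1 := by
  have h1 := sum_simpleRoot_mul hd i 1
  simp only [Pi.one_apply, mul_one] at h1
  rw [h1]
  simp only [wall, Pi.one_apply]
  split_ifs <;> simp; ring

theorem dewitt_simpleRoot (hd : 3 < d) (i : Fin d) (q : Fin d → ℤ) :
    dewitt (simpleRoot i) q = wall hd i q := by
  have hd' : (d : ℝ) - 1 ≠ 0 := by
    have : (3 : ℝ) < d := by exact_mod_cast hd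
    linarith
  rw [dewitt_eq, sum_simpleRoot_mul hd, sum_simpleRoot hd]
  split_ifs
  · simp
  · push_cast; field_simp; ring

theorem wall_simpleRoot (hd : 3 < d) (i j : Fin d) : wall hd i (simpleRoot j) = cartan d i j := by
  have := i.2
  have := j.2
  have hc : cartan d i j = if i.val = j.val then 2 else if Joined d i j then -1 else 0 := by
    simp only [cartan, Matrix.of_apply, Fin.ext_iff]
  rw [hc]
  by_cases hJ : Joined d i j
  all_goals
    rw [Joined] at hJ
    simp only [wall, simpleRoot, Joined, Fin.ext_iff, hJ, if_true, if_false]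
    split_ifs <;> first | omega | contradiction

theorem dvd_sum_of_mem_rootLattice (hd : 3 < d) {p : Fin d → ℤ} (hp : p ∈ rootLattice d) :
    ((d : ℤ) - 1) ∣ ∑ a, p a := by
  induction hp using AddSubgroup.closure_induction with
  | mem p hp =>
    obtain ⟨i, rfl⟩ := hp
    rw [sum_simpleRoot hd]
    split_ifs <;> simp
  | zero => simp
  | add p q _ _ hp hq => simpa [Finset.sum_add_distrib] using dvd_add hp hq
  | neg p _ hp => simpa using hp

theorem simpleRoot_mem (i : Fin d) : simpleRoot i ∈ rootLattice d :=
  AddSubgroup.subset_closure ⟨i, rfl⟩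

/-- The lattice vector with the given coordinates in the basis of simple roots. -/
def ofCoord (c : Fin d → ℤ) : Fin d → ℤ := ∑ i, c i • simpleRoot i

theorem ofCoord_mem (c : Fin d → ℤ) : ofCoord c ∈ rootLattice d :=
  sum_mem fun i _ => zsmul_mem (simpleRoot_mem i) _

theorem ofCoord_add (c c' : Fin d → ℤ) : ofCoord (c + c') = ofCoord c + ofCoord c' := by
  simp [ofCoord, add_smul, Finset.sum_add_distrib]

theorem ofCoord_neg (c : Fin d → ℤ) : ofCoord (-c) = -ofCoord c := by
  simp [ofCoord]

theorem ofCoord_single (i : Fin d) (n : ℤ) : ofCoord (Pi.single i n) = n • simpleRoot i := by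
  rw [ofCoord, Finset.sum_eq_single i]
  · simp
  · intro j _ hj; simp [hj]
  · simp

theorem exists_ofCoord {p : Fin d → ℤ} (hp : p ∈ rootLattice d) : ∃ c, ofCoord c = p := by
  induction hp using AddSubgroup.closure_induction with
  | mem p hp =>
    obtain ⟨i, rfl⟩ := hp
    exact ⟨Pi.single i 1, by rw [ofCoord_single, one_smul]⟩
  | zero => exact ⟨0, by simp [ofCoord]⟩
  | add p q _ _ hp hq =>
    obtain ⟨c, rfl⟩ := hp
    obtain ⟨c', rfl⟩ := hq
    exact ⟨c + c', ofCoord_add c c'⟩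
  | neg p _ hp =>
    obtain ⟨c, rfl⟩ := hp
    exact ⟨-c, ofCoord_neg c⟩

theorem dewitt_simpleRoot_ofCoord (hd : 3 < d) (i : Fin d) (c : Fin d → ℤ) :
    dewitt (simpleRoot i) (ofCoord c) = ((cartan d).mulVec c i : ℝ) := by
  simp only [ofCoord, dewitt_sum_right, dewitt_zsmul_right]
  simp only [dewitt_simpleRoot hd, wall_simpleRoot, Matrix.mulVec, dotProduct]
  push_cast
  exact Finset.sum_congr rfl fun j _ => mul_comm (c j : ℝ) _

theorem dewitt_ofCoord (hd : 3 < d) (c c' : Fin d → ℤ) :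
    dewitt (ofCoord c) (ofCoord c') = ((c ⬝ᵥ (cartan d).mulVec c' : ℤ) : ℝ) := by
  rw [dewitt_comm]
  conv_lhs => rw [ofCoord.eq_def c]
  simp only [dewitt_sum_right, dewitt_zsmul_right]
  simp only [dewitt_comm (ofCoord c'), dewitt_simpleRoot_ofCoord hd, dotProduct]
  push_cast; rfl

theorem cartan_isSimplyLaced (d : ℕ) : KacMoody.IsSimplyLaced (cartan d) where
  diag i := by simp [cartan]
  symm i j := by
    simp only [cartan, Matrix.of_apply, eq_comm (a := i), Joined]
    congr 2
    simp only [eq_iff_iff]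
    tauto
  off_diag i j hij := by
    simp only [cartan, Matrix.of_apply, if_neg hij]
    split_ifs <;> simp

/-- A lattice vector orthogonal to α_1, …, α_{d-1} has equal coordinates; orthogonality to α_d then
reads t - t - t = 0. It remains that the simple roots are independent: the coordinate sum isolates
the coefficient of α_d, and the others vanish successively from the first coordinate on. -/
theorem cartan_mulVec_injective (hd : 3 < d) : Function.Injective (cartan d).mulVec := by
  refine (injective_iff_map_eq_zero (cartan d).mulVecLin).mpr fun c hc => ?_
  have hw : ∀ i, wall hd i (ofCoord c) = 0 := fun i => by
    have := dewitt_simpleRoot_ofCoord hd i c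
    rw [dewitt_simpleRoot hd] at this
    have h2 : (cartan d).mulVec c i = 0 := congrFun hc i
    rw [h2] at this
    exact_mod_cast this
  have hconst : ∀ a (ha : a < d), ofCoord c ⟨a, ha⟩ = ofCoord c ⟨0, by omega⟩ := by
    intro a
    induction a with
    | zero => intro _; rfl
    | succ a ih =>
      intro ha
      have := hw ⟨a, by omega⟩
      simp only [wall, ha, dif_pos] at this
      rw [← ih (by omega)]
      omega
  have h0 : ∀ a, ofCoord c a = 0 := by
    intro a
    have := hw ⟨d - 1, by omega⟩
    simp only [wall, show ¬ (d - 1 + 1 < d) by omega, dif_neg, not_false_iff] at this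
    rw [hconst (d - 1), hconst 1] at this
    rw [show a = ⟨a.val, a.2⟩ from rfl, hconst a.val]
    omega
  have hlast : c ⟨d - 1, by omega⟩ = 0 := by
    have hs : ∑ a, ofCoord c a = c ⟨d - 1, by omega⟩ * ((d : ℤ) - 1) := by
      simp only [ofCoord, Finset.sum_apply, Pi.smul_apply, smul_eq_mul]
      rw [Finset.sum_comm]
      simp only [← Finset.mul_sum, sum_simpleRoot hd]
      rw [Finset.sum_eq_single ⟨d - 1, by omega⟩]
      · simp [show ¬ (d - 1 + 1 < d) by omega]
      · intro b _ hb
        have : b.val + 1 < d := by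
          have := b.2
          have h2 : b.val ≠ d - 1 := fun h => hb (Fin.ext h)
          omega
        simp [this]
      · simp
    rw [Finset.sum_eq_zero fun a _ => h0 a] at hs
    have hd' : (d : ℤ) - 1 ≠ 0 := by omega
    exact (mul_eq_zero.mp hs.symm).resolve_right hd'
  have hc0 : ∀ a (ha : a + 1 < d), c ⟨a, by omega⟩ = 0 := by
    intro a
    induction a with
    | zero =>
      intro ha
      have h1 := h0 ⟨0, by omega⟩
      simp only [ofCoord, Finset.sum_apply, Pi.smul_apply, smul_eq_mul] at h1
      rw [Finset.sum_eq_single ⟨0, by omega⟩] at h1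
      · simpa [simpleRoot, ha] using h1
      · intro b _ hb
        have hb' : b.val ≠ 0 := fun h => hb (Fin.ext h)
        simp only [simpleRoot, Fin.ext_iff]
        have := b.2
        split_ifs <;> first | omega | simp_all
      · simp
    | succ a ih =>
      intro ha
      have h1 := h0 ⟨a + 1, by omega⟩
      simp only [ofCoord, Finset.sum_apply, Pi.smul_apply, smul_eq_mul] at h1
      rw [Finset.sum_eq_single ⟨a + 1, by omega⟩] at h1
      · simpa [simpleRoot, ha] using h1
      · intro b _ hb
        have hb' : b.val ≠ a + 1 := fun h => hb (Fin.ext h)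
        by_cases hba : b.val = a
        · have : b = ⟨a, by omega⟩ := Fin.ext hba
          rw [this, ih (by omega), zero_mul]
        by_cases hbl : b.val = d - 1
        · have : b = ⟨d - 1, by omega⟩ := Fin.ext hbl
          rw [this, hlast, zero_mul]
        have := b.2
        simp only [simpleRoot, Fin.ext_iff]
        split_ifs <;> omega
      · simp
  funext a
  by_cases ha : a.val + 1 < d
  · exact hc0 a ha
  · have : a = ⟨d - 1, by omega⟩ := Fin.ext (by have := a.2; simp; omega)
    rw [this]; exact hlast

theorem rootSpace_ofCoord (hd : 3 < d) (c : Fin d → ℤ) :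
    rootSpace (ofCoord c) = KacMoody.weightSpace (cartan d) c := by
  ext x
  change (∀ i, _ = dewitt (simpleRoot i) (ofCoord c) • x) ↔ ∀ i, _ = (cartan d).mulVec c i • x
  simp only [dewitt_simpleRoot_ofCoord hd, Int.cast_smul_eq_zsmul]

theorem ofCoord_reflectCoord (i : Fin d) (c : Fin d → ℤ) :
    ofCoord (KacMoody.reflectCoord (cartan d) i c) =
      ofCoord c + (-(cartan d).mulVec c i) • simpleRoot i := by
  rw [KacMoody.reflectCoord, sub_eq_add_neg, ofCoord_add, ofCoord_neg, neg_smul]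
  congr 2
  rw [← ofCoord_single]
  congr 1
  ext j
  by_cases hj : j = i
  · subst hj; simp
  · simp [hj]

end Lattice

end AE

/-! ### Signs of products of gamma matrices and the matrices of the simple roots. -/

namespace AE

/-! ### Commutation up to sign -/

section Sign

variable {R : Type*} [Ring R]

/-- `x` and `y` commute up to the factor `s`. -/
def SignComm (s : ℤ) (x y : R) : Prop := x * y = s • (y * x)

namespace SignComm

variable {s t : ℤ} {x y z : R}

theorem refl (x : R) : SignComm 1 x x := by simp [SignComm]

theorem mul_left (hx : SignComm s x z) (hy : SignComm t y z) : SignComm (s * t) (x * y) z := by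
  unfold SignComm at *
  rw [mul_assoc, hy, mul_smul_comm, ← mul_assoc, hx, smul_mul_assoc, smul_smul, mul_assoc,
    mul_comm t s]

theorem mul_right (hx : SignComm s x y) (hy : SignComm t x z) : SignComm (s * t) x (y * z) := by
  unfold SignComm at *
  rw [← mul_assoc, hx, smul_mul_assoc, mul_assoc, hy, mul_smul_comm, smul_smul, mul_assoc]

theorem prod_left {n : ℕ} {f : Fin n → R} (h : ∀ a, SignComm s (f a) y) :
    SignComm (s ^ n) (List.ofFn f).prod y := by
  induction n with
  | zero => simp [SignComm]
  | succ n ih =>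
    rw [List.ofFn_succ, List.prod_cons, pow_succ']
    exact (h 0).mul_left (ih fun a => h a.succ)

theorem neg_left (h : SignComm s x y) : SignComm s (-x) y := by
  unfold SignComm at *
  rw [neg_mul, h, mul_neg, smul_neg]

theorem symm (h : SignComm s x y) (hs : s * s = 1) : SignComm s y x := by
  unfold SignComm at *
  rw [h, smul_smul, hs, one_smul]

end SignComm

/-- Moving the first factor across the other n costs (-1)^n, and n + n(n - 1)/2 = (n + 1)n/2. -/
theorem prod_ofFn_sq {n : ℕ} {f : Fin n → R} (hsq : ∀ a, f a * f a = 1)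
    (h : ∀ a b, a ≠ b → SignComm (-1) (f a) (f b)) :
    (List.ofFn f).prod * (List.ofFn f).prod = ((-1 : ℤ) ^ (n * (n - 1) / 2)) • (1 : R) := by
  induction n with
  | zero => simp
  | succ n ih =>
    rw [List.ofFn_succ, List.prod_cons]
    set P := (List.ofFn fun i => f i.succ).prod with hP
    have h1 : SignComm ((-1) ^ n) P (f 0) := SignComm.prod_left fun a => h _ _ (Fin.succ_ne_zero a)
    have h2 := ih (fun a => hsq a.succ) fun a b hab => h _ _ fun hs => hab (Fin.succ_injective _ hs)
    unfold SignComm at h1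
    calc f 0 * P * (f 0 * P) = f 0 * (P * f 0) * P := by noncomm_ring
      _ = (-1 : ℤ) ^ n • ((f 0 * f 0) * (P * P)) := by
        rw [h1, mul_smul_comm, smul_mul_assoc]
        congr 1
        noncomm_ring
      _ = _ := by
        rw [hsq, one_mul, h2, smul_smul, ← pow_add]
        congr 2
        rw [← Nat.mul_add_div two_pos]
        congr 1
        rcases n with _ | n
        · rfl
        · simp only [Nat.add_sub_cancel]; ring

end Sign

/-! ### Gamma matrices -/

section Gamma

variable {d N : ℕ} {Γ : Fin (d + 1) → Matrix (Fin N) (Fin N) ℝ}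

theorem gamma_sq (hΓ : IsClifford Γ) (μ : Fin (d + 1)) :
    Γ μ * Γ μ = (if μ = 0 then (-1 : ℝ) else 1) • (1 : Matrix (Fin N) (Fin N) ℝ) := by
  have h := hΓ μ μ
  rw [minkowski, Matrix.diagonal_apply_eq, ← two_smul ℝ, mul_smul] at h
  exact smul_right_injective _ (two_ne_zero' ℝ) h

theorem gamma_zero_sq (hΓ : IsClifford Γ) : Γ 0 * Γ 0 = -1 := by simp [gamma_sq hΓ]

theorem gamma_sq_of_ne_zero (hΓ : IsClifford Γ) {μ : Fin (d + 1)} (hμ : μ ≠ 0) :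
    Γ μ * Γ μ = 1 := by simp [gamma_sq hΓ, hμ]

theorem gamma_anticomm (hΓ : IsClifford Γ) {μ ν : Fin (d + 1)} (h : μ ≠ ν) :
    SignComm (-1) (Γ μ) (Γ ν) := by
  have := hΓ μ ν
  rw [minkowski, Matrix.diagonal_apply_ne _ h, mul_zero, zero_smul] at this
  rw [SignComm, eq_neg_of_add_eq_zero_left this]; simp

theorem gammaStar_eq (hd : 3 < d) : gammaStar Γ =
    Γ 0 * Γ 1 * Γ 2 * gammaMiddle Γ * Γ (Fin.last d) := by
  obtain ⟨m, rfl⟩ : ∃ m, d = m + 3 := ⟨d - 3, by omega⟩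
  unfold gammaStar gammaMiddle
  rw [List.ofFn_succ, List.ofFn_succ, List.ofFn_succ, List.ofFn_succ_last]
  simp only [List.prod_cons, List.prod_append, List.prod_nil, mul_one, ← mul_assoc]
  rfl

theorem gammaMiddle_signComm (hΓ : IsClifford Γ) {μ : Fin (d + 1)}
    (hμ : μ.val < 3 ∨ μ.val = d) : SignComm ((-1) ^ (d - 3)) (gammaMiddle Γ) (Γ μ) :=
  SignComm.prod_left fun a => gamma_anticomm hΓ fun h => by
    have := congrArg Fin.val h
    have := a.2
    simp at *
    omega

theorem gammaMiddle_sq (hΓ : IsClifford Γ) : gammaMiddle Γ * gammaMiddle Γ =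
    ((-1 : ℤ) ^ ((d - 3) * (d - 3 - 1) / 2)) • (1 : Matrix (Fin N) (Fin N) ℝ) :=
  prod_ofFn_sq (fun a => gamma_sq_of_ne_zero hΓ (by simp [Fin.ext_iff])) fun a b hab =>
    gamma_anticomm hΓ fun h => hab (Fin.ext (by simpa using h))

theorem val_one_of_lt (hd : 3 < d) : ((1 : Fin (d + 1)) : ℕ) = 1 := by
  rw [Fin.val_one', Nat.mod_eq_of_lt (by omega)]

theorem val_two_of_lt (hd : 3 < d) : ((2 : Fin (d + 1)) : ℕ) = 2 := by
  change 2 % (d + 1) = 2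
  exact Nat.mod_eq_of_lt (by omega)

/-- The product `Γ_0 Γ_1 Γ_2 Γ_d`. -/
def gammaTail (Γ : Fin (d + 1) → Matrix (Fin N) (Fin N) ℝ) : Matrix (Fin N) (Fin N) ℝ :=
  Γ 0 * Γ 1 * Γ 2 * Γ (Fin.last d)

theorem sign_exponent (hd : 3 < d) :
    (-1 : ℤ) ^ (d - 3) * (-1) ^ ((d - 3) * (d - 3 - 1) / 2) = (-1) ^ ((d - 2) * (d - 3) / 2) := by
  obtain ⟨m, rfl⟩ : ∃ m, d = m + 4 := ⟨d - 4, by omega⟩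
  rw [← pow_add, show m + 4 - 3 = m + 1 by omega, show m + 4 - 2 = m + 2 by omega,
    Nat.add_sub_cancel, ← Nat.mul_add_div two_pos]
  congr 2
  ring

/-- The middle product crosses Γ_0, Γ_1, Γ_2 with sign (-1)^(3(d-3)) = (-1)^(d-3) and meets its copy
inside Γ_*, whose square supplies the remaining sign. From the right it crosses only Γ_d, with the
same sign, so it commutes with Γ_*. -/
theorem gammaMiddle_mul_gammaStar (hd : 3 < d) (hΓ : IsClifford Γ) :
    gammaMiddle Γ * gammaStar Γ = ((-1 : ℤ) ^ ((d - 2) * (d - 3) / 2)) • gammaTail Γ := by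
  have hc : SignComm ((-1) ^ (d - 3) * (-1) ^ (d - 3) * (-1) ^ (d - 3)) (gammaMiddle Γ)
      (Γ 0 * Γ 1 * Γ 2) :=
    ((gammaMiddle_signComm hΓ (by simp)).mul_right
      (gammaMiddle_signComm hΓ (by rw [val_one_of_lt hd]; omega))).mul_right
      (gammaMiddle_signComm hΓ (by rw [val_two_of_lt hd]; omega))
  have hsq : (-1 : ℤ) ^ (d - 3) * (-1) ^ (d - 3) = 1 := by rw [← mul_pow]; simp
  rw [hsq, one_mul] at hc
  rw [gammaStar_eq hd]
  calc gammaMiddle Γ * (Γ 0 * Γ 1 * Γ 2 * gammaMiddle Γ * Γ (Fin.last d))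
      = (gammaMiddle Γ * (Γ 0 * Γ 1 * Γ 2)) * gammaMiddle Γ * Γ (Fin.last d) := by
        simp only [mul_assoc]
    _ = (-1 : ℤ) ^ (d - 3) •
        (Γ 0 * Γ 1 * Γ 2 * (gammaMiddle Γ * gammaMiddle Γ) * Γ (Fin.last d)) := by
        rw [hc, smul_mul_assoc, smul_mul_assoc]
        simp only [mul_assoc]
    _ = _ := by
        rw [gammaMiddle_sq hΓ, mul_smul_comm, mul_one, smul_mul_assoc, smul_smul, sign_exponent hd]
        rfl

theorem gammaStar_mul_gammaMiddle (hd : 3 < d) (hΓ : IsClifford Γ) :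
    gammaStar Γ * gammaMiddle Γ = ((-1 : ℤ) ^ ((d - 2) * (d - 3) / 2)) • gammaTail Γ := by
  have hc := (gammaMiddle_signComm hΓ (μ := Fin.last d) (by simp)).symm
    (by rw [← mul_pow]; simp)
  rw [gammaStar_eq hd, mul_assoc, hc, mul_smul_comm, ← mul_assoc, mul_assoc (Γ 0 * Γ 1 * Γ 2),
    gammaMiddle_sq hΓ, mul_smul_comm, mul_one, smul_mul_assoc, smul_smul, sign_exponent hd]
  rfl

theorem neg_one_pow_smul {M : Type*} [AddCommGroup M] (n : ℕ) (x : M) :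
    ((-1 : ℤ) ^ n) • x = x ∨ ((-1 : ℤ) ^ n) • x = -x := by
  rcases neg_one_pow_eq_or ℤ n with h | h <;> simp [h]

theorem gammaSimple_of_lt {i : Fin d} (hi : i.val + 1 < d) :
    gammaSimple Γ i = Γ i.succ * Γ ⟨i.val + 2, by omega⟩ := dif_pos hi

theorem gammaSimple_last (hd : 3 < d) (hΓ : IsClifford Γ) {i : Fin d} (hi : ¬ i.val + 1 < d) :
    gammaSimple Γ i = gammaTail Γ ∨ gammaSimple Γ i = -gammaTail Γ := by
  rw [gammaSimple, dif_neg hi, gammaMiddle_mul_gammaStar hd hΓ]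
  exact neg_one_pow_smul _ _

/-- Two anticommutations cancel unless one of the two indices is μ itself. -/
theorem gamma_signComm_pair (hΓ : IsClifford Γ) {i : ℕ} (hi : i + 2 < d + 1) (μ : Fin (d + 1)) :
    SignComm (if μ.val = i + 1 ∨ μ.val = i + 2 then -1 else 1) (Γ μ)
      (Γ ⟨i + 1, by omega⟩ * Γ ⟨i + 2, hi⟩) := by
  have hs : ∀ ν : Fin (d + 1), SignComm (if μ.val = ν.val then 1 else -1) (Γ μ) (Γ ν) := by
    intro ν
    split_ifs with h
    · rw [Fin.ext h]; exact SignComm.refl _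
    · exact gamma_anticomm hΓ fun h' => h (congrArg Fin.val h')
  convert (hs ⟨i + 1, by omega⟩).mul_right (hs ⟨i + 2, hi⟩) using 1
  simp only
  split_ifs <;> omega

/-- The sign is the parity of the number of common indices. For the last node, {0, 1, 2, d} meets
{j, j + 1} in an odd number of indices exactly for j = 2 and j = d - 1; this uses d > 3. -/
theorem gammaSimple_signComm_pair (hd : 3 < d) (hΓ : IsClifford Γ) {i j : Fin d}
    (hj : j.val + 1 < d) (hij : i ≠ j) :
    SignComm (if Joined d i j then -1 else 1) (gammaSimple Γ i) (gammaSimple Γ j) := by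
  have hne : i.val ≠ j.val := fun h => hij (Fin.ext h)
  have hjr := gammaSimple_of_lt (Γ := Γ) hj
  have hc := gamma_signComm_pair hΓ (i := j.val) (by omega)
  rw [show Γ ⟨j.val + 1, by omega⟩ * Γ ⟨j.val + 2, by omega⟩ = gammaSimple Γ j from hjr.symm] at hc
  by_cases hi : i.val + 1 < d
  · rw [gammaSimple_of_lt hi]
    convert (hc i.succ).mul_left (hc ⟨i.val + 2, by omega⟩) using 1
    simp only [Fin.val_succ]
    by_cases hJ : Joined d i j
    · rw [if_pos hJ]
      rw [Joined] at hJ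
      split_ifs <;> omega
    · rw [if_neg hJ]
      rw [Joined] at hJ
      split_ifs <;> omega
  · have ht : SignComm (if Joined d i j then -1 else 1) (gammaTail Γ) (gammaSimple Γ j) := by
      have hp := (((hc 0).mul_left (hc 1)).mul_left (hc 2)).mul_left (hc (Fin.last d))
      rw [val_one_of_lt hd, val_two_of_lt hd, Fin.val_last,
        if_neg (by rw [Fin.val_zero]; omega)] at hp
      change SignComm _ (Γ 0 * Γ 1 * Γ 2 * Γ (Fin.last d)) _
      convert hp using 1
      have := i.2
      by_cases hJ : Joined d i j
      · rw [if_pos hJ]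
        rw [Joined] at hJ
        split_ifs <;> omega
      · rw [if_neg hJ]
        rw [Joined] at hJ
        split_ifs <;> omega
    rcases gammaSimple_last hd hΓ hi with h | h <;> rw [h]
    exacts [ht, ht.neg_left]

theorem joined_comm {i j : Fin d} : Joined d i j ↔ Joined d j i := by
  simp only [Joined]; tauto

theorem gammaSimple_signComm (hd : 3 < d) (hΓ : IsClifford Γ) (i j : Fin d) :
    SignComm (if Joined d i j then -1 else 1) (gammaSimple Γ i) (gammaSimple Γ j) := by
  by_cases hij : i = j
  · subst hij
    have : ¬ Joined d i i := by simp only [Joined]; omega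
    rw [if_neg this]; exact SignComm.refl _
  by_cases hj : j.val + 1 < d
  · exact gammaSimple_signComm_pair hd hΓ hj hij
  · have hi : i.val + 1 < d := by
      have := i.2
      have := j.2
      have h : i.val ≠ j.val := fun h => hij (Fin.ext h)
      omega
    have h := gammaSimple_signComm_pair hd hΓ hi (Ne.symm hij)
    simp only [joined_comm (i := j)] at h
    exact h.symm (by split_ifs <;> rfl)

/-- Reordering costs six transpositions, an even number, and among the four factors only Γ_0 squares
to -1. -/
theorem gammaTail_sq (hd : 3 < d) (hΓ : IsClifford Γ) : gammaTail Γ * gammaTail Γ = -1 := by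
  have h1 := val_one_of_lt hd
  have h2 := val_two_of_lt hd
  have ha : ∀ {μ ν : Fin (d + 1)}, μ.val ≠ ν.val → Γ μ * Γ ν = -(Γ ν * Γ μ) := fun {μ ν} h => by
    have := gamma_anticomm hΓ (μ := μ) (ν := ν) fun h' => h (congrArg Fin.val h')
    rw [this]; simp
  have h10 : Γ 1 * Γ 0 = -(Γ 0 * Γ 1) := ha (by rw [h1]; simp)
  have h20 : Γ 2 * Γ 0 = -(Γ 0 * Γ 2) := ha (by rw [h2]; simp)
  have h21 : Γ 2 * Γ 1 = -(Γ 1 * Γ 2) := ha (by rw [h2, h1]; simp)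
  have h30 : Γ (Fin.last d) * Γ 0 = -(Γ 0 * Γ (Fin.last d)) := ha (by simp; omega)
  have h31 : Γ (Fin.last d) * Γ 1 = -(Γ 1 * Γ (Fin.last d)) := ha (by rw [h1]; simp; omega)
  have h32 : Γ (Fin.last d) * Γ 2 = -(Γ 2 * Γ (Fin.last d)) := ha (by rw [h2]; simp; omega)
  have hs1 : Γ 1 * Γ 1 = 1 := gamma_sq_of_ne_zero hΓ fun h => by have := congrArg Fin.val h; rw [h1] at this; simp at this
  have hs2 : Γ 2 * Γ 2 = 1 := gamma_sq_of_ne_zero hΓ fun h => by have := congrArg Fin.val h; rw [h2] at this; simp at this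
  have hs3 : Γ (Fin.last d) * Γ (Fin.last d) = 1 :=
    gamma_sq_of_ne_zero hΓ fun h => by simp [Fin.ext_iff] at h; omega
  unfold gammaTail
  generalize Γ 1 = b at *
  generalize Γ 2 = c at *
  generalize Γ (Fin.last d) = e at *
  have hs0 := gamma_zero_sq hΓ
  generalize Γ 0 = a at *
  calc a * b * c * e * (a * b * c * e) = a * b * c * (e * a) * b * c * e := by noncomm_ring
    _ = -(a * b * (c * a) * (e * b) * c * e) := by rw [h30]; noncomm_ring
    _ = -(a * (b * a) * (c * b) * (e * c) * e) := by rw [h20, h31]; noncomm_ring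
    _ = -((a * a) * (b * b) * (c * c) * (e * e)) * (-1) * (-1) * (-1) * (-1) * (-1) * (-1) * (-1) := by
      rw [h10, h21, h32]; noncomm_ring
    _ = -1 := by rw [hs0, hs1, hs2, hs3]; noncomm_ring

theorem gammaSimple_sq (hd : 3 < d) (hΓ : IsClifford Γ) (i : Fin d) :
    gammaSimple Γ i * gammaSimple Γ i = -1 := by
  by_cases hi : i.val + 1 < d
  · rw [gammaSimple_of_lt hi]
    have h1 : Γ ⟨i.val + 2, by omega⟩ * Γ i.succ = -(Γ i.succ * Γ ⟨i.val + 2, by omega⟩) := by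
      have := gamma_anticomm hΓ (μ := ⟨i.val + 2, by omega⟩) (ν := i.succ) (by simp [Fin.ext_iff])
      rw [this]; simp
    have hs1 : Γ i.succ * Γ i.succ = 1 := gamma_sq_of_ne_zero hΓ (by simp [Fin.ext_iff])
    have hs2 : Γ ⟨i.val + 2, by omega⟩ * Γ ⟨i.val + 2, by omega⟩ = 1 :=
      gamma_sq_of_ne_zero hΓ (by simp [Fin.ext_iff])
    rw [mul_assoc, ← mul_assoc (Γ ⟨i.val + 2, by omega⟩), h1, neg_mul, mul_assoc, hs2, mul_one,
      mul_neg, hs1]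
  · rcases gammaSimple_last hd hΓ hi with h | h <;> rw [h]
    · exact gammaTail_sq hd hΓ
    · rw [neg_mul_neg, gammaTail_sq hd hΓ]

theorem gammaSimple_transpose (hd : 3 < d) (hΓ : IsClifford Γ) (ho : IsOrthogonalChoice Γ)
    (i : Fin d) : (gammaSimple Γ i).transpose = -gammaSimple Γ i := by
  have h0 : (Γ 0).transpose = -Γ 0 := by rw [ho]; simp [minkowski]
  have hp : ∀ {μ : Fin (d + 1)}, μ ≠ 0 → (Γ μ).transpose = Γ μ := fun {μ} h => by
    rw [ho]; simp [minkowski, h]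
  have ha : ∀ {μ ν : Fin (d + 1)}, μ.val ≠ ν.val → Γ μ * Γ ν = -(Γ ν * Γ μ) := fun {μ ν} h => by
    have := gamma_anticomm hΓ (μ := μ) (ν := ν) fun h' => h (congrArg Fin.val h')
    rw [this]; simp
  by_cases hi : i.val + 1 < d
  · rw [gammaSimple_of_lt hi, Matrix.transpose_mul, hp (by simp [Fin.ext_iff]),
      hp (by simp [Fin.ext_iff]), ha (by simp)]
  · have h1 := val_one_of_lt hd
    have h2 := val_two_of_lt hd
    have ht : (gammaTail Γ).transpose = -gammaTail Γ := by
      have h10 : Γ 1 * Γ 0 = -(Γ 0 * Γ 1) := ha (by rw [h1]; simp)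
      have h20 : Γ 2 * Γ 0 = -(Γ 0 * Γ 2) := ha (by rw [h2]; simp)
      have h21 : Γ 2 * Γ 1 = -(Γ 1 * Γ 2) := ha (by rw [h2, h1]; simp)
      have h30 : Γ (Fin.last d) * Γ 0 = -(Γ 0 * Γ (Fin.last d)) := ha (by simp; omega)
      have h31 : Γ (Fin.last d) * Γ 1 = -(Γ 1 * Γ (Fin.last d)) := ha (by rw [h1]; simp; omega)
      have h32 : Γ (Fin.last d) * Γ 2 = -(Γ 2 * Γ (Fin.last d)) := ha (by rw [h2]; simp; omega)
      unfold gammaTail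
      rw [Matrix.transpose_mul, Matrix.transpose_mul, Matrix.transpose_mul, h0,
        hp (μ := 1) (fun h => by have := congrArg Fin.val h; rw [h1] at this; simp at this),
        hp (μ := 2) (fun h => by have := congrArg Fin.val h; rw [h2] at this; simp at this),
        hp (μ := Fin.last d) (fun h => by simp [Fin.ext_iff] at h; omega)]
      generalize Γ 1 = b at *
      generalize Γ 2 = c at *
      generalize Γ (Fin.last d) = e at *
      generalize Γ 0 = a at *
      calc e * (c * (b * -a)) = -(e * c * (b * a)) := by noncomm_ring
        _ = -(c * (e * a) * b) := by rw [h10, h32]; noncomm_ring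
        _ = (c * a) * (e * b) := by rw [h30]; noncomm_ring
        _ = a * (c * b) * e := by rw [h20, h31]; noncomm_ring
        _ = _ := by rw [h21]; noncomm_ring
    rcases gammaSimple_last hd hΓ hi with h | h <;> rw [h]
    · exact ht
    · rw [Matrix.transpose_neg, ht]

/-- For anticommuting x and y, [x/2, y/2] = xy/2, and a second bracket uses x² = -1 to give -y/2.
The factor 1/2 is what normalises the relation. -/
theorem gammaSimple_berman {A : Type*} [Ring A] [Algebra ℝ A] {x y : A} (hx : x * x = -1) :
    (SignComm (-1) x y →
      ⁅(1 / 2 : ℝ) • x, ⁅(1 / 2 : ℝ) • x, (1 / 2 : ℝ) • y⁆⁆ + (1 / 2 : ℝ) • y = 0) ∧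
    (SignComm 1 x y → ⁅(1 / 2 : ℝ) • x, (1 / 2 : ℝ) • y⁆ = 0) := by
  have hlie : ⁅(1 / 2 : ℝ) • x, (1 / 2 : ℝ) • y⁆ = (1 / 4 : ℝ) • (x * y - y * x) := by
    rw [Ring.lie_def]
    simp only [smul_mul_assoc, mul_smul_comm, smul_smul, ← smul_sub]
    norm_num
  constructor
  · intro h
    have hyx : y * x = -(x * y) := by rw [h]; simp
    have hz : ⁅(1 / 2 : ℝ) • x, (1 / 2 : ℝ) • y⁆ = (1 / 2 : ℝ) • (x * y) := by
      rw [hlie, hyx]; module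
    have h1 : x * (x * y) = -y := by rw [← mul_assoc, hx]; simp
    have h2 : x * y * x = y := by rw [mul_assoc, hyx, mul_neg, h1, neg_neg]
    rw [hz, Ring.lie_def]
    simp only [smul_mul_assoc, mul_smul_comm, smul_smul, h1, h2]
    module
  · intro h
    rw [hlie, h]; simp

end Gamma

end AE

/-! ### Multiplicativity of Γ on the root lattice modulo signs. -/

namespace AE

/-! ### Equality up to sign -/

section SignEq

variable {R : Type*} [Ring R]

/-- `x` and `y` agree up to sign. -/
def SignEq (x y : R) : Prop := x = y ∨ x = -y

namespace SignEq

variable {x y z w : R}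

theorem refl (x : R) : SignEq x x := .inl rfl

theorem symm (h : SignEq x y) : SignEq y x := by
  rcases h with rfl | rfl
  exacts [.inl rfl, .inr (neg_neg y).symm]

theorem trans (h : SignEq x y) (h' : SignEq y z) : SignEq x z := by
  rcases h with rfl | rfl <;> rcases h' with rfl | rfl
  exacts [.inl rfl, .inr rfl, .inr rfl, .inl (neg_neg z)]

instance : Trans (SignEq (R := R)) SignEq SignEq := ⟨trans⟩

theorem mul (h : SignEq x y) (h' : SignEq z w) : SignEq (x * z) (y * w) := by
  rcases h with rfl | rfl <;> rcases h' with rfl | rfl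
  · exact .inl rfl
  · exact .inr (mul_neg _ _)
  · exact .inr (neg_mul _ _)
  · exact .inl (neg_mul_neg _ _)

theorem mul_self_eq (h : SignEq x y) : x * x = y * y := by
  rcases h with rfl | rfl
  exacts [rfl, neg_mul_neg _ _]

theorem mul_prod_comm {n : ℕ} {f : Fin n → R} (h : ∀ a, SignEq (x * f a) (f a * x)) :
    SignEq (x * (List.ofFn f).prod) ((List.ofFn f).prod * x) := by
  induction n with
  | zero => simpa using refl x
  | succ n ih =>
    rw [List.ofFn_succ, List.prod_cons]
    set P := (List.ofFn fun i => f i.succ).prod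
    calc SignEq (x * (f 0 * P)) (f 0 * (x * P)) := by
          rw [← mul_assoc, ← mul_assoc]; exact (h 0).mul (refl P)
      SignEq _ (f 0 * P * x) := by
          rw [mul_assoc]; exact (refl _).mul (ih fun a => h a.succ)

theorem prod_mul_prod {n : ℕ} {f g : Fin n → R} (h : ∀ a b, SignEq (g a * f b) (f b * g a)) :
    SignEq (List.ofFn fun a => f a * g a).prod ((List.ofFn f).prod * (List.ofFn g).prod) := by
  induction n with
  | zero => simpa using refl (1 : R)
  | succ n ih =>
    simp only [List.ofFn_succ, List.prod_cons]
    have h0 := mul_prod_comm (x := g 0) (f := fun b => f b.succ) fun b => h 0 b.succ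
    have h1 := ih (f := fun a => f a.succ) (g := fun a => g a.succ) fun a b => h a.succ b.succ
    generalize (List.ofFn fun a => f a.succ).prod = F at *
    generalize (List.ofFn fun a => g a.succ).prod = G at *
    refine ((refl _).mul h1).trans ?_
    have := ((refl (f 0)).mul h0).mul (refl G)
    simpa only [mul_assoc] using this

theorem prod_one {n : ℕ} {f : Fin n → R} (h : ∀ a, SignEq (f a) 1) :
    SignEq (List.ofFn f).prod 1 := by
  induction n with
  | zero => simpa using refl (1 : R)
  | succ n ih =>
    rw [List.ofFn_succ, List.prod_cons]
    simpa using (h 0).mul (ih fun a => h a.succ)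

end SignEq

theorem prod_ofFn_eq_single {M : Type*} [Monoid M] {n : ℕ} {f : Fin n → M} (i : Fin n)
    (h : ∀ a, a ≠ i → f a = 1) : (List.ofFn f).prod = f i := by
  induction n with
  | zero => exact i.elim0
  | succ n ih =>
    rw [List.ofFn_succ, List.prod_cons]
    cases i using Fin.cases with
    | zero =>
      rw [List.prod_eq_one, mul_one]
      simp only [List.mem_ofFn]
      rintro _ ⟨a, rfl⟩
      exact h _ (Fin.succ_ne_zero a)
    | succ i =>
      rw [h 0 (Fin.succ_ne_zero i).symm, one_mul]
      exact ih i fun a ha => h _ fun h' => ha (Fin.succ_injective _ h')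

theorem prod_ofFn_eq_pair {M : Type*} [Monoid M] {n : ℕ} {f : Fin n → M} {i j : Fin n}
    (hij : i < j) (h : ∀ a, a ≠ i → a ≠ j → f a = 1) : (List.ofFn f).prod = f i * f j := by
  induction n with
  | zero => exact i.elim0
  | succ n ih =>
    rw [List.ofFn_succ, List.prod_cons]
    cases j using Fin.cases with
    | zero => exact absurd hij (Fin.not_lt_zero i)
    | succ j =>
      cases i using Fin.cases with
      | zero =>
        congr 1
        exact prod_ofFn_eq_single j fun a ha =>
          h _ (Fin.succ_ne_zero a) fun h' => ha (Fin.succ_injective _ h')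
      | succ i =>
        rw [h 0 (Fin.succ_ne_zero i).symm (Fin.succ_ne_zero j).symm, one_mul]
        exact ih (Fin.succ_lt_succ_iff.1 hij) fun a ha ha' =>
          h _ (fun h' => ha (Fin.succ_injective _ h')) fun h' => ha' (Fin.succ_injective _ h')

end SignEq

section Zpow

variable {N : ℕ} {x y : Matrix (Fin N) (Fin N) ℝ}

theorem isUnit_det_of_signEq (hx : SignEq (x * x) 1) : IsUnit x.det := by
  rw [← Matrix.isUnit_iff_isUnit_det]
  rcases hx with h | h
  · exact .of_mul_eq_one _ h
  · exact .of_mul_eq_one (-x) (by rw [mul_neg, h, neg_neg])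

/-- Modulo signs x is its own inverse, so its powers depend only on parity. -/
theorem zpow_signEq (hx : SignEq (x * x) 1) (n : ℤ) : SignEq (x ^ n) 1 ∨ SignEq (x ^ n) x := by
  have hu := isUnit_det_of_signEq hx
  have hinv : SignEq x⁻¹ x := by
    have := (SignEq.refl x⁻¹).mul hx
    rw [← mul_assoc, Matrix.nonsing_inv_mul _ hu, one_mul, mul_one] at this
    exact this.symm
  induction n using Int.induction_on with
  | zero => exact .inl (by simpa using SignEq.refl _)
  | succ n ih =>
    rw [Matrix.zpow_add_one hu]
    rcases ih with h | h
    · exact .inr (by simpa using h.mul (SignEq.refl x))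
    · exact .inl ((h.mul (SignEq.refl x)).trans hx)
  | pred n ih =>
    rw [Matrix.zpow_sub_one hu]
    rcases ih with h | h
    · exact .inr (by simpa using h.mul hinv)
    · exact .inl ((h.mul hinv).trans hx)

theorem zpow_mul_self (hx : SignEq (x * x) 1) (n : ℤ) : SignEq (x ^ n * x ^ n) 1 := by
  rcases zpow_signEq hx n with h | h
  · simpa using h.mul h
  · exact (h.mul h).trans hx

theorem zpow_mul_comm (hx : SignEq (x * x) 1) (h : SignEq (x * y) (y * x)) (n : ℤ) :
    SignEq (x ^ n * y) (y * x ^ n) := by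
  rcases zpow_signEq hx n with hn | hn
  · refine (hn.mul (SignEq.refl y)).trans (SignEq.trans ?_ ((SignEq.refl y).mul hn.symm))
    simpa using SignEq.refl y
  · exact (hn.mul (SignEq.refl y)).trans (h.trans ((SignEq.refl y).mul hn.symm))

end Zpow

/-! ### The matrices attached to the root lattice -/

section Root

variable {d N : ℕ} {Γ : Fin (d + 1) → Matrix (Fin N) (Fin N) ℝ}

theorem gamma_mul_self_signEq (hΓ : IsClifford Γ) (μ : Fin (d + 1)) : SignEq (Γ μ * Γ μ) 1 := by
  rw [gamma_sq hΓ]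
  split_ifs <;> simp [SignEq]

theorem gamma_mul_comm_signEq (hΓ : IsClifford Γ) (μ ν : Fin (d + 1)) :
    SignEq (Γ μ * Γ ν) (Γ ν * Γ μ) := by
  by_cases h : μ = ν
  · subst h; exact .refl _
  · right
    have := gamma_anticomm hΓ h
    rw [this]; simp

theorem gamma_mul_gammaStar_signEq (hΓ : IsClifford Γ) (μ : Fin (d + 1)) :
    SignEq (Γ μ * gammaStar Γ) (gammaStar Γ * Γ μ) :=
  SignEq.mul_prod_comm fun ν => gamma_mul_comm_signEq hΓ μ ν

/-- Modulo signs all gamma matrices commute and square to 1, hence so do their products. -/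
theorem gammaStar_mul_self_signEq (hΓ : IsClifford Γ) :
    SignEq (gammaStar Γ * gammaStar Γ) 1 :=
  (SignEq.prod_mul_prod fun μ ν => gamma_mul_comm_signEq hΓ μ ν).symm.trans
    (SignEq.prod_one fun μ => gamma_mul_self_signEq hΓ μ)

theorem gamma_zpow_mul_comm (hΓ : IsClifford Γ) (μ ν : Fin (d + 1)) (m n : ℤ) :
    SignEq (Γ μ ^ m * Γ ν ^ n) (Γ ν ^ n * Γ μ ^ m) :=
  zpow_mul_comm (gamma_mul_self_signEq hΓ μ)
    (zpow_mul_comm (gamma_mul_self_signEq hΓ ν) (gamma_mul_comm_signEq hΓ ν μ) n).symm m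

/-- The factor `Γ_1^{p_1} ⋯ Γ_d^{p_d}` of `gammaRoot Γ p`. -/
def gammaProd (Γ : Fin (d + 1) → Matrix (Fin N) (Fin N) ℝ) (p : Fin d → ℤ) :
    Matrix (Fin N) (Fin N) ℝ := (List.ofFn fun a : Fin d => Γ a.succ ^ p a).prod

theorem gammaProd_mul_self (hΓ : IsClifford Γ) (p : Fin d → ℤ) :
    SignEq (gammaProd Γ p * gammaProd Γ p) 1 :=
  (SignEq.prod_mul_prod fun a b => gamma_zpow_mul_comm hΓ a.succ b.succ (p a) (p b)).symm.trans
    (SignEq.prod_one fun _ => zpow_mul_self (gamma_mul_self_signEq hΓ _) _)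

theorem gammaProd_add (hΓ : IsClifford Γ) (p q : Fin d → ℤ) :
    SignEq (gammaProd Γ (p + q)) (gammaProd Γ p * gammaProd Γ q) := by
  refine SignEq.trans (.inl ?_)
    (SignEq.prod_mul_prod fun a b => gamma_zpow_mul_comm hΓ a.succ b.succ (q a) (p b))
  unfold gammaProd
  congr 2
  funext a
  exact Matrix.zpow_add (isUnit_det_of_signEq (gamma_mul_self_signEq hΓ _)) _ _

theorem gammaStar_zpow_mul_gammaProd (hΓ : IsClifford Γ) (n : ℤ) (p : Fin d → ℤ) :
    SignEq (gammaStar Γ ^ n * gammaProd Γ p) (gammaProd Γ p * gammaStar Γ ^ n) :=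
  SignEq.mul_prod_comm fun _ => zpow_mul_comm (gammaStar_mul_self_signEq hΓ)
    (zpow_mul_comm (gamma_mul_self_signEq hΓ _) (gamma_mul_gammaStar_signEq hΓ _) _).symm n

theorem gammaRoot_mul_self_signEq (hΓ : IsClifford Γ) (p : Fin d → ℤ) :
    SignEq (gammaRoot Γ p * gammaRoot Γ p) 1 := by
  set s := (∑ a, p a) / ((d : ℤ) - 1) with hs
  change SignEq (gammaProd Γ p * gammaStar Γ ^ s * (gammaProd Γ p * gammaStar Γ ^ s)) 1
  have h1 := gammaStar_zpow_mul_gammaProd hΓ s p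
  have h2 := gammaProd_mul_self hΓ p
  have h3 := zpow_mul_self (gammaStar_mul_self_signEq hΓ) s
  have h4 := ((SignEq.refl (gammaProd Γ p)).mul h1).mul (SignEq.refl (gammaStar Γ ^ s))
  have h5 := h2.mul h3
  simp only [mul_assoc, mul_one] at h4 h5 ⊢
  exact h4.trans h5

/-- The exponent of Γ_* is additive because the division is exact for p; everything else is
reordering of factors that commute up to sign. -/
theorem gammaRoot_add (hd : 3 < d) (hΓ : IsClifford Γ) {p q : Fin d → ℤ} (hp : p ∈ rootLattice d) :
    SignEq (gammaRoot Γ (p + q)) (gammaRoot Γ p * gammaRoot Γ q) := by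
  have hdiv : (∑ a, (p + q) a) / ((d : ℤ) - 1) =
      (∑ a, p a) / ((d : ℤ) - 1) + (∑ a, q a) / ((d : ℤ) - 1) := by
    simp only [Pi.add_apply]
    rw [Finset.sum_add_distrib, Int.add_ediv_of_dvd_left (dvd_sum_of_mem_rootLattice hd hp)]
  unfold gammaRoot
  rw [hdiv, Matrix.zpow_add (isUnit_det_of_signEq (gammaStar_mul_self_signEq hΓ))]
  set s := (∑ a, p a) / ((d : ℤ) - 1)
  set t := (∑ a, q a) / ((d : ℤ) - 1)
  change SignEq (gammaProd Γ (p + q) * (gammaStar Γ ^ s * gammaStar Γ ^ t))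
    (gammaProd Γ p * gammaStar Γ ^ s * (gammaProd Γ q * gammaStar Γ ^ t))
  have h1 := (gammaProd_add hΓ p q).mul (SignEq.refl (gammaStar Γ ^ s * gammaStar Γ ^ t))
  have h2 := ((SignEq.refl (gammaProd Γ p)).mul (gammaStar_zpow_mul_gammaProd hΓ s q)).mul
    (SignEq.refl (gammaStar Γ ^ t))
  simp only [mul_assoc] at h1 h2 ⊢
  exact h1.trans h2.symm

theorem gammaRoot_zero : gammaRoot Γ (0 : Fin d → ℤ) = 1 := by
  simp [gammaRoot]

theorem gammaRoot_neg (hd : 3 < d) (hΓ : IsClifford Γ) {p : Fin d → ℤ} (hp : p ∈ rootLattice d) :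
    SignEq (gammaRoot Γ (-p)) (gammaRoot Γ p) := by
  have h := gammaRoot_add hd hΓ (q := p) (neg_mem hp)
  rw [neg_add_cancel, gammaRoot_zero] at h
  have h1 := h.mul (SignEq.refl (gammaRoot Γ p))
  rw [one_mul, mul_assoc] at h1
  refine (h1.trans ?_).symm
  simpa using (SignEq.refl (gammaRoot Γ (-p))).mul (gammaRoot_mul_self_signEq hΓ p)

theorem gammaRoot_simpleRoot_of_lt (hd : 3 < d) (hΓ : IsClifford Γ) {i : Fin d}
    (hi : i.val + 1 < d) : gammaRoot Γ (simpleRoot i) = gammaSimple Γ i := by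
  rw [gammaRoot, sum_simpleRoot hd, if_pos hi, Int.zero_ediv, zpow_zero, mul_one,
    prod_ofFn_eq_pair (i := i) (j := ⟨i.val + 1, hi⟩) (by simp [Fin.lt_def])]
  · rw [gammaSimple_of_lt hi]
    -- The exponent -1 gives Γ_{i+1}⁻¹, which equals Γ_{i+1} as its index is space-like.
    have h2 : simpleRoot i ⟨i.val + 1, hi⟩ = -1 := by simp [simpleRoot, hi, Fin.ext_iff]
    have h1 : simpleRoot i i = 1 := by simp [simpleRoot, hi]
    rw [h1, h2, zpow_one, Matrix.zpow_neg_one]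
    congr 1
    exact Matrix.inv_eq_right_inv (gamma_sq_of_ne_zero hΓ (by simp [Fin.ext_iff]))
  · intro a h1 h2
    have : simpleRoot i a = 0 := by
      rw [Ne, Fin.ext_iff] at h2
      simp only at h2
      simp [simpleRoot, hi, h1, h2]
    rw [this, zpow_zero]

theorem gammaProd_simpleRoot_last (hd : 3 < d) (hΓ : IsClifford Γ) {i : Fin d}
    (hi : ¬ i.val + 1 < d) : gammaProd Γ (simpleRoot i) = gammaMiddle Γ := by
  obtain ⟨m, rfl⟩ : ∃ m, d = m + 3 := ⟨d - 3, by omega⟩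
  unfold gammaProd gammaMiddle
  -- The coordinate 2 of α_d contributes Γ_d² = 1, so that only the product from 3 to d - 1
  -- survives.
  have hl : Γ (Fin.last (m + 2)).succ ^ (2 : ℤ) = 1 := by
    rw [show (2 : ℤ) = ((2 : ℕ) : ℤ) from rfl, zpow_natCast, pow_two]
    exact gamma_sq_of_ne_zero hΓ (Fin.succ_ne_zero _)
  have hv : ∀ a : Fin (m + 3), simpleRoot i a =
      if a.val + 1 = m + 3 then 2 else if 2 ≤ a.val then 1 else 0 := fun a => if_neg hi
  rw [List.ofFn_succ, List.ofFn_succ, List.ofFn_succ_last]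
  simp only [hv, List.prod_cons, List.prod_append, List.prod_nil, mul_one]
  have e1 : (Fin.last m).succ.succ = Fin.last (m + 2) := rfl
  simp only [e1, Fin.val_last, if_true, hl, mul_one, Fin.val_zero, Fin.val_succ]
  simp only [show ¬ (0 + 1 = m + 3) by omega, show ¬ (0 + 1 + 1 = m + 3) by omega,
    show ¬ (2 ≤ 0) by omega, show ¬ (2 ≤ 0 + 1) by omega, if_false, zpow_zero, one_mul]
  congr 2
  funext a
  have := a.2
  rw [if_neg (by simp; omega), if_pos (by omega), zpow_one]
  rfl

theorem gammaRoot_simpleRoot (hd : 3 < d) (hΓ : IsClifford Γ) (i : Fin d) :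
    gammaRoot Γ (simpleRoot i) = gammaSimple Γ i := by
  by_cases hi : i.val + 1 < d
  · exact gammaRoot_simpleRoot_of_lt hd hΓ hi
  · rw [gammaSimple, dif_neg hi, gammaRoot, sum_simpleRoot hd, if_neg hi,
      Int.ediv_self (by omega), zpow_one]
    congr 1
    exact gammaProd_simpleRoot_last hd hΓ hi

theorem gammaRoot_zsmul_simpleRoot (hd : 3 < d) (hΓ : IsClifford Γ) (i : Fin d) (n : ℤ) :
    (Even n → SignEq (gammaRoot Γ (n • simpleRoot i)) 1) ∧
    (Odd n → SignEq (gammaRoot Γ (n • simpleRoot i)) (gammaSimple Γ i)) := by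
  have hev : ∀ n : ℤ, Even n → SignEq (gammaRoot Γ (n • simpleRoot i)) 1 := by
    rintro _ ⟨m, rfl⟩
    rw [add_smul]
    exact (gammaRoot_add hd hΓ (zsmul_mem (simpleRoot_mem i) m)).trans
      (gammaRoot_mul_self_signEq hΓ _)
  refine ⟨hev n, ?_⟩
  rintro ⟨m, rfl⟩
  rw [add_smul, one_smul]
  refine (gammaRoot_add hd hΓ (zsmul_mem (simpleRoot_mem i) _)).trans ?_
  rw [gammaRoot_simpleRoot hd hΓ]
  simpa using (hev (2 * m) (even_two_mul m)).mul (SignEq.refl (gammaSimple Γ i))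

end Root

end AE

/-! ### Commutation, square and transpose relations, exponentials, and existence of Clifford
generators. -/

namespace AE

/-! ### Gamma relations -/

section Relations

variable {d N : ℕ} {Γ : Fin (d + 1) → Matrix (Fin N) (Fin N) ℝ}

theorem neg_one_zpow_neg (k : ℤ) : (-1 : ℝ) ^ (-k) = (-1) ^ k := by
  rw [zpow_neg, ← inv_zpow, inv_neg_one]

theorem neg_one_zpow_mul_self (k : ℤ) : (-1 : ℝ) ^ k * (-1) ^ k = 1 := by
  rw [← mul_zpow]; simp

theorem smul_mul_comm_mul {M : Type*} [Ring M] [Algebra ℝ M] {x y z : M} {k l : ℤ}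
    (hy : x * y = (-1 : ℝ) ^ k • (y * x)) (hz : x * z = (-1 : ℝ) ^ l • (z * x)) :
    x * (y * z) = (-1 : ℝ) ^ (k + l) • (y * z * x) := by
  rw [← mul_assoc, hy, smul_mul_assoc, mul_assoc, hz, mul_smul_comm, smul_smul, mul_assoc,
    zpow_add₀ (by norm_num)]

theorem smul_mul_comm_of_signEq {M : Type*} [Ring M] [Algebra ℝ M] {x y z : M} {k : ℤ}
    (hy : x * y = (-1 : ℝ) ^ k • (y * x)) (hz : SignEq z y) :
    x * z = (-1 : ℝ) ^ k • (z * x) := by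
  rcases hz with rfl | rfl
  · exact hy
  · rw [mul_neg, hy, neg_mul, smul_neg]

theorem smul_mul_comm_symm {M : Type*} [Ring M] [Algebra ℝ M] {x y : M} {k : ℤ}
    (h : x * y = (-1 : ℝ) ^ k • (y * x)) : y * x = (-1 : ℝ) ^ k • (x * y) := by
  rw [h, smul_smul, neg_one_zpow_mul_self, one_smul]

/-- Commutation signs multiply while φ adds, and the ambiguity Γ(p + q) = ±Γ(p)Γ(q) cancels because
the relation is linear in Γ(q). It serves first for x = Γ(α_i) and then, with the roles exchanged,
for x = Γ(p). -/
theorem gammaRoot_mul_comm_simple (hd : 3 < d) (hΓ : IsClifford Γ) {x : Matrix (Fin N) (Fin N) ℝ}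
    {φ : (Fin d → ℤ) → ℝ} (hφ : ∀ p q, φ (p + q) = φ p + φ q)
    (hs : ∀ i, ∃ k : ℤ, φ (simpleRoot i) = k ∧
      x * gammaSimple Γ i = (-1 : ℝ) ^ k • (gammaSimple Γ i * x))
    {q : Fin d → ℤ} (hq : q ∈ rootLattice d) :
    ∃ k : ℤ, φ q = k ∧ x * gammaRoot Γ q = (-1 : ℝ) ^ k • (gammaRoot Γ q * x) := by
  have h0 : φ 0 = 0 := by simpa using hφ 0 0
  induction hq using AddSubgroup.closure_induction with
  | mem q hq =>
    obtain ⟨i, rfl⟩ := hq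
    simpa only [gammaRoot_simpleRoot hd hΓ] using hs i
  | zero => exact ⟨0, by simp [h0], by simp [gammaRoot_zero]⟩
  | add p q hp hq ihp ihq =>
    obtain ⟨k, hk, hk'⟩ := ihp
    obtain ⟨l, hl, hl'⟩ := ihq
    exact ⟨k + l, by rw [hφ, hk, hl]; push_cast; rfl,
      smul_mul_comm_of_signEq (smul_mul_comm_mul hk' hl') (gammaRoot_add hd hΓ hp)⟩
  | neg p hp ih =>
    obtain ⟨k, hk, hk'⟩ := ih
    refine ⟨-k, ?_, ?_⟩
    · have := hφ p (-p)
      rw [add_neg_cancel, h0, hk] at this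
      push_cast
      linarith
    · rw [neg_one_zpow_neg]
      exact smul_mul_comm_of_signEq hk' (gammaRoot_neg hd hΓ hp)

theorem gammaSimple_mul_comm (hd : 3 < d) (hΓ : IsClifford Γ) (i j : Fin d) :
    gammaSimple Γ i * gammaSimple Γ j =
      (-1 : ℝ) ^ (cartan d i j) • (gammaSimple Γ j * gammaSimple Γ i) := by
  have h := gammaSimple_signComm hd hΓ i j
  unfold SignComm at h
  by_cases hij : i = j
  · subst hij
    rw [show cartan d i i = 2 by simp [cartan]]
    norm_num
  by_cases hJ : Joined d i j
  · rw [show cartan d i j = -1 by simp [cartan, hij, hJ], h, if_pos hJ]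
    norm_num
  · rw [show cartan d i j = 0 by simp [cartan, hij, hJ], h, if_neg hJ]
    norm_num

theorem gammaSimple_mul_gammaRoot (hd : 3 < d) (hΓ : IsClifford Γ) (i : Fin d) {q : Fin d → ℤ}
    (hq : q ∈ rootLattice d) : ∃ k : ℤ, dewitt (simpleRoot i) q = k ∧
      gammaSimple Γ i * gammaRoot Γ q = (-1 : ℝ) ^ k • (gammaRoot Γ q * gammaSimple Γ i) :=
  gammaRoot_mul_comm_simple hd hΓ (φ := dewitt (simpleRoot i)) (fun _ _ => dewitt_add_right _ _ _)
    (fun j => ⟨cartan d i j, by rw [dewitt_simpleRoot hd, wall_simpleRoot hd],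
      gammaSimple_mul_comm hd hΓ i j⟩) hq

theorem gammaRoot_mul_comm (hd : 3 < d) (hΓ : IsClifford Γ) {p q : Fin d → ℤ}
    (hp : p ∈ rootLattice d) (hq : q ∈ rootLattice d) : ∃ k : ℤ, dewitt p q = k ∧
      gammaRoot Γ p * gammaRoot Γ q = (-1 : ℝ) ^ k • (gammaRoot Γ q * gammaRoot Γ p) :=
  gammaRoot_mul_comm_simple hd hΓ (φ := dewitt p) (fun _ _ => dewitt_add_right _ _ _)
    (fun j => by
      obtain ⟨k, hk, hk'⟩ := gammaSimple_mul_gammaRoot hd hΓ j hp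
      exact ⟨k, by rw [dewitt_comm, hk], smul_mul_comm_symm hk'⟩) hq

/-- Half the norm of p + q is the sum of the half norms plus p·q, and p·q is precisely the exponent
of the sign for exchanging Γ(p) and Γ(q) in the square or the transpose of their product. An overall
sign affects neither identity. -/
theorem gammaRoot_square (hd : 3 < d) (hΓ : IsClifford Γ) {p : Fin d → ℤ}
    (hp : p ∈ rootLattice d) : ∃ k : ℤ, dewitt p p = 2 * (k : ℝ) ∧
      gammaRoot Γ p ^ 2 = (-1 : ℝ) ^ k • (1 : Matrix (Fin N) (Fin N) ℝ) ∧
      (IsOrthogonalChoice Γ → (gammaRoot Γ p).transpose = (-1 : ℝ) ^ k • gammaRoot Γ p) := by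
  induction hp using AddSubgroup.closure_induction with
  | mem q hq =>
    obtain ⟨i, rfl⟩ := hq
    rw [gammaRoot_simpleRoot hd hΓ]
    refine ⟨1, ?_, ?_, fun ho => ?_⟩
    · rw [dewitt_simpleRoot hd, wall_simpleRoot hd]
      simp [cartan]
    · rw [pow_two, gammaSimple_sq hd hΓ]; simp
    · rw [gammaSimple_transpose hd hΓ ho]; simp
  | zero => exact ⟨0, by simp [dewitt_zero_left], by simp [gammaRoot_zero],
      by simp [gammaRoot_zero]⟩
  | add p q hp hq ihp ihq =>
    obtain ⟨k, hk, hk', hk''⟩ := ihp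
    obtain ⟨l, hl, hl', hl''⟩ := ihq
    obtain ⟨m, hm, hm'⟩ := gammaRoot_mul_comm hd hΓ hp hq
    have hadd := gammaRoot_add hd hΓ (q := q) hp
    have hne : (-1 : ℝ) ≠ 0 := by norm_num
    refine ⟨k + l + m, ?_, ?_, fun ho => ?_⟩
    · rw [dewitt_add_left, dewitt_add_right, dewitt_add_right, dewitt_comm q p, hk, hl, hm]
      push_cast
      ring
    · rw [pow_two, hadd.mul_self_eq]
      calc gammaRoot Γ p * gammaRoot Γ q * (gammaRoot Γ p * gammaRoot Γ q)
          = gammaRoot Γ p * (gammaRoot Γ q * gammaRoot Γ p) * gammaRoot Γ q := by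
            simp only [mul_assoc]
        _ = (-1 : ℝ) ^ m • (gammaRoot Γ p ^ 2 * gammaRoot Γ q ^ 2) := by
            rw [smul_mul_comm_symm hm', mul_smul_comm, smul_mul_assoc, pow_two, pow_two]
            simp only [mul_assoc]
        _ = _ := by
            rw [hk', hl', smul_mul_smul_comm, one_mul, smul_smul, zpow_add₀ hne, zpow_add₀ hne]
            congr 1
            ring
    · have ht : (gammaRoot Γ p * gammaRoot Γ q).transpose =
          (-1 : ℝ) ^ (k + l + m) • (gammaRoot Γ p * gammaRoot Γ q) := by
        rw [Matrix.transpose_mul, hk'' ho, hl'' ho, smul_mul_smul_comm, smul_mul_comm_symm hm',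
          smul_smul, zpow_add₀ hne, zpow_add₀ hne, mul_comm ((-1 : ℝ) ^ l)]
      rcases hadd with h | h <;> rw [h]
      · exact ht
      · rw [Matrix.transpose_neg, ht, smul_neg]
  | neg p hp ih =>
    obtain ⟨k, hk, hk', hk''⟩ := ih
    have hneg := gammaRoot_neg hd hΓ hp
    refine ⟨k, by rw [dewitt_neg_left, dewitt_neg_right, neg_neg, hk], ?_, fun ho => ?_⟩
    · rw [pow_two, hneg.mul_self_eq, ← pow_two, hk']
    · rcases hneg with h | h <;> rw [h]
      · exact hk'' ho
      · rw [Matrix.transpose_neg, hk'' ho, smul_neg]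

end Relations

/-! ### Exponentials of complex structures -/

section Exp

/-- A matrix with square -1 is the image of i under a homomorphism ℂ → M_N(ℝ) of real algebras. It
is continuous, so it carries exp(πi) = -1 over. -/
theorem exp_pi_smul {N : ℕ} {x : Matrix (Fin N) (Fin N) ℝ} (hx : x * x = -1) :
    NormedSpace.exp (Real.pi • x) = -1 := by
  set φ : ℂ →ₐ[ℝ] Matrix (Fin N) (Fin N) ℝ := Complex.lift ⟨x, hx⟩
  have hφ : Continuous φ := φ.toLinearMap.continuous_of_finiteDimensional
  have hI : φ Complex.I = x := Complex.liftAux_apply_I x hx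
  have h1 : φ (Real.pi * Complex.I) = Real.pi • x := by
    rw [← hI, ← map_smul, Complex.real_smul]
  have h2 : φ (NormedSpace.exp (Real.pi * Complex.I)) =
      NormedSpace.exp (φ (Real.pi * Complex.I)) := by
    rw [NormedSpace.exp_eq_tsum ℝ, NormedSpace.exp_eq_tsum ℝ]
    refine ((NormedSpace.expSeries_summable' (𝕂 := ℝ) _).hasSum.map φ hφ).tsum_eq.symm.trans ?_
    simp only [Function.comp_def, map_smul, map_pow]
  rw [← h1, ← h2, ← Complex.exp_eq_exp_ℂ, Complex.exp_pi_mul_I, map_neg, map_one]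

end Exp

/-! ### Existence of Clifford generators -/

section Existence

/-- Doubling: start from a quarter turn of the plane as Γ_0, then replace each Γ_μ by diag(Γ_μ,
-Γ_μ) and add the block swap as a new symmetric generator of square 1. -/
theorem exists_clifford_fintype (d : ℕ) : ∃ (κ : Type) (_ : Fintype κ) (_ : DecidableEq κ)
    (_ : Nonempty κ) (Γ : Fin (d + 1) → Matrix κ κ ℝ),
    (∀ μ ν, Γ μ * Γ ν + Γ ν * Γ μ = (2 * minkowski d μ ν) • (1 : Matrix κ κ ℝ)) ∧
    ∀ μ, (Γ μ).transpose = minkowski d μ μ • Γ μ := by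
  induction d with
  | zero =>
    refine ⟨Fin 2, inferInstance, inferInstance, inferInstance, fun _ => !![0, 1; -1, 0], ?_, ?_⟩
    · intro μ ν
      fin_cases μ
      fin_cases ν
      ext i j
      fin_cases i <;> fin_cases j <;> norm_num [minkowski, Matrix.mul_apply]
    · intro μ
      fin_cases μ
      ext i j
      fin_cases i <;> fin_cases j <;> norm_num [minkowski]
  | succ d ih =>
    obtain ⟨κ, _, _, _, Γ, hΓ, ho⟩ := ih
    have hm : ∀ μ ν : Fin (d + 1),
        minkowski (d + 1) μ.castSucc ν.castSucc = minkowski d μ ν := fun μ ν => by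
      simp [minkowski, Matrix.diagonal_apply]
    have hml : ∀ μ : Fin (d + 1), minkowski (d + 1) μ.castSucc (Fin.last _) = 0 := fun μ => by
      simp [minkowski, (Fin.castSucc_lt_last μ).ne]
    have hlm : ∀ μ : Fin (d + 1), minkowski (d + 1) (Fin.last _) μ.castSucc = 0 := fun μ => by
      simp [minkowski, (Fin.castSucc_lt_last μ).ne']
    have hll : minkowski (d + 1) (Fin.last _) (Fin.last _) = 1 := by simp [minkowski]
    refine ⟨κ ⊕ κ, inferInstance, inferInstance, inferInstance,
      Fin.lastCases (Matrix.fromBlocks 0 1 1 0) fun μ => Matrix.fromBlocks (Γ μ) 0 0 (-Γ μ), ?_, ?_⟩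
    · intro μ ν
      rw [← Matrix.fromBlocks_one]
      cases μ using Fin.lastCases with
      | last =>
        cases ν using Fin.lastCases with
        | last =>
          simp [hll, Matrix.fromBlocks_multiply, two_smul]
        | cast ν =>
          simp [hlm, Matrix.fromBlocks_multiply, Matrix.fromBlocks_add]
      | cast μ =>
        cases ν using Fin.lastCases with
        | last =>
          simp [hml, Matrix.fromBlocks_multiply, Matrix.fromBlocks_add]
        | cast ν =>
          simp [hm, Matrix.fromBlocks_multiply, Matrix.fromBlocks_add, hΓ,
            Matrix.smul_one_eq_diagonal]
    · intro μ
      cases μ using Fin.lastCases with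
      | last => simp [hll, Matrix.fromBlocks_transpose]
      | cast μ => simp [hm, Matrix.fromBlocks_transpose, Matrix.fromBlocks_smul, ho]

theorem exists_clifford (d : ℕ) : ∃ N : ℕ, 0 < N ∧ ∃ Γ : Fin (d + 1) → Matrix (Fin N) (Fin N) ℝ,
    IsClifford Γ ∧ IsOrthogonalChoice Γ := by
  obtain ⟨κ, _, _, _, Γ, hΓ, ho⟩ := exists_clifford_fintype d
  refine ⟨Fintype.card κ, Fintype.card_pos,
    fun μ => Matrix.reindexAlgEquiv ℝ ℝ (Fintype.equivFin κ) (Γ μ), fun μ ν => ?_, fun μ => ?_⟩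
  · rw [← map_mul, ← map_mul, ← map_add, hΓ, map_smul, map_one]
  · rw [← map_smul, ← ho]
    rfl

end Existence

end AE

/-! ### The spinor representation and its values on real root vectors. -/

namespace AE

/-! ### The representation -/

section Representation

open KacMoody

variable {d N : ℕ} {Γ : Fin (d + 1) → Matrix (Fin N) (Fin N) ℝ}

theorem gammaSimple_joined (hd : 3 < d) (hΓ : IsClifford Γ) {i j : Fin d} (h : Joined d i j) :
    ⁅(1 / 2 : ℝ) • gammaSimple Γ i,
      ⁅(1 / 2 : ℝ) • gammaSimple Γ i, (1 / 2 : ℝ) • gammaSimple Γ j⁆⁆ +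
        (1 / 2 : ℝ) • gammaSimple Γ j = 0 := by
  have hc := gammaSimple_signComm hd hΓ i j
  rw [if_pos h] at hc
  exact (gammaSimple_berman (gammaSimple_sq hd hΓ i)).1 hc

theorem gammaSimple_not_joined (hd : 3 < d) (hΓ : IsClifford Γ) {i j : Fin d}
    (h : ¬ Joined d i j) :
    ⁅(1 / 2 : ℝ) • gammaSimple Γ i, (1 / 2 : ℝ) • gammaSimple Γ j⁆ = 0 := by
  have hc := gammaSimple_signComm hd hΓ i j
  rw [if_neg h] at hc
  exact (gammaSimple_berman (gammaSimple_sq hd hΓ i)).2 hc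

theorem cartan_eq_zero {i j : Fin d} (h : cartan d i j = 0) : ¬ Joined d i j := by
  intro hJ
  by_cases hij : i = j <;> simp [cartan, hij, hJ] at h

theorem cartan_eq_neg_one {i j : Fin d} (h : cartan d i j = -1) : Joined d i j := by
  by_contra hJ
  by_cases hij : i = j <;> simp [cartan, hij, hJ] at h

theorem bermanRelations_gammaSimple (hd : 3 < d) (hΓ : IsClifford Γ) :
    BermanRelations (cartan d) fun i => (1 / 2 : ℝ) • gammaSimple Γ i where
  xx _ _ h := gammaSimple_not_joined hd hΓ (cartan_eq_zero h)
  xxx _ _ h := gammaSimple_joined hd hΓ (cartan_eq_neg_one h)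

/-- The spinor representation of `K(AE_d)`. -/
theorem exists_spinor_representation (hd : 3 < d) (hΓ : IsClifford Γ) :
    ∃ ρ : K d →ₗ⁅ℝ⁆ Matrix (Fin N) (Fin N) ℝ,
      ∀ i, ρ (compactGen (cartan d) i) = (1 / 2 : ℝ) • gammaSimple Γ i :=
  exists_hom_of_bermanRelations (cartan_isSimplyLaced d) (bermanRelations_gammaSimple hd hΓ)

/-- The representation detects e_i: if e_i = 0, then f_i = -ω(e_i) and x_i vanish, whereas ρ(x_i) is
half a matrix of square -1. -/
theorem e_ne_zero (hd : 3 < d) (i : Fin d) : e (cartan d) i ≠ 0 := by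
  intro he
  obtain ⟨N, hN, Γ, hΓ, -⟩ := exists_clifford d
  obtain ⟨ρ, hρ⟩ := exists_spinor_representation hd hΓ
  have hf : f (cartan d) i = 0 := by
    have := involution_e (cartan d) i
    rw [he, map_zero] at this
    exact neg_eq_zero.1 this.symm
  have hx : compactGen (cartan d) i = 0 := by
    apply Subtype.ext
    change e (cartan d) i - f (cartan d) i = 0
    rw [he, hf, sub_zero]
  have hg : gammaSimple Γ i = 0 := by
    have := hρ i
    rw [hx, map_zero] at this
    exact (smul_eq_zero.1 this.symm).resolve_left (by norm_num)
  have hs := gammaSimple_sq hd hΓ i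
  rw [hg, mul_zero] at hs
  have : Nonempty (Fin N) := ⟨⟨0, hN⟩⟩
  exact neg_ne_zero.2 one_ne_zero hs.symm

theorem isSl2Triple_e (hd : 3 < d) (i : Fin d) :
    IsSl2Triple ⁅e (cartan d) i, -involution (cartan d) (e (cartan d) i)⁆ (e (cartan d) i)
      (-involution (cartan d) (e (cartan d) i)) := by
  have he : ⁅h (cartan d) i, e (cartan d) i⁆ = 2 • e (cartan d) i := by
    rw [lie_h_e, (cartan_isSimplyLaced d).diag]
    exact ofNat_zsmul _ _
  have hef : ⁅e (cartan d) i, f (cartan d) i⁆ = h (cartan d) i := by rw [lie_e_f, if_pos rfl]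
  rw [involution_e, neg_neg, hef]
  refine ⟨fun h0 => ?_, hef, he, ?_⟩
  · rw [h0, zero_lie, two_nsmul, ← two_smul ℝ] at he
    exact e_ne_zero hd i ((smul_eq_zero.1 he.symm).resolve_left two_ne_zero)
  · rw [lie_h_f, (cartan_isSimplyLaced d).diag]
    exact congrArg _ (ofNat_zsmul _ _)

theorem isRealRoot_simpleRoot (hd : 3 < d) (i : Fin d) : IsRealRoot (simpleRoot i) := by
  refine ⟨simpleRoot_mem i, fun h => e_ne_zero hd i ?_, ?_⟩
  · have hm := e_mem_weightSpace (A := cartan d) i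
    rw [← rootSpace_ofCoord hd, ofCoord_single, one_smul, h] at hm
    exact hm
  · rw [dewitt_simpleRoot hd, wall_simpleRoot hd]
    simp [cartan]

/-- Since G² = -1, (1 + G)(1 - G) = 2: the map is conjugation by (1 + G)/√2 = exp(πG/4). -/
theorem conj_of_comm {G x : Matrix (Fin N) (Fin N) ℝ} (hG : G * G = -1) (h : G * x = x * G) :
    (1 / 2 : ℝ) • ((1 + G) * ((1 / 2 : ℝ) • x) * (1 - G)) = (1 / 2 : ℝ) • x := by
  have : (1 + G) * x * (1 - G) = (2 : ℝ) • x := by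
    have h1 : (1 + G) * x * (1 - G) = x + (G * x - x * G) - G * x * G := by noncomm_ring
    rw [h1, h, mul_assoc, hG, mul_neg, mul_one]
    module
  rw [mul_smul_comm, smul_mul_assoc, this]
  module

/-- Here x(1 - G) = (1 + G)x, and (1 + G)² = 2G. -/
theorem conj_of_anticomm {G x : Matrix (Fin N) (Fin N) ℝ} (hG : G * G = -1)
    (h : G * x = -(x * G)) :
    (1 / 2 : ℝ) • ((1 + G) * ((1 / 2 : ℝ) • x) * (1 - G)) = (1 / 2 : ℝ) • (G * x) := by
  have : (1 + G) * x * (1 - G) = (2 : ℝ) • (G * x) := by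
    have h1 : (1 + G) * x * (1 - G) = x + G * x - x * G - G * x * G := by noncomm_ring
    rw [h1, h, neg_mul, mul_assoc, hG]
    simp only [mul_neg, mul_one]
    module
  rw [mul_smul_comm, smul_mul_assoc, this]
  module

/-- The fundamental reflections act on the image of the spinor representation by conjugation with
the group elements `exp (π / 2 • ρ (x i))`, up to normalisation. -/
theorem spinor_compactReflection (hd : 3 < d) (hΓ : IsClifford Γ)
    {ρ : K d →ₗ⁅ℝ⁆ Matrix (Fin N) (Fin N) ℝ}
    (hρ : ∀ i, ρ (compactGen (cartan d) i) = (1 / 2 : ℝ) • gammaSimple Γ i) (i : Fin d) (y : K d) :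
    ρ (compactReflection (cartan_isSimplyLaced d) i y) =
      (1 / 2 : ℝ) • ((1 + gammaSimple Γ i) * ρ y * (1 - gammaSimple Γ i)) := by
  set G := gammaSimple Γ i with hG
  have hsq : G * G = -1 := gammaSimple_sq hd hΓ i
  have hinv : (1 - G) * (1 + G) = (2 : ℝ) • 1 := by
    have : (1 - G) * (1 + G) = 1 - G * G := by noncomm_ring
    rw [this, hsq]; module
  let conj : Matrix (Fin N) (Fin N) ℝ →ₗ⁅ℝ⁆ Matrix (Fin N) (Fin N) ℝ :=
    { toFun := fun x => (1 / 2 : ℝ) • ((1 + G) * x * (1 - G))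
      map_add' := fun x y => by rw [mul_add, add_mul, smul_add]
      map_smul' := fun c x => by
        rw [mul_smul_comm, smul_mul_assoc, smul_comm, RingHom.id_apply]
      map_lie' := fun {x y} => by
        have key : ∀ x y, (1 / 2 : ℝ) • ((1 + G) * (x * y) * (1 - G)) =
            (1 / 2 : ℝ) • ((1 + G) * x * (1 - G)) * (1 / 2 : ℝ) • ((1 + G) * y * (1 - G)) := by
          intro x y
          rw [smul_mul_smul_comm]
          have : (1 + G) * x * (1 - G) * ((1 + G) * y * (1 - G)) =
              (1 + G) * x * ((1 - G) * (1 + G)) * y * (1 - G) := by simp only [mul_assoc]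
          rw [this, hinv, mul_smul_comm, mul_one, smul_mul_assoc, smul_mul_assoc, smul_smul]
          norm_num [mul_assoc]
        change (1 / 2 : ℝ) • ((1 + G) * ⁅x, y⁆ * (1 - G)) = ⁅_, _⁆
        rw [Ring.lie_def, Ring.lie_def, ← key, ← key, ← smul_sub, ← sub_mul, ← mul_sub] }
  -- Both sides are Lie homomorphisms, so they are compared on the generators x_j, where the
  -- reflection is the identity or the bracket with x_i.
  have hcomp : ρ.comp (compactReflection (cartan_isSimplyLaced d) i) = conj.comp ρ := by
    refine compact_hom_ext fun j => ?_
    change ρ (compactReflection _ i (compactGen _ j)) =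
      (1 / 2 : ℝ) • ((1 + G) * ρ (compactGen _ j) * (1 - G))
    have hGx : G * gammaSimple Γ j =
        (-1 : ℝ) ^ (cartan d i j) • (gammaSimple Γ j * G) := gammaSimple_mul_comm hd hΓ i j
    rw [hρ]
    rcases (cartan_isSimplyLaced d).trichotomy i j with ⟨rfl, -⟩ | ⟨-, hij⟩ | ⟨-, hij⟩
    · rw [compactReflection_compactGen_self, conj_of_comm hsq rfl, hρ]
    · rw [hij, zpow_zero, one_smul] at hGx
      rw [compactReflection_compactGen_of_eq_zero _ hij, conj_of_comm hsq hGx, hρ]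
    · rw [hij, zpow_neg_one, inv_neg_one, neg_one_smul] at hGx
      rw [compactReflection_compactGen_of_eq_neg_one _ hij, conj_of_anticomm hsq hGx,
        LieHom.map_lie, hρ, hρ, Ring.lie_def, smul_mul_smul_comm, smul_mul_smul_comm, ← smul_sub,
        ← neg_eq_iff_eq_neg.2 hGx]
      module
  exact LieHom.congr_fun hcomp y

/-- `c` is the coordinate vector of a norm-two weight with a standard root vector on which `ρ` takes
the value `Γ / 2`, up to sign. -/
def HasSpinorVector (Γ : Fin (d + 1) → Matrix (Fin N) (Fin N) ℝ)
    (ρ : K d →ₗ⁅ℝ⁆ Matrix (Fin N) (Fin N) ℝ) (c : Fin d → ℤ) : Prop :=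
  c ⬝ᵥ (cartan d).mulVec c = 2 ∧ ∃ e ∈ weightSpace (cartan d) c,
    IsSl2Triple ⁅e, -involution (cartan d) e⁆ e (-involution (cartan d) e) ∧
    SignEq (ρ (symmetrize (cartan d) e)) ((1 / 2 : ℝ) • gammaRoot Γ (ofCoord c))

theorem SignEq.smul {x y : Matrix (Fin N) (Fin N) ℝ} (h : SignEq x y) (a : ℝ) :
    SignEq (a • x) (a • y) := by
  rcases h with rfl | rfl
  exacts [.refl _, .inr (smul_neg a y)]

theorem _root_.IsSl2Triple.neg_neg {L : Type*} [LieRing L] {h e f : L} (t : IsSl2Triple h e f) :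
    IsSl2Triple h (-e) (-f) where
  h_ne_zero := t.h_ne_zero
  lie_e_f := by rw [neg_lie, lie_neg, _root_.neg_neg, t.lie_e_f]
  lie_h_e_nsmul := by rw [lie_neg, t.lie_h_e_nsmul, smul_neg]
  lie_h_f_nsmul := by rw [lie_neg, t.lie_h_f_nsmul, smul_neg]

theorem _root_.IsSl2Triple.map_injective {L L' : Type*} [LieRing L] [LieRing L'] [LieAlgebra ℝ L]
    [LieAlgebra ℝ L'] {h e f : L} (t : IsSl2Triple h e f) {φ : L →ₗ⁅ℝ⁆ L'}
    (hφ : Function.Injective φ) : IsSl2Triple (φ h) (φ e) (φ f) where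
  h_ne_zero := (map_ne_zero_iff φ hφ).2 t.h_ne_zero
  lie_e_f := by rw [← LieHom.map_lie, t.lie_e_f]
  lie_h_e_nsmul := by rw [← LieHom.map_lie, t.lie_h_e_nsmul, map_nsmul]
  lie_h_f_nsmul := by rw [← LieHom.map_lie, t.lie_h_f_nsmul, map_neg, map_nsmul]

theorem symmetrize_neg (x : Alg d) : symmetrize (cartan d) (-x) = -symmetrize (cartan d) x :=
  Subtype.ext (by
    change -x + involution (cartan d) (-x) = -(x + involution (cartan d) x)
    rw [map_neg, neg_add])

theorem symmetrize_involution (x : Alg d) :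
    symmetrize (cartan d) (involution (cartan d) x) = symmetrize (cartan d) x :=
  Subtype.ext (by
    change involution (cartan d) x + involution (cartan d) (involution (cartan d) x) =
      x + involution (cartan d) x
    rw [involution_involution, add_comm])

variable {ρ : K d →ₗ⁅ℝ⁆ Matrix (Fin N) (Fin N) ℝ}

theorem hasSpinorVector_single (hd : 3 < d) (hΓ : IsClifford Γ)
    (hρ : ∀ i, ρ (compactGen (cartan d) i) = (1 / 2 : ℝ) • gammaSimple Γ i) (i : Fin d) :
    HasSpinorVector Γ ρ (Pi.single i 1) := by
  refine ⟨by simp [cartan], e (cartan d) i, e_mem_weightSpace i, isSl2Triple_e hd i, .inl ?_⟩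
  have hs : symmetrize (cartan d) (e (cartan d) i) = compactGen (cartan d) i :=
    Subtype.ext (by
      change e (cartan d) i + involution (cartan d) (e (cartan d) i) =
        e (cartan d) i - f (cartan d) i
      rw [involution_e, sub_eq_add_neg])
  rw [hs, hρ, ofCoord_single, one_smul, gammaRoot_simpleRoot hd hΓ]

theorem HasSpinorVector.neg (hd : 3 < d) (hΓ : IsClifford Γ) {c : Fin d → ℤ}
    (hc : HasSpinorVector Γ ρ c) : HasSpinorVector Γ ρ (-c) := by
  obtain ⟨h2, e, he, ht, hs⟩ := hc
  -- For -α the root vector is -ω(e), the lowering element of the same triple; its symmetrisation is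
  -- minus that of e.
  refine ⟨by rw [Matrix.mulVec_neg, neg_dotProduct_neg, h2], -involution (cartan d) e,
    neg_mem (involution_mem_weightSpace he), ?_, ?_⟩
  · rw [map_neg, involution_involution, neg_neg]
    have := ht.symm
    rwa [lie_skew] at this
  · rw [symmetrize_neg, symmetrize_involution, map_neg, ofCoord_neg]
    exact SignEq.trans (.inr rfl) (hs.trans ((gammaRoot_neg hd hΓ (ofCoord_mem c)).symm.smul _))

/-- With k = α_i·α, Γ(s_i α) is Γ(α)Γ(α_i)^(-k) up to sign, which depends on k only modulo 2.
Conjugation by exp(πΓ(α_i)/4) gives the same two outcomes, since Γ(α_i) commutes or anticommutes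
with Γ(α) by the parity of k. -/
theorem HasSpinorVector.reflect (hd : 3 < d) (hΓ : IsClifford Γ)
    (hρ : ∀ i, ρ (compactGen (cartan d) i) = (1 / 2 : ℝ) • gammaSimple Γ i) (i : Fin d)
    {c : Fin d → ℤ} (hc : HasSpinorVector Γ ρ c) :
    HasSpinorVector Γ ρ (reflectCoord (cartan d) i c) := by
  obtain ⟨h2, e, he, ht, hs⟩ := hc
  have hA := cartan_isSimplyLaced d
  refine ⟨by rw [dotProduct_reflectCoord hA, h2], reflection hA i e,
    reflection_mem_weightSpace hA i he, ?_, ?_⟩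
  · have := ht.map_injective (reflection_injective hA i)
    rwa [LieHom.map_lie, map_neg, ← involution_reflection] at this
  · have hsq := gammaSimple_sq hd hΓ i
    rw [← compactReflection_symmetrize, spinor_compactReflection hd hΓ hρ]
    refine (SignEq.smul (((SignEq.refl _).mul hs).mul (.refl _)) _).trans ?_
    rw [ofCoord_reflectCoord]
    obtain ⟨k, hk, hcomm⟩ := gammaSimple_mul_gammaRoot hd hΓ i (ofCoord_mem c)
    have hk : (cartan d).mulVec c i = k := by
      rw [dewitt_simpleRoot_ofCoord hd] at hk
      exact_mod_cast hk
    rw [hk]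
    have hadd := gammaRoot_add (Γ := Γ) (q := (-k) • simpleRoot i) hd hΓ (ofCoord_mem c)
    have hz := gammaRoot_zsmul_simpleRoot hd hΓ i (-k)
    rcases Int.even_or_odd k with hk2 | hk2
    · rw [hk2.neg_one_zpow, one_smul] at hcomm
      rw [conj_of_comm hsq hcomm]
      refine SignEq.smul (SignEq.symm (hadd.trans ?_)) _
      simpa using (SignEq.refl (gammaRoot Γ (ofCoord c))).mul (hz.1 hk2.neg)
    · rw [hk2.neg_one_zpow, neg_one_smul] at hcomm
      rw [conj_of_anticomm hsq hcomm]
      exact SignEq.smul (SignEq.symm (hadd.trans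
        (((SignEq.refl _).mul (hz.2 hk2.neg)).trans (.inr (neg_eq_iff_eq_neg.1 hcomm.symm))))) _

theorem IsRealRoot.hasSpinorVector (hd : 3 < d) (hΓ : IsClifford Γ)
    (hρ : ∀ i, ρ (compactGen (cartan d) i) = (1 / 2 : ℝ) • gammaSimple Γ i) {c : Fin d → ℤ}
    (hc : IsRealRoot (ofCoord c)) : HasSpinorVector Γ ρ c := by
  obtain ⟨-, hne, hpos⟩ := hc
  rw [rootSpace_ofCoord hd] at hne
  rw [dewitt_ofCoord hd] at hpos
  exact real_root_induction (cartan_isSimplyLaced d) (cartan_mulVec_injective hd)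
    (hasSpinorVector_single hd hΓ hρ) (fun _ h => h.neg hd hΓ)
    (fun i _ h => h.reflect hd hΓ hρ i) hne (by exact_mod_cast hpos)

/-- The sign left open by the Weyl group argument is absorbed by e ↦ -e, which changes both e and
-ω(e) and keeps the triple. -/
theorem exists_root_vector (hd : 3 < d) (hΓ : IsClifford Γ)
    (hρ : ∀ i, ρ (compactGen (cartan d) i) = (1 / 2 : ℝ) • gammaSimple Γ i) {p : Fin d → ℤ}
    (hp : IsRealRoot p) : ∃ e ∈ rootSpace p,
      IsSl2Triple ⁅e, -involution (cartan d) e⁆ e (-involution (cartan d) e) ∧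
      ρ (symmetrize (cartan d) e) = (1 / 2 : ℝ) • gammaRoot Γ p := by
  obtain ⟨c, rfl⟩ := exists_ofCoord hp.1
  obtain ⟨-, e, he, ht, hs | hs⟩ := hp.hasSpinorVector hd hΓ hρ
  · exact ⟨e, by rwa [rootSpace_ofCoord hd], ht, hs⟩
  · refine ⟨-e, by rw [rootSpace_ofCoord hd]; exact neg_mem he, ?_, ?_⟩
    · have := ht.neg_neg
      rw [map_neg, neg_lie, lie_neg, neg_neg]
      exact this
    · rw [symmetrize_neg, map_neg, hs, neg_neg]

/-- Reflections preserve the norm, so a real root has norm exactly 2, and the square formula applies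
with exponent 1. The representation serves only to quote `IsRealRoot.hasSpinorVector`, which records
the norm. -/
theorem gammaRoot_mul_self_of_isRealRoot (hd : 3 < d) (hΓ : IsClifford Γ) {p : Fin d → ℤ}
    (hp : IsRealRoot p) : gammaRoot Γ p * gammaRoot Γ p = -1 := by
  obtain ⟨ρ, hρ⟩ := exists_spinor_representation hd hΓ
  obtain ⟨k, hk, hk', -⟩ := gammaRoot_square hd hΓ hp.1
  obtain ⟨c, rfl⟩ := exists_ofCoord hp.1
  have h2 := (hp.hasSpinorVector hd hΓ hρ).1
  rw [dewitt_ofCoord hd, h2] at hk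
  have hk1 : k = 1 := by
    push_cast at hk
    have : (k : ℝ) = 1 := by linarith
    exact_mod_cast this
  rw [← pow_two, hk', hk1]
  simp

end Representation

end AE

end

/-! ### Assembly of the main theorem. -/

theorem mainTheorem1 (d : ℕ) (hd : 3 < d) :
    -- the wall basis realises the Cartan matrix, and the exponent of `Γ_*` is an integer
    (∀ i j : Fin d, AE.dewitt (AE.simpleRoot i) (AE.simpleRoot j) = (AE.cartan d i j : ℝ)) ∧
    (∀ p ∈ AE.rootLattice d, ((d : ℤ) - 1) ∣ ∑ a, p a) ∧
    -- real Clifford generators exist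
    (∃ N : ℕ, 0 < N ∧ ∃ Γ : Fin (d + 1) → Matrix (Fin N) (Fin N) ℝ,
      AE.IsClifford Γ ∧ AE.IsOrthogonalChoice Γ) ∧
    ∀ (N : ℕ) (Γ : Fin (d + 1) → Matrix (Fin N) (Fin N) ℝ), AE.IsClifford Γ →
      -- equivalent forms of the matrix of the last simple root
      (AE.gammaMiddle Γ * AE.gammaStar Γ = AE.gammaStar Γ * AE.gammaMiddle Γ ∧
        AE.gammaMiddle Γ * AE.gammaStar Γ =
          ((-1 : ℝ) ^ ((d - 2) * (d - 3) / 2)) • (Γ 0 * Γ 1 * Γ 2 * Γ (Fin.last d))) ∧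
      -- the Berman relations
      (∀ i j : Fin d,
        (AE.Joined d i j →
          ⁅(1 / 2 : ℝ) • AE.gammaSimple Γ i,
            ⁅(1 / 2 : ℝ) • AE.gammaSimple Γ i, (1 / 2 : ℝ) • AE.gammaSimple Γ j⁆⁆ +
              (1 / 2 : ℝ) • AE.gammaSimple Γ j = 0) ∧
        (¬ AE.Joined d i j →
          ⁅(1 / 2 : ℝ) • AE.gammaSimple Γ i, (1 / 2 : ℝ) • AE.gammaSimple Γ j⁆ = 0)) ∧
      -- the representation, and its value on the real root vectors
      (∃ ρ : AE.K d →ₗ⁅ℝ⁆ Matrix (Fin N) (Fin N) ℝ,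
        (∀ i, ρ (KacMoody.compactGen (AE.cartan d) i) = (1 / 2 : ℝ) • AE.gammaSimple Γ i) ∧
        (∀ ρ' : AE.K d →ₗ⁅ℝ⁆ Matrix (Fin N) (Fin N) ℝ,
          (∀ i, ρ' (KacMoody.compactGen (AE.cartan d) i) = (1 / 2 : ℝ) • AE.gammaSimple Γ i) →
            ρ' = ρ) ∧
        ∀ p : Fin d → ℤ, AE.IsRealRoot p →
          ∃ e ∈ AE.rootSpace p,
            IsSl2Triple ⁅e, -KacMoody.involution (AE.cartan d) e⁆ e
              (-KacMoody.involution (AE.cartan d) e) ∧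
            ρ (KacMoody.symmetrize (AE.cartan d) e) = (1 / 2 : ℝ) • AE.gammaRoot Γ p) ∧
      -- it is double-valued
      (∀ p : Fin d → ℤ, AE.IsRealRoot p →
        NormedSpace.exp ((2 * Real.pi) • ((1 / 2 : ℝ) • AE.gammaRoot Γ p)) = -1) ∧
      -- the root formula extends the matrices of the simple roots multiplicatively
      (∀ i : Fin d, AE.IsRealRoot (AE.simpleRoot i) ∧
        AE.gammaRoot Γ (AE.simpleRoot i) = AE.gammaSimple Γ i) ∧
      (∀ p ∈ AE.rootLattice d, ∀ q ∈ AE.rootLattice d,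
        AE.gammaRoot Γ (p + q) = AE.gammaRoot Γ p * AE.gammaRoot Γ q ∨
        AE.gammaRoot Γ (p + q) = -(AE.gammaRoot Γ p * AE.gammaRoot Γ q)) ∧
      -- the gamma relations
      (∀ p ∈ AE.rootLattice d, ∀ q ∈ AE.rootLattice d, ∃ k : ℤ, AE.dewitt p q = (k : ℝ) ∧
        AE.gammaRoot Γ p * AE.gammaRoot Γ q =
          ((-1 : ℝ) ^ k) • (AE.gammaRoot Γ q * AE.gammaRoot Γ p)) ∧
      (∀ p ∈ AE.rootLattice d, ∃ k : ℤ, AE.dewitt p p = 2 * (k : ℝ) ∧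
        AE.gammaRoot Γ p ^ 2 = ((-1 : ℝ) ^ k) • (1 : Matrix (Fin N) (Fin N) ℝ) ∧
        (AE.IsOrthogonalChoice Γ →
          (AE.gammaRoot Γ p).transpose = ((-1 : ℝ) ^ k) • AE.gammaRoot Γ p)) := by
  refine ⟨fun i j => ?_, fun p hp => AE.dvd_sum_of_mem_rootLattice hd hp, AE.exists_clifford d,
    fun N Γ hΓ => ⟨⟨?_, ?_⟩, fun i j => ⟨AE.gammaSimple_joined hd hΓ,
      AE.gammaSimple_not_joined hd hΓ⟩, ?_, fun p hp => ?_, fun i =>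
      ⟨AE.isRealRoot_simpleRoot hd i, AE.gammaRoot_simpleRoot hd hΓ i⟩,
      fun p hp q _ => AE.gammaRoot_add hd hΓ hp,
      fun p hp q hq => AE.gammaRoot_mul_comm hd hΓ hp hq,
      fun p hp => AE.gammaRoot_square hd hΓ hp⟩⟩
  · rw [AE.dewitt_simpleRoot hd, AE.wall_simpleRoot hd]
  · rw [AE.gammaMiddle_mul_gammaStar hd hΓ, AE.gammaStar_mul_gammaMiddle hd hΓ]
  · rw [AE.gammaMiddle_mul_gammaStar hd hΓ, ← Int.cast_smul_eq_zsmul ℝ]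
    push_cast
    rfl
  · obtain ⟨ρ, hρ⟩ := AE.exists_spinor_representation hd hΓ
    exact ⟨ρ, hρ, fun ρ' hρ' => KacMoody.compact_hom_ext fun i => (hρ' i).trans (hρ i).symm,
      fun p hp => AE.exists_root_vector hd hΓ hρ hp⟩
  · rw [smul_smul, show 2 * Real.pi * (1 / 2) = Real.pi by ring]
    exact AE.exp_pi_smul (AE.gammaRoot_mul_self_of_isRealRoot hd hΓ hp)
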